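/- Let $a_1,a_2,a_3>0$. Let $\mathcal G$ be the graph with vertices $v_{k,\ell}=(ka_1,\ell a_2,0)$, $v_{k,\ell}^\pm=(ka_1,\ell a_2,\pm a_3/2)$, $(k,\ell)\in\mathbb Z^2$, and edges $e_{k+1/2,\ell}=(v_{k,\ell},v_{k+1,\ell})$, $e_{k,\ell+1/2}=(v_{k,\ell},v_{k,\ell+1})$, $e_{k,\ell}^\pm=(v_{k,\ell},v_{k,\ell}^\pm)$, each parametrized by the coordinate $x_1$, $x_2$ or $x_3$ along it. For $\beta\in\mathbb R$ let $\mathcal A(\beta)$ be the operator in $L_2(\mathcal G)$ defined by $\mathcal A(\beta)u=-u''$ on every edge, whose domain consists of the functions $u$ that are continuous on $\mathcal G$, belong to $H^2$ on every edge with $\sum_e\|u\|_{H^2(e)}^2<\infty$, and satisfy, for all $(k,\ell)\in\mathbb Z^2$, the quasi-periodicity conditions $u_{k,\ell}^+(a_3/2)=e^{-i\beta}u_{k,\ell}^-(-a_3/2)$, $(u_{k,\ell}^+)'(a_3/2)=e^{-i\beta}(u_{k,\ell}^-)'(-a_3/2)$ and the Kirchhoff condition $$u'_{k+\frac12,\ell}(ka_1)-u'_{k-\frac12,\ell}(ka_1)+u'_{k,\ell+\frac12}(\ell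 a_2)-u'_{k,\ell-\frac12}(\ell a_2)+(u^+_{k,\ell})'(0)-(u^-_{k,\ell})'(0)=0.$$ A gap of $\mathcal A(\beta)$ is a nonempty bounded open interval $(a,b)\subset\mathbb R$ with $[a,b]\cap\sigma(\mathcal A(\beta))=\{a,b\}$. Put $$\sigma_i=\{(\pi n/a_i)^2:\ n\in\mathbb Z\setminus\{0\}\}\ (i=1,2),\qquad \sigma_3=\{((\pm\beta+2\pi n)/a_3)^2:\ n\in\mathbb Z\}.$$ Then: 1. For every $\beta\in\mathbb R$, $\sigma_1\cup\sigma_2\cup\sigma_3\subset\sigma(\mathcal A(\beta))$. 2. For every $\beta\in[0,\pi]$, $\mathcal A(\beta)$ has infinitely many gaps, and their ends tend to infinity (for every $R$, only finitely many gaps have an end smaller than $R$). 3. Let $\beta\in[0,\pi]$ and let $\mathcal W(\beta)=\{\pi n/a_3:\ n\in\mathbb N,\ n\ge1\}$ if $\beta\notin\{0,\pi\}$, and $\mathcal W(\beta)=\{\beta/a_3+(2n+1)\pi/a_3:\ n\in\mathbb N,\ n\ge0\}$ if $\beta\in\{0,\pi\}$. Every gap of $\mathcal A(\beta)$ is of the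 form $(\omega_b^2,\omega_t^2)$ with $\omega_b,\omega_t\ge0$, and exactly one of the following holds: (i) $\omega_b^2\notin\sigma_1\cup\sigma_2$, $\omega_t^2\notin\sigma_1\cup\sigma_2$, and there is a unique $\omega_0\in(\omega_b,\omega_t)\cap\mathcal W(\beta)$; (ii) $\omega_b^2\in\sigma_1\cup\sigma_2$, $\omega_t^2\notin\sigma_1\cup\sigma_2$, and $\mathcal W(\beta)\cap(\omega_b,\omega_t)=\varnothing$; (iii) $\omega_b^2\notin\sigma_1\cup\sigma_2$, $\omega_t^2\in\sigma_1\cup\sigma_2$, and $\mathcal W(\beta)\cap(\omega_b,\omega_t)=\varnothing$. -/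

import Mathlib

open MeasureTheory Set Filter Topology

noncomputable section

namespace PeriodicGraph

/-- The four edges attached to a cell `(k, ℓ) ∈ ℤ²` of the graph:
`dir₁` joins `v k ℓ = (k a₁, ℓ a₂, 0)` to `v (k+1) ℓ`, `dir₂` joins `v k ℓ` to `v k (ℓ+1)`, and
`plus`, `minus` join `v k ℓ` to `(k a₁, ℓ a₂, a₃/2)` and `(k a₁, ℓ a₂, -a₃/2)`. -/
inductive EdgeKind
  | dir₁
  | dir₂
  | plus
  | minus

/-- The edges of the graph. -/
abbrev Edge := (ℤ × ℤ) × EdgeKind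

/-- Left end of the coordinate interval of an edge. The coordinate is `s = x₁ - k a₁` on `dir₁`,
`s = x₂ - ℓ a₂` on `dir₂` and `s = x₃` on `plus` and `minus`. -/
def left (a₃ : ℝ) : EdgeKind → ℝ
  | .dir₁ => 0
  | .dir₂ => 0
  | .plus => 0
  | .minus => -(a₃ / 2)

/-- Right end of the coordinate interval of an edge. -/
def right (a₁ a₂ a₃ : ℝ) : EdgeKind → ℝ
  | .dir₁ => a₁
  | .dir₂ => a₂
  | .plus => a₃ / 2
  | .minus => 0

/-- Length measure on an edge. -/
abbrev edgeMeasure (a₁ a₂ a₃ : ℝ) (κ : EdgeKind) : Measure ℝ :=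
  volume.restrict (Ioo (left a₃ κ) (right a₁ a₂ a₃ κ))

/-- The Hilbert space `L²(𝒢)`, the Hilbert sum of the spaces `L²(e)` over all edges `e`. -/
abbrev GraphL2 (a₁ a₂ a₃ : ℝ) :=
  lp (fun e : Edge => Lp ℂ 2 (edgeMeasure a₁ a₂ a₃ e.2)) 2

/-- `u` is, on each edge, the continuously differentiable representative of an `H²` function, with
derivative `u'` and second derivative `f₂`, and `f, f₁, f₂ ∈ L²(𝒢)` are the classes of `u`, of `u'`
and of the second derivative. (`H²` of an interval consists of the `C¹` functions whose derivative
is absolutely continuous with density in `L²`; the sum of the squared `H²` norms over the edges is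
finite because `f, f₁, f₂` lie in `L²(𝒢)`.) -/
structure IsH2 {a₁ a₂ a₃ : ℝ} (u u' : ℤ × ℤ → EdgeKind → ℝ → ℂ) (f f₁ f₂ : GraphL2 a₁ a₂ a₃) :
    Prop where
  ae_eq : ∀ c κ, u c κ =ᵐ[edgeMeasure a₁ a₂ a₃ κ] f (c, κ)
  ae_eq_deriv : ∀ c κ, u' c κ =ᵐ[edgeMeasure a₁ a₂ a₃ κ] f₁ (c, κ)
  eq_integral : ∀ c κ, ∀ s ∈ Icc (left a₃ κ) (right a₁ a₂ a₃ κ),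
    u c κ s = u c κ (left a₃ κ) + ∫ t in (left a₃ κ)..s, u' c κ t
  deriv_eq_integral : ∀ c κ, ∀ s ∈ Icc (left a₃ κ) (right a₁ a₂ a₃ κ),
    u' c κ s = u' c κ (left a₃ κ) + ∫ t in (left a₃ κ)..s, f₂ (c, κ) t

/-- Continuity at the vertices `v k ℓ`: the six edges that meet there give the same value. -/
def ContinuousAtVertices (a₁ a₂ : ℝ) (u : ℤ × ℤ → EdgeKind → ℝ → ℂ) : Prop :=
  ∀ k l : ℤ,
    u (k, l) .minus 0 = u (k, l) .plus 0 ∧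
    u (k, l) .dir₁ 0 = u (k, l) .plus 0 ∧
    u (k - 1, l) .dir₁ a₁ = u (k, l) .plus 0 ∧
    u (k, l) .dir₂ 0 = u (k, l) .plus 0 ∧
    u (k, l - 1) .dir₂ a₂ = u (k, l) .plus 0

/-- The `β`-quasi-periodicity conditions for a function `u` with derivative `u'`. -/
def QuasiPeriodic (a₃ β : ℝ) (u u' : ℤ × ℤ → EdgeKind → ℝ → ℂ) : Prop :=
  ∀ c : ℤ × ℤ,
    u c .plus (a₃ / 2) = Complex.exp (-Complex.I * β) * u c .minus (-(a₃ / 2)) ∧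
    u' c .plus (a₃ / 2) = Complex.exp (-Complex.I * β) * u' c .minus (-(a₃ / 2))

/-- The Kirchhoff conditions at the vertices `v k ℓ` for the derivative `u'`. -/
def Kirchhoff (a₁ a₂ : ℝ) (u' : ℤ × ℤ → EdgeKind → ℝ → ℂ) : Prop :=
  ∀ k l : ℤ,
    u' (k, l) .dir₁ 0 - u' (k - 1, l) .dir₁ a₁ + u' (k, l) .dir₂ 0 - u' (k, l - 1) .dir₂ a₂ +
      (u' (k, l) .plus 0 - u' (k, l) .minus 0) = 0

/-- `f` lies in the domain of `𝒜(β)`, and its second derivative on the edges is `f₂`. -/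
def InDomain {a₁ a₂ a₃ : ℝ} (β : ℝ) (f f₂ : GraphL2 a₁ a₂ a₃) : Prop :=
  ∃ (u u' : ℤ × ℤ → EdgeKind → ℝ → ℂ) (f₁ : GraphL2 a₁ a₂ a₃),
    IsH2 u u' f f₁ f₂ ∧ ContinuousAtVertices a₁ a₂ u ∧ QuasiPeriodic a₃ β u u' ∧ Kirchhoff a₁ a₂ u'

theorem integrable_coe {a₁ a₂ a₃ : ℝ} (f : GraphL2 a₁ a₂ a₃) (c : ℤ × ℤ) (κ : EdgeKind) :
    IntegrableOn (f (c, κ)) (Ioo (left a₃ κ) (right a₁ a₂ a₃ κ)) :=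
  (Lp.memLp (f (c, κ))).integrable (by norm_num)

theorem intervalIntegrable_of {a b : ℝ} {g : ℝ → ℂ} (hg : IntegrableOn g (Ioo a b)) {s : ℝ}
    (hs : s ∈ Icc a b) : IntervalIntegrable g volume a s := by
  rw [intervalIntegrable_iff_integrableOn_Ioo_of_le hs.1]
  exact hg.mono_set (Ioo_subset_Ioo_right hs.2)

theorem IsH2.integrable_deriv {a₁ a₂ a₃ : ℝ} {u u' : ℤ × ℤ → EdgeKind → ℝ → ℂ}
    {f f₁ f₂ : GraphL2 a₁ a₂ a₃} (h : IsH2 u u' f f₁ f₂) (c : ℤ × ℤ) (κ : EdgeKind) :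
    IntegrableOn (u' c κ) (Ioo (left a₃ κ) (right a₁ a₂ a₃ κ)) :=
  (integrable_coe f₁ c κ).congr (h.ae_eq_deriv c κ).symm

theorem integral_congr_edge {a b : ℝ} {g h : ℝ → ℂ} (hgh : g =ᵐ[volume.restrict (Ioo a b)] h)
    {s : ℝ} (hs : s ∈ Icc a b) : ∫ t in a..s, g t = ∫ t in a..s, h t := by
  rw [intervalIntegral.integral_of_le hs.1, intervalIntegral.integral_of_le hs.1,
    integral_Ioc_eq_integral_Ioo, integral_Ioc_eq_integral_Ioo]
  exact integral_congr_ae (ae_restrict_of_ae_restrict_of_subset (Ioo_subset_Ioo_right hs.2) hgh)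

/-- An absolutely continuous function that vanishes almost everywhere has derivative zero. -/
theorem deriv_ae_zero {a b : ℝ} {w g : ℝ → ℂ} (hg : IntegrableOn g (Ioo a b))
    (hw : ∀ s ∈ Icc a b, w s = w a + ∫ t in a..s, g t)
    (h0 : w =ᵐ[volume.restrict (Ioo a b)] 0) : g =ᵐ[volume.restrict (Ioo a b)] 0 := by
  rcases le_or_gt b a with hab | hab
  · rw [Ioo_eq_empty (not_lt.mpr hab), Measure.restrict_empty, ae_zero]
    exact eventually_bot
  have hint : IntervalIntegrable g volume a b := intervalIntegrable_of hg ⟨hab.le, le_rfl⟩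
  have hcont : ContinuousOn w (Icc a b) := by
    refine ContinuousOn.congr (f := fun s => w a + ∫ t in a..s, g t) ?_ hw
    refine continuousOn_const.add ?_
    have := intervalIntegral.continuousOn_primitive_interval' hint (left_mem_uIcc)
    rwa [uIcc_of_le hab.le] at this
  have hz : EqOn w 0 (Icc a b) :=
    Measure.eqOn_Icc_of_ae_eq volume hab.ne
      (by rw [restrict_Ioo_eq_restrict_Icc] at h0; exact h0) hcont continuousOn_const
  have hi : ∀ s ∈ Icc a b, ∫ t in a..s, g t = 0 := by
    intro s hs
    have h1 := hw s hs
    rw [hz hs, hz ⟨le_rfl, hab.le⟩] at h1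
    simpa using h1.symm
  have hd := hint.ae_hasDerivAt_integral
  rw [EventuallyEq, ae_restrict_iff' measurableSet_Ioo]
  filter_upwards [hd] with x hx hxm
  have h1 := hx (by rw [uIcc_of_le hab.le]; exact Ioo_subset_Icc_self hxm) a left_mem_uIcc
  have h2 : HasDerivAt (fun s => ∫ t in a..s, g t) 0 x := by
    refine (hasDerivAt_const x (0 : ℂ)).congr_of_eventuallyEq ?_
    filter_upwards [Ioo_mem_nhds hxm.1 hxm.2] with s hs
    exact hi s (Ioo_subset_Icc_self hs)
  exact h1.unique h2

theorem InDomain.eq_zero {a₁ a₂ a₃ β : ℝ} {f₂ : GraphL2 a₁ a₂ a₃} (h : InDomain β 0 f₂) :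
    f₂ = 0 := by
  obtain ⟨u, u', f₁, h, -, -, -⟩ := h
  ext1
  funext e
  obtain ⟨c, κ⟩ := e
  have hu : u c κ =ᵐ[edgeMeasure a₁ a₂ a₃ κ] 0 := (h.ae_eq c κ).trans (Lp.coeFn_zero _ _ _)
  have h1 := deriv_ae_zero (h.integrable_deriv c κ) (h.eq_integral c κ) hu
  have h2 := deriv_ae_zero (integrable_coe f₂ c κ) (h.deriv_eq_integral c κ) h1
  exact Lp.ext (h2.trans (Lp.coeFn_zero _ _ _).symm)

theorem InDomain.zero {a₁ a₂ a₃ β : ℝ} : InDomain β (0 : GraphL2 a₁ a₂ a₃) 0 := by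
  have hz : ∀ κ, (0 : ℝ → ℂ) =ᵐ[edgeMeasure a₁ a₂ a₃ κ] (0 : Lp ℂ 2 (edgeMeasure a₁ a₂ a₃ κ)) :=
    fun κ => (Lp.coeFn_zero _ _ _).symm
  refine ⟨fun _ _ _ => 0, fun _ _ _ => 0, 0, ⟨fun c κ => hz κ, fun c κ => hz κ, ?_, ?_⟩, ?_, ?_, ?_⟩
  · intro c κ s hs
    simp
  · intro c κ s hs
    have := integral_congr_edge (hz κ) hs
    simp only [Pi.zero_apply, intervalIntegral.integral_zero] at this
    simpa using this
  · intro k l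
    simp
  · intro c
    simp
  · intro k l
    simp

theorem InDomain.add {a₁ a₂ a₃ β : ℝ} {f f₂ g g₂ : GraphL2 a₁ a₂ a₃} (hf : InDomain β f f₂)
    (hg : InDomain β g g₂) : InDomain β (f + g) (f₂ + g₂) := by
  obtain ⟨u, u', f₁, hu, hu1, hu2, hu3⟩ := hf
  obtain ⟨v, v', g₁, hv, hv1, hv2, hv3⟩ := hg
  refine ⟨fun c κ s => u c κ s + v c κ s, fun c κ s => u' c κ s + v' c κ s, f₁ + g₁,
    ⟨?_, ?_, ?_, ?_⟩, ?_, ?_, ?_⟩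
  · intro c κ
    exact ((hu.ae_eq c κ).add (hv.ae_eq c κ)).trans (Lp.coeFn_add _ _).symm
  · intro c κ
    exact ((hu.ae_eq_deriv c κ).add (hv.ae_eq_deriv c κ)).trans (Lp.coeFn_add _ _).symm
  · intro c κ s hs
    rw [intervalIntegral.integral_add (intervalIntegrable_of (hu.integrable_deriv c κ) hs)
      (intervalIntegrable_of (hv.integrable_deriv c κ) hs), hu.eq_integral c κ s hs,
      hv.eq_integral c κ s hs]
    ring
  · intro c κ s hs
    have h1 := integral_congr_edge (Lp.coeFn_add (f₂ (c, κ)) (g₂ (c, κ))) hs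
    have h2 : ∫ t in (left a₃ κ)..s, (f₂ (c, κ) t + g₂ (c, κ) t) = _ :=
      intervalIntegral.integral_add (intervalIntegrable_of (integrable_coe f₂ c κ) hs)
      (intervalIntegrable_of (integrable_coe g₂ c κ) hs)
    refine Eq.trans ?_ (congrArg _ (h1.trans h2).symm)
    rw [hu.deriv_eq_integral c κ s hs, hv.deriv_eq_integral c κ s hs]
    ring
  · intro k l
    obtain ⟨p1, p2, p3, p4, p5⟩ := hu1 k l
    obtain ⟨q1, q2, q3, q4, q5⟩ := hv1 k l
    simp only [p1, p2, p3, p4, p5, q1, q2, q3, q4, q5, and_self]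
  · intro c
    simp only [hu2 c, hv2 c, mul_add, and_self]
  · intro k l
    linear_combination hu3 k l + hv3 k l

theorem InDomain.smul {a₁ a₂ a₃ β : ℝ} (z : ℂ) {f f₂ : GraphL2 a₁ a₂ a₃} (hf : InDomain β f f₂) :
    InDomain β (z • f) (z • f₂) := by
  obtain ⟨u, u', f₁, hu, hu1, hu2, hu3⟩ := hf
  refine ⟨fun c κ s => z * u c κ s, fun c κ s => z * u' c κ s, z • f₁,
    ⟨?_, ?_, ?_, ?_⟩, ?_, ?_, ?_⟩
  · intro c κ
    exact ((hu.ae_eq c κ).const_smul z).trans (Lp.coeFn_smul _ _).symm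
  · intro c κ
    exact ((hu.ae_eq_deriv c κ).const_smul z).trans (Lp.coeFn_smul _ _).symm
  · intro c κ s hs
    rw [intervalIntegral.integral_const_mul, hu.eq_integral c κ s hs]
    ring
  · intro c κ s hs
    have h1 := integral_congr_edge (Lp.coeFn_smul z (f₂ (c, κ))) hs
    have h2 : ∫ t in (left a₃ κ)..s, (z * f₂ (c, κ) t) = _ :=
      intervalIntegral.integral_const_mul _ _
    refine Eq.trans ?_ (congrArg _ (h1.trans h2).symm)
    rw [hu.deriv_eq_integral c κ s hs]
    ring
  · intro k l
    obtain ⟨p1, p2, p3, p4, p5⟩ := hu1 k l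
    simp only [p1, p2, p3, p4, p5, and_self]
  · intro c
    simp only [hu2 c]
    constructor <;> ring
  · intro k l
    linear_combination z * hu3 k l

/-- The graph `{(f, -f'')}` of the operator `𝒜(β)`, as a subspace of `L²(𝒢) × L²(𝒢)`. -/
def operatorGraph (a₁ a₂ a₃ β : ℝ) : Submodule ℂ (GraphL2 a₁ a₂ a₃ × GraphL2 a₁ a₂ a₃) where
  carrier := {p | InDomain β p.1 (-p.2)}
  add_mem' := fun {p q} (hp : InDomain β p.1 (-p.2)) (hq : InDomain β q.1 (-q.2)) => by
    have h := hp.add hq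
    rwa [← neg_add] at h
  zero_mem' := by simpa using InDomain.zero
  smul_mem' := fun z p (hp : InDomain β p.1 (-p.2)) => by
    have h := hp.smul z
    rwa [smul_neg] at h

/-- The unbounded operator `𝒜(β) f = -f''` in `L²(𝒢)`. -/
def periodicOperator (a₁ a₂ a₃ β : ℝ) : GraphL2 a₁ a₂ a₃ →ₗ.[ℂ] GraphL2 a₁ a₂ a₃ :=
  (operatorGraph a₁ a₂ a₃ β).toLinearPMap

/-- The second derivative is determined by the function, so that `periodicOperator` really is the
operator whose graph is `operatorGraph`. -/
theorem periodicOperator_graph (a₁ a₂ a₃ β : ℝ) :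
    (periodicOperator a₁ a₂ a₃ β).graph = operatorGraph a₁ a₂ a₃ β := by
  refine Submodule.toLinearPMap_graph_eq _ ?_
  rintro ⟨f, g⟩ hp (rfl : f = 0)
  exact neg_eq_zero.mp (InDomain.eq_zero hp)

/-- Resolvent set of an unbounded operator `T`: the `z` for which `T - z` is a bijection of the
domain onto the whole space with bounded inverse. -/
def resolventSet {H : Type*} [NormedAddCommGroup H] [NormedSpace ℂ H] (T : H →ₗ.[ℂ] H) : Set ℂ :=
  {z | ∃ R : H →L[ℂ] H,
    (∀ f : H, ∃ hf : R f ∈ T.domain, T ⟨R f, hf⟩ - z • R f = f) ∧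
    ∀ x : T.domain, R (T x - z • (x : H)) = x}

/-- The (real) spectrum of an unbounded operator. -/
def realSpectrum {H : Type*} [NormedAddCommGroup H] [NormedSpace ℂ H] (T : H →ₗ.[ℂ] H) : Set ℝ :=
  {t | (t : ℂ) ∉ resolventSet T}

/-- `(s, t)` is a gap of `S`: a nonempty open interval with `[s, t] ∩ S = {s, t}`. -/
def IsGap (S : Set ℝ) (s t : ℝ) : Prop :=
  s < t ∧ Icc s t ∩ S = {s, t}

/-- The set `σ₁` or `σ₂`, for `a = a₁` or `a = a₂`. -/
def sigmaDir (a : ℝ) : Set ℝ :=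
  {t | ∃ n : ℤ, n ≠ 0 ∧ t = (Real.pi * n / a) ^ 2}

/-- The set `σ₃`. -/
def sigmaThree (a₃ β : ℝ) : Set ℝ :=
  {t | ∃ n : ℤ, t = ((β + 2 * Real.pi * n) / a₃) ^ 2 ∨ t = ((-β + 2 * Real.pi * n) / a₃) ^ 2}

open Classical in
/-- The set `𝒲(β)`. -/
def specialFrequencies (a₃ β : ℝ) : Set ℝ :=
  if β = 0 ∨ β = Real.pi then {w | ∃ n : ℕ, w = β / a₃ + (2 * n + 1) * Real.pi / a₃}
  else {w | ∃ n : ℕ, 1 ≤ n ∧ w = Real.pi * n / a₃}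

end PeriodicGraph

end

/-! The spectral problem is reduced to the vertices, and the resulting dispersion relation is then
studied as a comparison of monotone functions of the frequency.

Reduction. On each edge a solution of `-u'' - lam u = g` is determined by its data at the left end,
through the fundamental solutions `c`, `s` (`FundPair`). If `s a₁` and `s a₂` are nonzero, the
derivatives on the horizontal edges are expressed by the vertex values `A`, and quasi-periodicity
carries the data of the `plus` edge to the `minus` edge. What remains is a 2×2 system for `A` and
the derivative `B` at the start of the `plus` edge, whose coefficients are scalars and one Laurent
operator on `ℓ²(ℤ²)`. Its determinant is a Laurent operator with symbol `-2 (D + (s a₃ / s a₁) cos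
θ₁ + (s a₃ / s a₂) cos θ₂)`, where `D = cos β - c a₃ - s a₃ (c a₁ / s a₁ + c a₂ / s a₂)`. If `|D|`
exceeds `|s a₃ / s a₁| + |s a₃ / s a₂|`, the determinant is invertible by a Neumann series and `lam`
is in the resolvent set (`notMem_realSpectrum`). Otherwise the symbol has a zero, which gives a
Bloch solution, and its truncations to large boxes contradict a bounded inverse
(`IsBlochSolution.mem_realSpectrum`). If `s a₁` or `s a₂` vanishes, a Bloch solution exists that
vanishes at all vertices. Hence `sq_mem_realSpectrum_iff`; the parameter 0 and negative parameters
are treated separately.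

Frequencies. After division by `sin (w a₃)`, a frequency `w > 0` with nonzero `sin (w a₁)`, `sin (w
a₂)` that is no pole is a band frequency exactly when `v = (cos β - cos (w a₃)) / sin (w a₃)` lies
between `L` and `U`, the sums over `a = a₁, a₂` of `cot (w a) - 1/|sin (w a)|` and of `cot (w a) +
1/|sin (w a)|`. Here `v` increases between its poles, `L` and `U` decrease between the zeros of the
two sines, and `L ≤ 0 ≤ U`. So along a gap free of poles `v` stays on one side of the band. If
neither end is a zero of the sines, monotonicity forces a pole inside; it is unique, since `v`
vanishes between two poles. To the right of a zero of the sines `U` tends to infinity, so a gap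
beginning there lies below the band and cannot reach a pole, where `v` rises to infinity; reflection
`w ↦ -w` gives the right ends. No gap has both ends of this kind, as it would lie below and above at
once.

Number of gaps. There are no band frequencies close to a pole on either side of it, and there are
arbitrarily large poles. Conversely every closed gap contains a zero of one of the three sines, so
only finitely many gaps begin below a given bound. -/

open MeasureTheory Set Filter Topology

noncomputable section

namespace PeriodicGraph

section

/-! ### Absolutely continuous functions on an interval -/

/-- On `[a, b]`, the function `w` is the primitive of the integrable function `g`. -/
structure HasDensityOn (a b : ℝ) (w g : ℝ → ℂ) : Prop where
  integrable : IntegrableOn g (Ioo a b)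
  eq_integral : ∀ x ∈ Icc a b, w x = w a + ∫ t in a..x, g t

namespace HasDensityOn

variable {a b : ℝ} {w g w₁ g₁ w₂ g₂ : ℝ → ℂ}

theorem intervalIntegrable (h : HasDensityOn a b w g) {x : ℝ} (hx : x ∈ Icc a b) :
    IntervalIntegrable g volume a x :=
  intervalIntegrable_of h.integrable hx

theorem add (h₁ : HasDensityOn a b w₁ g₁) (h₂ : HasDensityOn a b w₂ g₂) :
    HasDensityOn a b (fun x => w₁ x + w₂ x) (fun x => g₁ x + g₂ x) := by
  refine ⟨h₁.integrable.add h₂.integrable, fun x hx => ?_⟩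
  rw [intervalIntegral.integral_add (h₁.intervalIntegrable hx) (h₂.intervalIntegrable hx),
    h₁.eq_integral x hx, h₂.eq_integral x hx]
  ring

theorem const_mul (z : ℂ) (h : HasDensityOn a b w g) :
    HasDensityOn a b (fun x => z * w x) (fun x => z * g x) := by
  refine ⟨h.integrable.const_mul z, fun x hx => ?_⟩
  rw [intervalIntegral.integral_const_mul, h.eq_integral x hx]
  ring

theorem congr_density (h : HasDensityOn a b w g) (hg : g =ᵐ[volume.restrict (Ioo a b)] g₁) :
    HasDensityOn a b w g₁ :=
  ⟨h.integrable.congr hg, fun x hx => by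
    rw [← integral_congr_edge hg hx]; exact h.eq_integral x hx⟩

theorem of_hasDerivAt (hw : ∀ x, HasDerivAt w (g x) x) (hg : Continuous g) :
    HasDensityOn a b w g := by
  refine ⟨(hg.integrableOn_Icc).mono_set Ioo_subset_Icc_self, fun x _ => ?_⟩
  rw [intervalIntegral.integral_eq_sub_of_hasDerivAt (fun t _ => hw t)
    (hg.intervalIntegrable _ _)]
  ring

theorem continuousOn (h : HasDensityOn a b w g) : ContinuousOn w (Icc a b) := by
  rcases lt_or_ge b a with hab | hab
  · rw [Icc_eq_empty (not_le.mpr hab)]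
    exact continuousOn_empty w
  refine ContinuousOn.congr (f := fun s => w a + ∫ t in a..s, g t) ?_ h.eq_integral
  refine continuousOn_const.add ?_
  have := intervalIntegral.continuousOn_primitive_interval'
    (h.intervalIntegrable ⟨hab, le_rfl⟩) left_mem_uIcc
  rwa [uIcc_of_le hab] at this

end HasDensityOn

/-- Integration by parts for absolutely continuous functions: `φ` is `C¹`, and the primitive of `g`
is absolutely continuous with derivative `g` almost everywhere. The boundary term at `a` vanishes
with the primitive. -/
theorem mul_primitive_eq_integral {φ φ' g : ℝ → ℝ} {a x : ℝ}
    (hφ : ∀ t, HasDerivAt φ (φ' t) t) (hφ' : Continuous φ')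
    (hg : IntervalIntegrable g volume a x) :
    φ x * ∫ t in a..x, g t = ∫ t in a..x, (φ' t * (∫ r in a..t, g r) + φ t * g t) := by
  have hd : deriv φ = φ' := funext fun t => (hφ t).deriv
  have hC : ContDiff ℝ 1 φ :=
    contDiff_one_iff_deriv.mpr ⟨fun t => (hφ t).differentiableAt, by rwa [hd]⟩
  have h1 : AbsolutelyContinuousOnInterval φ a x :=
    hC.contDiffOn.absolutelyContinuousOnInterval
  have h2 := hg.absolutelyContinuousOnInterval_intervalIntegral (c := a) left_mem_uIcc
  have h3 := h1.integral_deriv_mul_eq_sub h2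
  rw [intervalIntegral.integral_same, mul_zero, sub_zero] at h3
  rw [← h3]
  refine intervalIntegral.integral_congr_ae ?_
  filter_upwards [hg.ae_hasDerivAt_integral] with t ht htm
  rw [(ht (uIoc_subset_uIcc htm) a left_mem_uIcc).deriv, hd]

/-- The product rule. The primitive of `g` is treated through its real and imaginary parts by
`mul_primitive_eq_integral`; the constant `w a` contributes `(φ x - φ a) w a` by the fundamental
theorem. -/
theorem HasDensityOn.smooth_mul {φ φ' : ℝ → ℝ} {a b : ℝ} {w g : ℝ → ℂ}
    (hφ : ∀ t, HasDerivAt φ (φ' t) t) (hφ' : Continuous φ') (h : HasDensityOn a b w g) :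
    HasDensityOn a b (fun x => (φ x : ℂ) * w x) (fun x => (φ' x : ℂ) * w x + (φ x : ℂ) * g x) := by
  have hφc : Continuous φ := continuous_iff_continuousAt.mpr fun t => (hφ t).continuousAt
  have hi1 : IntegrableOn (fun x => (φ' x : ℂ) * w x) (Ioo a b) :=
    (ContinuousOn.integrableOn_Icc
      ((Complex.continuous_ofReal.comp hφ').continuousOn.mul h.continuousOn)).mono_set
      Ioo_subset_Icc_self
  have hi2 : IntegrableOn (fun x => (φ x : ℂ) * g x) (Ioo a b) := by
    have := ((integrableOn_Icc_iff_integrableOn_Ioo (by simp) (by simp)).mpr h.integrable).continuousOn_mul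
      (Complex.continuous_ofReal.comp hφc).continuousOn isCompact_Icc
    exact this.mono_set Ioo_subset_Icc_self
  refine ⟨hi1.add hi2, fun x hx => ?_⟩
  have hgx := h.intervalIntegrable hx
  have hre : IntervalIntegrable (fun t => (g t).re) volume a x :=
    ⟨hgx.1.re, hgx.2.re⟩
  have him : IntervalIntegrable (fun t => (g t).im) volume a x :=
    ⟨hgx.1.im, hgx.2.im⟩
  have hsub : ∀ {t}, t ∈ uIcc a x → IntervalIntegrable g volume a t := fun {t} ht =>
    hgx.mono_set (uIcc_subset_uIcc left_mem_uIcc ht)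
  have key : (φ x : ℂ) * ∫ t in a..x, g t =
      ∫ t in a..x, ((φ' t : ℂ) * (∫ r in a..t, g r) + (φ t : ℂ) * g t) := by
    have hint : IntervalIntegrable
        (fun t => (φ' t : ℂ) * (∫ r in a..t, g r) + (φ t : ℂ) * g t) volume a x := by
      refine IntervalIntegrable.add ?_ (hgx.continuousOn_mul
        (Complex.continuous_ofReal.comp hφc).continuousOn)
      exact ContinuousOn.intervalIntegrable
        ((Complex.continuous_ofReal.comp hφ').continuousOn.mul
          (intervalIntegral.continuousOn_primitive_interval' hgx left_mem_uIcc))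
    apply Complex.ext
    · have h1 := mul_primitive_eq_integral hφ hφ' hre
      have h2 := Complex.reCLM.intervalIntegral_comp_comm hgx
      have h3 := Complex.reCLM.intervalIntegral_comp_comm hint
      simp only [Complex.reCLM_apply] at h2 h3
      rw [← h3, Complex.re_ofReal_mul, ← h2, h1]
      refine intervalIntegral.integral_congr fun t ht => ?_
      have h4 := Complex.reCLM.intervalIntegral_comp_comm (hsub ht)
      simp only [Complex.reCLM_apply] at h4
      simp only [Complex.add_re, Complex.re_ofReal_mul, h4]
    · have h1 := mul_primitive_eq_integral hφ hφ' him
      have h2 := Complex.imCLM.intervalIntegral_comp_comm hgx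
      have h3 := Complex.imCLM.intervalIntegral_comp_comm hint
      simp only [Complex.imCLM_apply] at h2 h3
      rw [← h3, Complex.im_ofReal_mul, ← h2, h1]
      refine intervalIntegral.integral_congr fun t ht => ?_
      have h4 := Complex.imCLM.intervalIntegral_comp_comm (hsub ht)
      simp only [Complex.imCLM_apply] at h4
      simp only [Complex.add_im, Complex.im_ofReal_mul, h4]
  have hw : ∫ t in a..x, ((φ' t : ℂ) * w t + (φ t : ℂ) * g t) =
      ∫ t in a..x, (((φ' t : ℂ) * (∫ r in a..t, g r) + (φ t : ℂ) * g t) + (φ' t : ℂ) * w a) := by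
    refine intervalIntegral.integral_congr fun t ht => ?_
    rw [uIcc_of_le hx.1] at ht
    rw [h.eq_integral t ⟨ht.1, ht.2.trans hx.2⟩]
    ring
  have hφi : ∫ t in a..x, (φ' t : ℂ) * w a = ((φ x : ℂ) - φ a) * w a := by
    rw [intervalIntegral.integral_mul_const, intervalIntegral.integral_ofReal,
      intervalIntegral.integral_eq_sub_of_hasDerivAt (fun t _ => hφ t)
        (hφ'.intervalIntegrable _ _)]
    push_cast
    ring
  rw [hw, intervalIntegral.integral_add, ← key, hφi, h.eq_integral x hx]
  · ring
  · refine IntervalIntegrable.add ?_ (hgx.continuousOn_mul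
        (Complex.continuous_ofReal.comp hφc).continuousOn)
    exact ContinuousOn.intervalIntegrable
        ((Complex.continuous_ofReal.comp hφ').continuousOn.mul
          (intervalIntegral.continuousOn_primitive_interval' hgx left_mem_uIcc))
  · exact ((Complex.continuous_ofReal.comp hφ').mul continuous_const).intervalIntegrable _ _

/-! ### Fundamental solutions of `-u'' = lam u` -/

/-- The solutions `c`, `s` of `-u'' = lam u` with `c 0 = 1`, `c' 0 = 0`, `s 0 = 0`, `s' 0 = 1`. -/
structure FundPair (lam : ℝ) where
  c : ℝ → ℝ
  s : ℝ → ℝ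
  deriv_c : ∀ x, HasDerivAt c (-lam * s x) x
  deriv_s : ∀ x, HasDerivAt s (c x) x
  c_zero : c 0 = 1
  s_zero : s 0 = 0
  c_add : ∀ x y, c (x + y) = c x * c y - lam * s x * s y
  s_add : ∀ x y, s (x + y) = s x * c y + c x * s y
  sq_add : ∀ x, c x ^ 2 + lam * s x ^ 2 = 1

namespace FundPair

variable {lam : ℝ} (P : FundPair lam)

theorem continuous_c : Continuous P.c :=
  continuous_iff_continuousAt.mpr fun t => (P.deriv_c t).continuousAt

theorem continuous_s : Continuous P.s :=
  continuous_iff_continuousAt.mpr fun t => (P.deriv_s t).continuousAt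

theorem deriv_c_sub (a x : ℝ) : HasDerivAt (fun t => P.c (t - a)) (-lam * P.s (x - a)) x :=
  (P.deriv_c (x - a)).comp_sub_const x a

theorem deriv_s_sub (a x : ℝ) : HasDerivAt (fun t => P.s (t - a)) (P.c (x - a)) x :=
  (P.deriv_s (x - a)).comp_sub_const x a

theorem continuous_c_sub (a : ℝ) : Continuous fun t => P.c (t - a) :=
  P.continuous_c.comp (continuous_id.sub continuous_const)

theorem continuous_s_sub (a : ℝ) : Continuous fun t => P.s (t - a) :=
  P.continuous_s.comp (continuous_id.sub continuous_const)

theorem sq_add_complex (x : ℝ) : (P.c x : ℂ) ^ 2 + lam * (P.s x : ℂ) ^ 2 = 1 := by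
  exact_mod_cast congrArg (fun r : ℝ => (r : ℂ)) (P.sq_add x)

/-- Variation of constants, the function. -/
def sol (a : ℝ) (w₁ w₂ : ℝ → ℂ) (x : ℝ) : ℂ := P.c (x - a) * w₁ x + P.s (x - a) * w₂ x

/-- Variation of constants, the derivative. -/
def sol' (a : ℝ) (w₁ w₂ : ℝ → ℂ) (x : ℝ) : ℂ :=
  -lam * P.s (x - a) * w₁ x + P.c (x - a) * w₂ x

/-- The densities `s g` and `-c g` are those of variation of constants: their contributions cancel
in the first derivative, so `sol'` contains no `g`. -/
theorem hasDensityOn_sol {a b : ℝ} {w₁ w₂ g : ℝ → ℂ}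
    (h₁ : HasDensityOn a b w₁ fun x => P.s (x - a) * g x)
    (h₂ : HasDensityOn a b w₂ fun x => -(P.c (x - a) * g x)) :
    HasDensityOn a b (P.sol a w₁ w₂) (P.sol' a w₁ w₂) := by
  have := (h₁.smooth_mul (P.deriv_c_sub a) (continuous_const.mul (P.continuous_s_sub a))).add
    (h₂.smooth_mul (P.deriv_s_sub a) (P.continuous_c_sub a))
  refine this.congr_density (Eventually.of_forall fun x => ?_)
  simp only [sol']
  push_cast
  ring

/-- The densities of `w₁`, `w₂` now contribute `-(lam s² + c²) g = -g`, so `sol` solves `-u'' - lam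
u = g`. -/
theorem hasDensityOn_sol' {a b : ℝ} {w₁ w₂ g : ℝ → ℂ}
    (h₁ : HasDensityOn a b w₁ fun x => P.s (x - a) * g x)
    (h₂ : HasDensityOn a b w₂ fun x => -(P.c (x - a) * g x)) :
    HasDensityOn a b (P.sol' a w₁ w₂) (fun x => -lam * P.sol a w₁ w₂ x - g x) := by
  have := ((h₁.smooth_mul (P.deriv_s_sub a) (P.continuous_c_sub a)).const_mul (-lam : ℂ)).add
    (h₂.smooth_mul (P.deriv_c_sub a) (continuous_const.mul (P.continuous_s_sub a)))
  have h3 := this.congr_density (g₁ := fun x => -lam * P.sol a w₁ w₂ x - g x)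
    (Eventually.of_forall fun x => by
      simp only [sol]
      push_cast
      linear_combination (-g x) * P.sq_add_complex (x - a))
  refine ⟨h3.integrable, fun x hx => ?_⟩
  have := h3.eq_integral x hx
  simp only [sol'] at this ⊢
  linear_combination this

/-- Both left-hand sides are first integrals of `-u'' = lam u`: their densities vanish identically,
so they keep their value at `a`. -/
theorem eq_sol_of_homogeneous {a b : ℝ} {u u' g : ℝ → ℂ} (h : HasDensityOn a b u u')
    (h' : HasDensityOn a b u' g)
    (hg : g =ᵐ[volume.restrict (Ioo a b)] fun x => -lam * u x) {x : ℝ} (hx : x ∈ Icc a b) :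
    P.c (x - a) * u x - P.s (x - a) * u' x = u a ∧
      lam * P.s (x - a) * u x + P.c (x - a) * u' x = u' a := by
  have h'' := h'.congr_density hg
  constructor
  · have := (h.smooth_mul (P.deriv_c_sub a) (continuous_const.mul (P.continuous_s_sub a))).add
      ((h''.smooth_mul (P.deriv_s_sub a) (P.continuous_c_sub a)).const_mul (-1))
    have h3 := this.congr_density (g₁ := fun _ => 0) (Eventually.of_forall fun x => by
      push_cast
      ring)
    have := h3.eq_integral x hx
    simp only [sub_self, P.c_zero, P.s_zero, intervalIntegral.integral_zero] at this
    push_cast at this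
    linear_combination this
  · have := ((h.smooth_mul (P.deriv_s_sub a) (P.continuous_c_sub a)).const_mul (lam : ℂ)).add
      (h''.smooth_mul (P.deriv_c_sub a) (continuous_const.mul (P.continuous_s_sub a)))
    have h3 := this.congr_density (g₁ := fun _ => 0) (Eventually.of_forall fun x => by
      push_cast
      ring)
    have := h3.eq_integral x hx
    simp only [sub_self, P.c_zero, P.s_zero, intervalIntegral.integral_zero] at this
    push_cast at this
    linear_combination this

end FundPair

end

section

/-! ### Bounded operators on the `L²` space of an interval -/

/-- `L²(a, b)`. -/
abbrev IntervalL2 (a b : ℝ) := Lp ℂ 2 (volume.restrict (Ioo a b))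

theorem exists_integral_norm_le (a b : ℝ) :
    ∃ K : ℝ, 0 ≤ K ∧ ∀ f : IntervalL2 a b, ∫ x in Ioo a b, ‖f x‖ ≤ K * ‖f‖ := by
  set μ := volume.restrict (Ioo a b)
  refine ⟨(μ univ ^ ((1 : ℝ) / 2)).toReal, ENNReal.toReal_nonneg, fun f => ?_⟩
  have h1 := eLpNorm_le_eLpNorm_mul_rpow_measure_univ (p := 1) (q := 2) (μ := μ) (by norm_num)
    (Lp.memLp f).1
  rw [eLpNorm_one_eq_lintegral_enorm] at h1
  have h2 : (∫⁻ x, ‖f x‖ₑ ∂μ).toReal ≤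
      (eLpNorm f 2 μ * μ univ ^ (1 / (1 : ENNReal).toReal - 1 / (2 : ENNReal).toReal)).toReal := by
    refine ENNReal.toReal_mono (ENNReal.mul_ne_top (Lp.memLp f).2.ne ?_) h1
    exact ENNReal.rpow_ne_top_of_nonneg (by norm_num) (measure_ne_top μ univ)
  rw [integral_norm_eq_lintegral_enorm (Lp.memLp f).1]
  refine h2.trans (le_of_eq ?_)
  rw [ENNReal.toReal_mul, mul_comm, Lp.norm_def]
  norm_num
  exact Or.inl rfl

theorem exists_bound_of_continuous (a b : ℝ) {φ : ℝ → ℝ} (hφ : Continuous φ) :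
    ∃ M : ℝ, 0 ≤ M ∧ ∀ x ∈ Icc a b, |φ x| ≤ M := by
  obtain ⟨M, hM⟩ := isCompact_Icc.exists_bound_of_continuousOn (s := Icc a b) hφ.continuousOn
  exact ⟨max M 0, le_max_right _ _, fun x hx => (hM x hx).trans (le_max_left _ _)⟩

theorem integrableOn_coe {a b : ℝ} (f : IntervalL2 a b) : IntegrableOn f (Ioo a b) :=
  (Lp.memLp f).integrable (by norm_num)

theorem integrableOn_ofReal_mul {a b : ℝ} {φ : ℝ → ℝ} (hφ : Continuous φ) {g : ℝ → ℂ}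
    (hg : IntegrableOn g (Ioo a b)) : IntegrableOn (fun x => (φ x : ℂ) * g x) (Ioo a b) := by
  have := ((integrableOn_Icc_iff_integrableOn_Ioo (by simp) (by simp)).mpr hg).continuousOn_mul
      (Complex.continuous_ofReal.comp hφ).continuousOn isCompact_Icc
  exact this.mono_set Ioo_subset_Icc_self

theorem hasDensityOn_primitive {a b : ℝ} {φ : ℝ → ℝ} (hφ : Continuous φ) {g : ℝ → ℂ}
    (hg : IntegrableOn g (Ioo a b)) :
    HasDensityOn a b (fun x => ∫ t in a..x, (φ t : ℂ) * g t) (fun x => (φ x : ℂ) * g x) :=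
  ⟨integrableOn_ofReal_mul hφ hg, fun x _ => by simp⟩

theorem exists_primitive_bound (a b : ℝ) {φ : ℝ → ℝ} (hφ : Continuous φ) :
    ∃ K : ℝ, 0 ≤ K ∧ ∀ f : IntervalL2 a b, ∀ x ∈ Icc a b,
      ‖∫ t in a..x, (φ t : ℂ) * f t‖ ≤ K * ‖f‖ := by
  obtain ⟨M, hM0, hM⟩ := exists_bound_of_continuous a b hφ
  obtain ⟨K, hK0, hK⟩ := exists_integral_norm_le a b
  refine ⟨M * K, by positivity, fun f x hx => ?_⟩
  have hi : IntegrableOn (fun t => M * ‖f t‖) (Ioo a b) := (integrableOn_coe f).norm.const_mul M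
  rw [intervalIntegral.integral_of_le hx.1, integral_Ioc_eq_integral_Ioo]
  calc ‖∫ t in Ioo a x, (φ t : ℂ) * f t‖ ≤ ∫ t in Ioo a x, M * ‖f t‖ := by
        refine norm_integral_le_of_norm_le (hi.mono_set (Ioo_subset_Ioo_right hx.2)) ?_
        refine (ae_restrict_iff' measurableSet_Ioo).mpr (Eventually.of_forall fun t ht => ?_)
        rw [norm_mul, Complex.norm_real]
        exact mul_le_mul_of_nonneg_right (hM t ⟨ht.1.le, ht.2.le.trans hx.2⟩) (norm_nonneg _)
    _ ≤ ∫ t in Ioo a b, M * ‖f t‖ :=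
        setIntegral_mono_set hi (Eventually.of_forall fun t => by positivity)
          (Ioo_subset_Ioo_right hx.2).eventuallyLE
    _ = M * ∫ t in Ioo a b, ‖f t‖ := integral_const_mul _ _
    _ ≤ M * K * ‖f‖ := by
        rw [mul_assoc]
        exact mul_le_mul_of_nonneg_left (hK f) hM0

theorem primitive_add {a b : ℝ} {φ : ℝ → ℝ} (hφ : Continuous φ) (f g : IntervalL2 a b) {x : ℝ}
    (hx : x ∈ Icc a b) : ∫ t in a..x, (φ t : ℂ) * (f + g : IntervalL2 a b) t =
      (∫ t in a..x, (φ t : ℂ) * f t) + ∫ t in a..x, (φ t : ℂ) * g t := by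
  rw [← intervalIntegral.integral_add
    (intervalIntegrable_of (integrableOn_ofReal_mul hφ (integrableOn_coe f)) hx)
    (intervalIntegrable_of (integrableOn_ofReal_mul hφ (integrableOn_coe g)) hx)]
  refine integral_congr_edge ?_ hx
  filter_upwards [Lp.coeFn_add f g] with t ht
  rw [ht, Pi.add_apply, mul_add]

theorem primitive_smul {a b : ℝ} {φ : ℝ → ℝ} (z : ℂ) (f : IntervalL2 a b) {x : ℝ}
    (hx : x ∈ Icc a b) : ∫ t in a..x, (φ t : ℂ) * (z • f : IntervalL2 a b) t =
      z * ∫ t in a..x, (φ t : ℂ) * f t := by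
  rw [← intervalIntegral.integral_const_mul]
  refine integral_congr_edge ?_ hx
  filter_upwards [Lp.coeFn_smul z f] with t ht
  rw [ht, Pi.smul_apply, smul_eq_mul]
  ring

/-- The functional `f ↦ ∫ φ f` on `L²(a, b)`. -/
def momentCLM {a b : ℝ} (hab : a ≤ b) {φ : ℝ → ℝ} (hφ : Continuous φ) : IntervalL2 a b →L[ℂ] ℂ :=
  LinearMap.mkContinuous
    { toFun := fun f => ∫ t in a..b, (φ t : ℂ) * f t
      map_add' := fun f g => primitive_add hφ f g ⟨hab, le_rfl⟩
      map_smul' := fun z f => primitive_smul z f ⟨hab, le_rfl⟩ }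
    (exists_primitive_bound a b hφ).choose
    fun f => (exists_primitive_bound a b hφ).choose_spec.2 f b ⟨hab, le_rfl⟩

theorem momentCLM_apply {a b : ℝ} (hab : a ≤ b) {φ : ℝ → ℝ} (hφ : Continuous φ)
    (f : IntervalL2 a b) : momentCLM hab hφ f = ∫ t in a..b, (φ t : ℂ) * f t := rfl

theorem memLp_of_continuousOn {a b : ℝ} {v : ℝ → ℂ} (hv : ContinuousOn v (Icc a b)) :
    MemLp v 2 (volume.restrict (Ioo a b)) := by
  obtain ⟨M, hM⟩ := isCompact_Icc.exists_bound_of_continuousOn hv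
  refine MemLp.of_bound ((hv.mono Ioo_subset_Icc_self).aestronglyMeasurable measurableSet_Ioo) M ?_
  exact (ae_restrict_iff' measurableSet_Ioo).mpr
    (Eventually.of_forall fun t ht => hM t (Ioo_subset_Icc_self ht))

/-- The class in `L²(a, b)` of a function continuous on `[a, b]`. -/
def toL2 {a b : ℝ} {v : ℝ → ℂ} (hv : ContinuousOn v (Icc a b)) : IntervalL2 a b :=
  (memLp_of_continuousOn hv).toLp

theorem coeFn_toL2 {a b : ℝ} {v : ℝ → ℂ} (hv : ContinuousOn v (Icc a b)) :
    toL2 hv =ᵐ[volume.restrict (Ioo a b)] v :=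
  MemLp.coeFn_toLp _

theorem toL2_ne_zero {a b : ℝ} (hab : a < b) {v : ℝ → ℂ} (hv : ContinuousOn v (Icc a b))
    (hne : ∃ x ∈ Icc a b, v x ≠ 0) : toL2 hv ≠ 0 := by
  obtain ⟨x, hx, hvx⟩ := hne
  intro h0
  have h1 : v =ᵐ[volume.restrict (Ioo a b)] 0 := by
    refine (coeFn_toL2 hv).symm.trans ?_
    rw [h0]
    exact Lp.coeFn_zero _ _ _
  rw [restrict_Ioo_eq_restrict_Icc] at h1
  exact hvx (Measure.eqOn_Icc_of_ae_eq volume hab.ne h1 hv continuousOn_const hx)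

theorem continuousOn_volterra {a b : ℝ} {φ ψ : ℝ → ℝ} (hφ : Continuous φ) (hψ : Continuous ψ)
    (f : IntervalL2 a b) :
    ContinuousOn (fun x => (ψ x : ℂ) * ∫ t in a..x, (φ t : ℂ) * f t) (Icc a b) :=
  (Complex.continuous_ofReal.comp hψ).continuousOn.mul
    (hasDensityOn_primitive hφ (integrableOn_coe f)).continuousOn

theorem exists_volterra_bound (a b : ℝ) {φ ψ : ℝ → ℝ} (hφ : Continuous φ) (hψ : Continuous ψ) :
    ∃ K : ℝ, ∀ f : IntervalL2 a b, ‖toL2 (continuousOn_volterra hφ hψ f)‖ ≤ K * ‖f‖ := by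
  obtain ⟨K, hK0, hK⟩ := exists_primitive_bound a b hφ
  obtain ⟨M, hM0, hM⟩ := exists_bound_of_continuous a b hψ
  refine ⟨(measureUnivNNReal (volume.restrict (Ioo a b)) : ℝ) ^ (2 : ENNReal).toReal⁻¹ * (M * K),
    fun f => ?_⟩
  rw [mul_assoc]
  refine Lp.norm_le_of_ae_bound (by positivity) ?_
  filter_upwards [coeFn_toL2 (continuousOn_volterra hφ hψ f),
    ae_restrict_mem measurableSet_Ioo] with x hx hxm
  have hxm' := Ioo_subset_Icc_self hxm
  rw [hx, norm_mul, Complex.norm_real, mul_assoc]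
  exact mul_le_mul (hM x hxm') (hK f x hxm') (norm_nonneg _) hM0

/-- The operator `f ↦ ψ(x) ∫ₐˣ φ f` on `L²(a, b)`. -/
def volterraCLM (a b : ℝ) {φ ψ : ℝ → ℝ} (hφ : Continuous φ) (hψ : Continuous ψ) :
    IntervalL2 a b →L[ℂ] IntervalL2 a b :=
  LinearMap.mkContinuous
    { toFun := fun f => toL2 (continuousOn_volterra hφ hψ f)
      map_add' := fun f g => by
        refine Lp.ext ?_
        filter_upwards [coeFn_toL2 (continuousOn_volterra hφ hψ f),
          coeFn_toL2 (continuousOn_volterra hφ hψ g),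
          coeFn_toL2 (continuousOn_volterra hφ hψ (f + g)),
          Lp.coeFn_add (toL2 (continuousOn_volterra hφ hψ f))
            (toL2 (continuousOn_volterra hφ hψ g)),
          ae_restrict_mem measurableSet_Ioo] with x h1 h2 h3 h4 hx
        rw [h4, Pi.add_apply, h1, h2, h3, primitive_add hφ f g (Ioo_subset_Icc_self hx), mul_add]
      map_smul' := fun z f => by
        refine Lp.ext ?_
        filter_upwards [coeFn_toL2 (continuousOn_volterra hφ hψ f),
          coeFn_toL2 (continuousOn_volterra hφ hψ (z • f)),
          Lp.coeFn_smul z (toL2 (continuousOn_volterra hφ hψ f)),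
          ae_restrict_mem measurableSet_Ioo] with x h1 h2 h4 hx
        simp only [RingHom.id_apply]
        rw [h4, Pi.smul_apply, h1, h2, primitive_smul z f (Ioo_subset_Icc_self hx), smul_eq_mul]
        ring }
    (exists_volterra_bound a b hφ hψ).choose
    (exists_volterra_bound a b hφ hψ).choose_spec

theorem coeFn_volterraCLM {a b : ℝ} {φ ψ : ℝ → ℝ} (hφ : Continuous φ) (hψ : Continuous ψ)
    (f : IntervalL2 a b) : volterraCLM a b hφ hψ f =ᵐ[volume.restrict (Ioo a b)]
      fun x => (ψ x : ℂ) * ∫ t in a..x, (φ t : ℂ) * f t :=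
  coeFn_toL2 (continuousOn_volterra hφ hψ f)

/-! ### Operators between `ℓ²` spaces -/

/-- The map `τ` colours the indices so that `φ` is injective on each colour class. Each class
therefore contributes at most the square of the norm of `x`. -/
theorem lp_sum_comp_le {ι ι' K : Type*} [Fintype K] {E : ι → Type*}
    [∀ i, NormedAddCommGroup (E i)] (φ : ι' → ι) (τ : ι' → K) (hinj : Function.Injective fun i => (φ i, τ i))
    (x : lp E 2) (s : Finset ι') :
    ∑ i ∈ s, ‖x (φ i)‖ ^ (2 : ℝ) ≤ Fintype.card K * ‖x‖ ^ (2 : ℝ) := by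
  classical
  rw [← Finset.sum_fiberwise s τ]
  have : ∀ k ∈ (Finset.univ : Finset K),
      ∑ i ∈ s with τ i = k, ‖x (φ i)‖ ^ (2 : ℝ) ≤ ‖x‖ ^ (2 : ℝ) := by
    intro k _
    have hinj' : Set.InjOn φ ↑({i ∈ s | τ i = k} : Finset ι') := by
      intro i hi j hj hij
      simp only [Finset.coe_filter, Set.mem_ofPred_eq] at hi hj
      exact hinj (Prod.ext hij (hi.2.trans hj.2.symm))
    rw [← Finset.sum_image (f := fun j => ‖x j‖ ^ (2 : ℝ)) hinj']
    have := lp.sum_rpow_le_norm_rpow (p := 2) (by norm_num) x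
      (Finset.image φ ({i ∈ s | τ i = k} : Finset ι'))
    simpa using this
  refine (Finset.sum_le_sum this).trans (le_of_eq ?_)
  simp

section lpMaps

variable {ι ι' K : Type*} [Fintype K] {E : ι → Type*} {F : ι' → Type*}
  [∀ i, NormedAddCommGroup (E i)] [∀ i, NormedSpace ℂ (E i)]
  [∀ i, NormedAddCommGroup (F i)] [∀ i, NormedSpace ℂ (F i)]

theorem lp_pull_sum_le (φ : ι' → ι) (τ : ι' → K) (hinj : Function.Injective fun i => (φ i, τ i))
    (T : ∀ i, E (φ i) →L[ℂ] F i) {C : ℝ} (hC : 0 ≤ C) (hT : ∀ i, ‖T i‖ ≤ C) (x : lp E 2)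
    (s : Finset ι') :
    ∑ i ∈ s, ‖T i (x (φ i))‖ ^ (2 : ℝ) ≤ (C * √(Fintype.card K) * ‖x‖) ^ (2 : ℝ) := by
  calc ∑ i ∈ s, ‖T i (x (φ i))‖ ^ (2 : ℝ) ≤ ∑ i ∈ s, C ^ (2 : ℝ) * ‖x (φ i)‖ ^ (2 : ℝ) := by
        refine Finset.sum_le_sum fun i _ => ?_
        rw [← Real.mul_rpow hC (norm_nonneg _)]
        exact Real.rpow_le_rpow (norm_nonneg _) ((T i).le_of_opNorm_le (hT i) _) (by norm_num)
    _ = C ^ (2 : ℝ) * ∑ i ∈ s, ‖x (φ i)‖ ^ (2 : ℝ) := (Finset.mul_sum _ _ _).symm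
    _ ≤ C ^ (2 : ℝ) * (Fintype.card K * ‖x‖ ^ (2 : ℝ)) :=
        mul_le_mul_of_nonneg_left (lp_sum_comp_le φ τ hinj x s) (by positivity)
    _ = (C * √(Fintype.card K) * ‖x‖) ^ (2 : ℝ) := by
        have h : √(Fintype.card K : ℝ) ^ 2 = Fintype.card K := Real.sq_sqrt (by positivity)
        simp only [Real.rpow_two]
        rw [mul_pow, mul_pow, h]
        ring

/-- The operator with components `(T x) i = T i (x (φ i))`, for a uniformly bounded family `T` and a
map `φ` with fibres of bounded size. -/
def lpPull (φ : ι' → ι) (τ : ι' → K) (hinj : Function.Injective fun i => (φ i, τ i))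
    (T : ∀ i, E (φ i) →L[ℂ] F i) {C : ℝ} (hC : 0 ≤ C) (hT : ∀ i, ‖T i‖ ≤ C) :
    lp E 2 →L[ℂ] lp F 2 :=
  LinearMap.mkContinuous
    { toFun := fun x => ⟨fun i => T i (x (φ i)), memℓp_gen' fun s => by
        simpa using lp_pull_sum_le φ τ hinj T hC hT x s⟩
      map_add' := fun x y => by
        ext i
        exact (T i).map_add (x (φ i)) (y (φ i))
      map_smul' := fun z x => by
        ext i
        simp }
    (C * √(Fintype.card K))
    fun x => lp.norm_le_of_forall_sum_le (by norm_num) (by positivity) fun s => by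
      simpa using lp_pull_sum_le φ τ hinj T hC hT x s

theorem norm_lpPull_le (φ : ι' → ι) (τ : ι' → K) (hinj : Function.Injective fun i => (φ i, τ i))
    (T : ∀ i, E (φ i) →L[ℂ] F i) {C : ℝ} (hC : 0 ≤ C) (hT : ∀ i, ‖T i‖ ≤ C) :
    ‖lpPull φ τ hinj T hC hT‖ ≤ C * √(Fintype.card K) :=
  LinearMap.mkContinuous_norm_le _ (by positivity) _

end lpMaps

end

section

/-! ### Operators between the vertex space and the graph space -/

instance : DecidableEq EdgeKind := fun a b => by
  cases a <;> cases b <;> first | exact isTrue rfl | exact isFalse EdgeKind.noConfusion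

instance : Fintype EdgeKind where
  elems := {.dir₁, .dir₂, .plus, .minus}
  complete := fun x => by cases x <;> simp

/-- `ℓ²(ℤ²)`. -/
abbrev VertexL2 := lp (fun _ : ℤ × ℤ => ℂ) 2

/-- The translation `(x_c) ↦ (x_{c+d})` of `ℓ²(ℤ²)`. -/
def shift (d : ℤ × ℤ) : VertexL2 →L[ℂ] VertexL2 :=
  lpPull (K := Unit) (fun c => c + d) (fun _ => ())
    (fun _ _ h => add_right_cancel (Prod.ext_iff.mp h).1) (fun _ => ContinuousLinearMap.id ℂ ℂ)
    zero_le_one (fun _ => ContinuousLinearMap.norm_id_le)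

@[simp] theorem shift_apply (d : ℤ × ℤ) (x : VertexL2) (c : ℤ × ℤ) : shift d x c = x (c + d) := rfl

theorem norm_shift_le (d : ℤ × ℤ) : ‖shift d‖ ≤ 1 := by
  refine (norm_lpPull_le _ _ _ _ _ _).trans (le_of_eq ?_)
  simp

variable {a₁ a₂ a₃ : ℝ}

/-- A family of functionals, one on each edge of a given kind, as a map into `ℓ²(ℤ²)`. -/
def edgeFunctional (κ : EdgeKind)
    (T : IntervalL2 (left a₃ κ) (right a₁ a₂ a₃ κ) →L[ℂ] ℂ) : GraphL2 a₁ a₂ a₃ →L[ℂ] VertexL2 :=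
  lpPull (K := Unit) (fun c => (c, κ)) (fun _ => ())
    (fun _ _ h => (Prod.ext_iff.mp (Prod.ext_iff.mp h).1).1) (fun _ => T)
    (norm_nonneg T) (fun _ => le_rfl)

/-- The map which puts the multiple `x_c v_κ` of the profile `v_κ` on the edge `(c, κ)`. -/
def embed (v : ∀ κ, IntervalL2 (left a₃ κ) (right a₁ a₂ a₃ κ)) :
    VertexL2 →L[ℂ] GraphL2 a₁ a₂ a₃ :=
  lpPull (F := fun e : Edge => IntervalL2 (left a₃ e.2) (right a₁ a₂ a₃ e.2)) (C := ∑ κ, ‖v κ‖)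
    -- The four edges of a cell share one vertex value; the kind of edge is the colour that
    -- separates them.
    Prod.fst Prod.snd (fun _ _ h => h)
    (fun e => ContinuousLinearMap.toSpanSingleton ℂ (v e.2))
    (Finset.sum_nonneg fun _ _ => norm_nonneg _)
    (fun e => by
      rw [ContinuousLinearMap.norm_toSpanSingleton]
      exact Finset.single_le_sum (f := fun κ => ‖v κ‖) (fun _ _ => norm_nonneg _)
        (Finset.mem_univ e.2))

@[simp] theorem embed_apply (v : ∀ κ, IntervalL2 (left a₃ κ) (right a₁ a₂ a₃ κ)) (x : VertexL2)
    (c : ℤ × ℤ) (κ : EdgeKind) : embed v x (c, κ) = x c • v κ := rfl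

/-- The sum over the kinds of edges of `embed`, with coefficients that depend on the kind. -/
def assemble {H : Type*} [NormedAddCommGroup H] [NormedSpace ℂ H]
    (v : ∀ κ, IntervalL2 (left a₃ κ) (right a₁ a₂ a₃ κ)) (X : EdgeKind → H →L[ℂ] VertexL2) :
    H →L[ℂ] GraphL2 a₁ a₂ a₃ :=
  ∑ κ, (embed (Pi.single κ (v κ))).comp (X κ)

theorem assemble_apply {H : Type*} [NormedAddCommGroup H] [NormedSpace ℂ H]
    (v : ∀ κ, IntervalL2 (left a₃ κ) (right a₁ a₂ a₃ κ)) (X : EdgeKind → H →L[ℂ] VertexL2) (f : H)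
    (c : ℤ × ℤ) (κ : EdgeKind) : assemble v X f (c, κ) = X κ f c • v κ := by
  simp only [assemble, sum_apply, ContinuousLinearMap.comp_apply,
    lp.coeFn_sum, Finset.sum_apply, embed_apply]
  rw [Finset.sum_eq_single κ]
  · simp
  · intro κ' _ h
    rw [Pi.single_eq_of_ne h.symm, smul_zero]
  · simp

/-! ### Functions on the graph given by their initial data on the edges -/

variable {lam : ℝ} (P : FundPair lam)

/-- The solution of `-u'' - lam u = g` on every edge with initial data `X`, `Y`. -/
def edgeSol (g : GraphL2 a₁ a₂ a₃) (X Y : ℤ × ℤ → EdgeKind → ℂ) (c : ℤ × ℤ) (κ : EdgeKind) :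
    ℝ → ℂ :=
  P.sol (left a₃ κ)
    (fun x => X c κ + ∫ t in (left a₃ κ)..x, (P.s (t - left a₃ κ) : ℂ) * g (c, κ) t)
    (fun x => Y c κ - ∫ t in (left a₃ κ)..x, (P.c (t - left a₃ κ) : ℂ) * g (c, κ) t)

/-- The derivative of `edgeSol`. -/
def edgeSol' (g : GraphL2 a₁ a₂ a₃) (X Y : ℤ × ℤ → EdgeKind → ℂ) (c : ℤ × ℤ) (κ : EdgeKind) :
    ℝ → ℂ :=
  P.sol' (left a₃ κ)
    (fun x => X c κ + ∫ t in (left a₃ κ)..x, (P.s (t - left a₃ κ) : ℂ) * g (c, κ) t)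
    (fun x => Y c κ - ∫ t in (left a₃ κ)..x, (P.c (t - left a₃ κ) : ℂ) * g (c, κ) t)

theorem isH2_edgeSol (g f f₁ : GraphL2 a₁ a₂ a₃) (X Y : ℤ × ℤ → EdgeKind → ℂ)
    (hf : ∀ c κ, f (c, κ) =ᵐ[edgeMeasure a₁ a₂ a₃ κ] edgeSol P g X Y c κ)
    (hf₁ : ∀ c κ, f₁ (c, κ) =ᵐ[edgeMeasure a₁ a₂ a₃ κ] edgeSol' P g X Y c κ) :
    IsH2 (edgeSol P g X Y) (edgeSol' P g X Y) f f₁ (-((lam : ℂ) • f + g)) := by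
  have h₁ : ∀ c κ, HasDensityOn (left a₃ κ) (right a₁ a₂ a₃ κ)
      (fun x => X c κ + ∫ t in (left a₃ κ)..x, (P.s (t - left a₃ κ) : ℂ) * g (c, κ) t)
      (fun x => P.s (x - left a₃ κ) * g (c, κ) x) := fun c κ =>
    ⟨integrableOn_ofReal_mul (P.continuous_s_sub _) (integrableOn_coe (g (c, κ))), fun x _ => by
      simp⟩
  have h₂ : ∀ c κ, HasDensityOn (left a₃ κ) (right a₁ a₂ a₃ κ)
      (fun x => Y c κ - ∫ t in (left a₃ κ)..x, (P.c (t - left a₃ κ) : ℂ) * g (c, κ) t)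
      (fun x => -(P.c (x - left a₃ κ) * g (c, κ) x)) := fun c κ =>
    ⟨(integrableOn_ofReal_mul (P.continuous_c_sub _) (integrableOn_coe (g (c, κ)))).neg,
      fun x _ => by simp [sub_eq_add_neg]⟩
  refine ⟨fun c κ => (hf c κ).symm, fun c κ => (hf₁ c κ).symm, fun c κ =>
    (P.hasDensityOn_sol (h₁ c κ) (h₂ c κ)).eq_integral, fun c κ => ?_⟩
  refine ((P.hasDensityOn_sol' (h₁ c κ) (h₂ c κ)).congr_density ?_).eq_integral
  have e1 : (-((lam : ℂ) • f + g) : GraphL2 a₁ a₂ a₃) (c, κ) =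
    -((lam : ℂ) • f (c, κ) + g (c, κ)) := rfl
  rw [e1]
  filter_upwards [hf c κ, Lp.coeFn_neg ((lam : ℂ) • f (c, κ) + g (c, κ)),
    Lp.coeFn_add ((lam : ℂ) • f (c, κ)) (g (c, κ)), Lp.coeFn_smul (lam : ℂ) (f (c, κ))]
    with x h3 h4 h5 h6
  rw [h4, Pi.neg_apply, h5, Pi.add_apply, h6, Pi.smul_apply, h3, smul_eq_mul]
  simp only [edgeSol]
  ring

theorem edgeSol_left (g : GraphL2 a₁ a₂ a₃) (X Y : ℤ × ℤ → EdgeKind → ℂ) (c : ℤ × ℤ)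
    (κ : EdgeKind) : edgeSol P g X Y c κ (left a₃ κ) = X c κ := by
  simp [edgeSol, FundPair.sol, P.c_zero, P.s_zero]

theorem edgeSol'_left (g : GraphL2 a₁ a₂ a₃) (X Y : ℤ × ℤ → EdgeKind → ℂ) (c : ℤ × ℤ)
    (κ : EdgeKind) : edgeSol' P g X Y c κ (left a₃ κ) = Y c κ := by
  simp [edgeSol', FundPair.sol', P.c_zero, P.s_zero]

/-- Length of an edge. -/
def len (a₁ a₂ a₃ : ℝ) (κ : EdgeKind) : ℝ := right a₁ a₂ a₃ κ - left a₃ κ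

/-- The end value of the solution of `-u'' - lam u = g` with zero initial data. -/
def endValue (κ : EdgeKind) (h : left a₃ κ ≤ right a₁ a₂ a₃ κ) :
    IntervalL2 (left a₃ κ) (right a₁ a₂ a₃ κ) →L[ℂ] ℂ :=
  (P.c (len a₁ a₂ a₃ κ) : ℂ) • momentCLM h (P.continuous_s_sub (left a₃ κ)) -
    (P.s (len a₁ a₂ a₃ κ) : ℂ) • momentCLM h (P.continuous_c_sub (left a₃ κ))

/-- The end derivative of the solution of `-u'' - lam u = g` with zero initial data. -/
def endDeriv (κ : EdgeKind) (h : left a₃ κ ≤ right a₁ a₂ a₃ κ) :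
    IntervalL2 (left a₃ κ) (right a₁ a₂ a₃ κ) →L[ℂ] ℂ :=
  (-lam * P.s (len a₁ a₂ a₃ κ) : ℂ) • momentCLM h (P.continuous_s_sub (left a₃ κ)) -
    (P.c (len a₁ a₂ a₃ κ) : ℂ) • momentCLM h (P.continuous_c_sub (left a₃ κ))

theorem edgeSol_right (g : GraphL2 a₁ a₂ a₃) (X Y : ℤ × ℤ → EdgeKind → ℂ) (c : ℤ × ℤ)
    (κ : EdgeKind) (h : left a₃ κ ≤ right a₁ a₂ a₃ κ) :
    edgeSol P g X Y c κ (right a₁ a₂ a₃ κ) =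
      P.c (len a₁ a₂ a₃ κ) * X c κ + P.s (len a₁ a₂ a₃ κ) * Y c κ +
        endValue P κ h (g (c, κ)) := by
  simp only [edgeSol, FundPair.sol, endValue, len, sub_apply,
    smul_apply, momentCLM_apply, smul_eq_mul]
  ring

theorem edgeSol'_right (g : GraphL2 a₁ a₂ a₃) (X Y : ℤ × ℤ → EdgeKind → ℂ) (c : ℤ × ℤ)
    (κ : EdgeKind) (h : left a₃ κ ≤ right a₁ a₂ a₃ κ) :
    edgeSol' P g X Y c κ (right a₁ a₂ a₃ κ) =
      -lam * P.s (len a₁ a₂ a₃ κ) * X c κ + P.c (len a₁ a₂ a₃ κ) * Y c κ +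
        endDeriv P κ h (g (c, κ)) := by
  simp only [edgeSol', FundPair.sol', endDeriv, len, sub_apply,
    smul_apply, momentCLM_apply, smul_eq_mul]
  ring

/-- The class of `c(· - left)` on an edge. -/
def cosClass (a₁ a₂ a₃ : ℝ) (κ : EdgeKind) : IntervalL2 (left a₃ κ) (right a₁ a₂ a₃ κ) :=
  toL2 (v := fun x => (P.c (x - left a₃ κ) : ℂ))
    (Complex.continuous_ofReal.comp (P.continuous_c_sub _)).continuousOn

/-- The class of `s(· - left)` on an edge. -/
def sinClass (a₁ a₂ a₃ : ℝ) (κ : EdgeKind) : IntervalL2 (left a₃ κ) (right a₁ a₂ a₃ κ) :=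
  toL2 (v := fun x => (P.s (x - left a₃ κ) : ℂ))
    (Complex.continuous_ofReal.comp (P.continuous_s_sub _)).continuousOn

/-- The solution operator of `-u'' - lam u = g` with zero initial data on an edge. -/
def duhamel (a₁ a₂ a₃ : ℝ) (κ : EdgeKind) :
    IntervalL2 (left a₃ κ) (right a₁ a₂ a₃ κ) →L[ℂ] IntervalL2 (left a₃ κ) (right a₁ a₂ a₃ κ) :=
  volterraCLM _ _ (P.continuous_s_sub (left a₃ κ)) (P.continuous_c_sub (left a₃ κ)) -
    volterraCLM _ _ (P.continuous_c_sub (left a₃ κ)) (P.continuous_s_sub (left a₃ κ))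

/-- The derivative of `duhamel`. -/
def duhamel' (a₁ a₂ a₃ : ℝ) (κ : EdgeKind) :
    IntervalL2 (left a₃ κ) (right a₁ a₂ a₃ κ) →L[ℂ] IntervalL2 (left a₃ κ) (right a₁ a₂ a₃ κ) :=
  (-lam : ℂ) • volterraCLM _ _ (P.continuous_s_sub (left a₃ κ)) (P.continuous_s_sub (left a₃ κ)) -
    volterraCLM _ _ (P.continuous_c_sub (left a₃ κ)) (P.continuous_c_sub (left a₃ κ))

theorem exists_norm_le_of_kind {F : EdgeKind → Type*} [∀ κ, SeminormedAddCommGroup (F κ)]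
    (T : ∀ κ, F κ) : ∃ C : ℝ, 0 ≤ C ∧ ∀ κ, ‖T κ‖ ≤ C :=
  ⟨∑ κ, ‖T κ‖, Finset.sum_nonneg fun _ _ => norm_nonneg _, fun κ =>
    Finset.single_le_sum (f := fun κ => ‖T κ‖) (fun _ _ => norm_nonneg _) (Finset.mem_univ κ)⟩

theorem exists_graph_operator (T : ∀ κ, IntervalL2 (left a₃ κ) (right a₁ a₂ a₃ κ) →L[ℂ]
      IntervalL2 (left a₃ κ) (right a₁ a₂ a₃ κ)) :
    ∃ S : GraphL2 a₁ a₂ a₃ →L[ℂ] GraphL2 a₁ a₂ a₃, ∀ f c κ, S f (c, κ) = T κ (f (c, κ)) := by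
  obtain ⟨C, hC, hT⟩ := exists_norm_le_of_kind T
  exact ⟨lp.mapCLM 2 (fun e : Edge => T e.2) hC fun e => hT e.2, fun f c κ => rfl⟩

/-- If the initial data depend boundedly on `g`, so does the solution: it is the data times the
fixed profiles `c`, `s`, plus a Volterra operator on each edge, with uniform bounds because there
are only four kinds of edges. Solving the resolvent equation is thereby reduced to choosing `X` and
`Y` so that the vertex conditions hold. -/
theorem exists_solution_operators (X Y : EdgeKind → GraphL2 a₁ a₂ a₃ →L[ℂ] VertexL2) :
    ∃ R R₁ : GraphL2 a₁ a₂ a₃ →L[ℂ] GraphL2 a₁ a₂ a₃, ∀ g,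
      IsH2 (edgeSol P g (fun c κ => X κ g c) (fun c κ => Y κ g c))
        (edgeSol' P g (fun c κ => X κ g c) (fun c κ => Y κ g c)) (R g) (R₁ g)
        (-((lam : ℂ) • R g + g)) := by
  obtain ⟨D, hD⟩ := exists_graph_operator (duhamel P a₁ a₂ a₃)
  obtain ⟨D', hD'⟩ := exists_graph_operator (duhamel' P a₁ a₂ a₃)
  refine ⟨assemble (cosClass P a₁ a₂ a₃) X + assemble (sinClass P a₁ a₂ a₃) Y + D,
    (-lam : ℂ) • assemble (sinClass P a₁ a₂ a₃) X + assemble (cosClass P a₁ a₂ a₃) Y + D',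
    fun g => isH2_edgeSol P g _ _ _ _ (fun c κ => ?_) (fun c κ => ?_)⟩
  · have e : (assemble (cosClass P a₁ a₂ a₃) X + assemble (sinClass P a₁ a₂ a₃) Y + D) g (c, κ) =
        X κ g c • cosClass P a₁ a₂ a₃ κ + Y κ g c • sinClass P a₁ a₂ a₃ κ +
        (volterraCLM _ _ (P.continuous_s_sub (left a₃ κ)) (P.continuous_c_sub (left a₃ κ))
          (g (c, κ)) -
        volterraCLM _ _ (P.continuous_c_sub (left a₃ κ)) (P.continuous_s_sub (left a₃ κ))
          (g (c, κ))) := by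
      simp only [add_apply, lp.coeFn_add, Pi.add_apply, assemble_apply, hD,
        duhamel, sub_apply]
    rw [e]
    filter_upwards [Lp.coeFn_add (X κ g c • cosClass P a₁ a₂ a₃ κ + Y κ g c • sinClass P a₁ a₂ a₃ κ)
        (volterraCLM _ _ (P.continuous_s_sub (left a₃ κ)) (P.continuous_c_sub (left a₃ κ))
          (g (c, κ)) -
        volterraCLM _ _ (P.continuous_c_sub (left a₃ κ)) (P.continuous_s_sub (left a₃ κ))
          (g (c, κ))),
      Lp.coeFn_add (X κ g c • cosClass P a₁ a₂ a₃ κ) (Y κ g c • sinClass P a₁ a₂ a₃ κ),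
      Lp.coeFn_sub (volterraCLM _ _ (P.continuous_s_sub (left a₃ κ)) (P.continuous_c_sub (left a₃ κ))
          (g (c, κ)))
        (volterraCLM _ _ (P.continuous_c_sub (left a₃ κ)) (P.continuous_s_sub (left a₃ κ))
          (g (c, κ))),
      Lp.coeFn_smul (X κ g c) (cosClass P a₁ a₂ a₃ κ),
      Lp.coeFn_smul (Y κ g c) (sinClass P a₁ a₂ a₃ κ),
      coeFn_volterraCLM (P.continuous_s_sub (left a₃ κ)) (P.continuous_c_sub (left a₃ κ)) (g (c, κ)),
      coeFn_volterraCLM (P.continuous_c_sub (left a₃ κ)) (P.continuous_s_sub (left a₃ κ)) (g (c, κ)),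
      coeFn_toL2 (a := left a₃ κ) (b := right a₁ a₂ a₃ κ)
        (Complex.continuous_ofReal.comp (P.continuous_c_sub (left a₃ κ))).continuousOn,
      coeFn_toL2 (a := left a₃ κ) (b := right a₁ a₂ a₃ κ)
        (Complex.continuous_ofReal.comp (P.continuous_s_sub (left a₃ κ))).continuousOn]
      with x h1 h2 h3 h4 h5 h6 h7 h8 h9
    rw [h1, Pi.add_apply, h2, Pi.add_apply, h3, Pi.sub_apply, h4, h5, h6, h7, Pi.smul_apply,
      Pi.smul_apply]
    erw [h8, h9]
    simp only [edgeSol, FundPair.sol, smul_eq_mul, Function.comp]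
    ring
  · have e : ((-lam : ℂ) • assemble (sinClass P a₁ a₂ a₃) X + assemble (cosClass P a₁ a₂ a₃) Y + D')
        g (c, κ) =
        (-lam * X κ g c : ℂ) • sinClass P a₁ a₂ a₃ κ + Y κ g c • cosClass P a₁ a₂ a₃ κ +
        ((-lam : ℂ) • volterraCLM _ _ (P.continuous_s_sub (left a₃ κ))
          (P.continuous_s_sub (left a₃ κ)) (g (c, κ)) -
        volterraCLM _ _ (P.continuous_c_sub (left a₃ κ)) (P.continuous_c_sub (left a₃ κ))
          (g (c, κ))) := by
      simp only [add_apply, smul_apply, lp.coeFn_add,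
        lp.coeFn_smul, Pi.smul_apply, Pi.add_apply, assemble_apply, hD',
        duhamel', sub_apply, mul_smul]
    rw [e]
    filter_upwards [Lp.coeFn_add
        ((-lam * X κ g c : ℂ) • sinClass P a₁ a₂ a₃ κ + Y κ g c • cosClass P a₁ a₂ a₃ κ)
        ((-lam : ℂ) • volterraCLM _ _ (P.continuous_s_sub (left a₃ κ))
          (P.continuous_s_sub (left a₃ κ)) (g (c, κ)) -
        volterraCLM _ _ (P.continuous_c_sub (left a₃ κ)) (P.continuous_c_sub (left a₃ κ))
          (g (c, κ))),
      Lp.coeFn_add ((-lam * X κ g c : ℂ) • sinClass P a₁ a₂ a₃ κ) (Y κ g c • cosClass P a₁ a₂ a₃ κ),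
      Lp.coeFn_sub ((-lam : ℂ) • volterraCLM _ _ (P.continuous_s_sub (left a₃ κ))
          (P.continuous_s_sub (left a₃ κ)) (g (c, κ)))
        (volterraCLM _ _ (P.continuous_c_sub (left a₃ κ)) (P.continuous_c_sub (left a₃ κ))
          (g (c, κ))),
      Lp.coeFn_smul (-lam * X κ g c : ℂ) (sinClass P a₁ a₂ a₃ κ),
      Lp.coeFn_smul (Y κ g c) (cosClass P a₁ a₂ a₃ κ),
      Lp.coeFn_smul (-lam : ℂ) (volterraCLM _ _ (P.continuous_s_sub (left a₃ κ))
          (P.continuous_s_sub (left a₃ κ)) (g (c, κ))),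
      coeFn_volterraCLM (P.continuous_s_sub (left a₃ κ)) (P.continuous_s_sub (left a₃ κ)) (g (c, κ)),
      coeFn_volterraCLM (P.continuous_c_sub (left a₃ κ)) (P.continuous_c_sub (left a₃ κ)) (g (c, κ)),
      coeFn_toL2 (a := left a₃ κ) (b := right a₁ a₂ a₃ κ)
        (Complex.continuous_ofReal.comp (P.continuous_c_sub (left a₃ κ))).continuousOn,
      coeFn_toL2 (a := left a₃ κ) (b := right a₁ a₂ a₃ κ)
        (Complex.continuous_ofReal.comp (P.continuous_s_sub (left a₃ κ))).continuousOn]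
      with x h1 h2 h3 h4 h5 h10 h6 h7 h8 h9
    rw [h1, Pi.add_apply, h2, Pi.add_apply, h3, Pi.sub_apply, h4, h5, h10, Pi.smul_apply,
      Pi.smul_apply, Pi.smul_apply, h6, h7]
    erw [h8, h9]
    simp only [edgeSol', FundPair.sol', smul_eq_mul, Function.comp]
    ring

end

section

/-! ### A criterion for the resolvent set -/

theorem mem_domain_iff {a₁ a₂ a₃ β : ℝ} {f g : GraphL2 a₁ a₂ a₃} :
    (∃ hf : f ∈ (periodicOperator a₁ a₂ a₃ β).domain, periodicOperator a₁ a₂ a₃ β ⟨f, hf⟩ = g) ↔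
      InDomain β f (-g) := by
  have h : (f, g) ∈ (periodicOperator a₁ a₂ a₃ β).graph ↔ InDomain β f (-g) := by
    rw [periodicOperator_graph]
    rfl
  rw [← h, LinearPMap.mem_graph_iff]
  constructor
  · rintro ⟨hf, hg⟩
    exact ⟨⟨f, hf⟩, rfl, hg⟩
  · rintro ⟨⟨y, hy⟩, rfl, hg⟩
    exact ⟨hy, hg⟩

/-- A bounded right inverse together with injectivity is enough: for `x` in the domain, `R (T x -
lam x) - x` solves the homogeneous equation and hence vanishes, so `R` is also a left inverse. -/
theorem notMem_realSpectrum_of {a₁ a₂ a₃ β lam : ℝ}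
    (R : GraphL2 a₁ a₂ a₃ →L[ℂ] GraphL2 a₁ a₂ a₃)
    (hR : ∀ g, InDomain β (R g) (-((lam : ℂ) • R g + g)))
    (hinj : ∀ f : GraphL2 a₁ a₂ a₃, InDomain β f (-((lam : ℂ) • f)) → f = 0) :
    lam ∉ realSpectrum (periodicOperator a₁ a₂ a₃ β) := by
  rw [realSpectrum, mem_ofPred_eq, not_not]
  refine ⟨R, fun f => ?_, fun x => ?_⟩
  · obtain ⟨hf, h⟩ := mem_domain_iff.mpr (hR f)
    exact ⟨hf, by rw [h]; abel⟩
  · obtain ⟨x, hx⟩ := x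
    have h1 : InDomain β x (-(periodicOperator a₁ a₂ a₃ β ⟨x, hx⟩)) := mem_domain_iff.mp ⟨hx, rfl⟩
    set y := periodicOperator a₁ a₂ a₃ β ⟨x, hx⟩
    have h2 := (hR (y - (lam : ℂ) • x)).add (h1.smul (-1))
    have h3 : R (y - (lam : ℂ) • x) + (-1 : ℂ) • x = 0 := by
      refine hinj _ ?_
      convert h2 using 1
      module
    have h4 : R (y - (lam : ℂ) • x) - x = 0 := by
      rw [← h3]
      module
    exact sub_eq_zero.mp h4

/-! ### Invertibility of the vertex operator -/

/-- The Laurent operator `α₁ (T₁ + T₁⁻¹) + α₂ (T₂ + T₂⁻¹) + δ` on `ℓ²(ℤ²)`. -/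
def laurent (α₁ α₂ δ : ℂ) : VertexL2 →L[ℂ] VertexL2 :=
  α₁ • (shift (1, 0) + shift (-1, 0)) + α₂ • (shift (0, 1) + shift (0, -1)) + δ • 1

theorem laurent_apply (α₁ α₂ δ : ℂ) (x : VertexL2) (k l : ℤ) :
    laurent α₁ α₂ δ x (k, l) =
      α₁ * (x (k + 1, l) + x (k - 1, l)) + α₂ * (x (k, l + 1) + x (k, l - 1)) + δ * x (k, l) := by
  simp only [laurent, add_apply, smul_apply, lp.coeFn_add, lp.coeFn_smul, Pi.add_apply,
    Pi.smul_apply, shift_apply, smul_eq_mul, Prod.mk_add_mk, add_zero, sub_eq_add_neg]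
  rfl

/-- Translations are contractions, so the off-diagonal part has norm less than `‖δ‖`, and a Neumann
series applies. -/
theorem isUnit_laurent {α₁ α₂ δ : ℂ} (h : 2 * ‖α₁‖ + 2 * ‖α₂‖ < ‖δ‖) :
    IsUnit (laurent α₁ α₂ δ) := by
  set N : VertexL2 →L[ℂ] VertexL2 :=
    α₁ • (shift (1, 0) + shift (-1, 0)) + α₂ • (shift (0, 1) + shift (0, -1)) with hN
  have hs : ∀ d d', ‖shift d + shift d'‖ ≤ 2 := fun d d' =>
    (norm_add_le _ _).trans (by linarith [norm_shift_le d, norm_shift_le d'])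
  have hn : ‖N‖ < ‖δ‖ := by
    have h3 : ‖α₁ • (shift (1, 0) + shift (-1, 0))‖ ≤ _ := ContinuousLinearMap.opNorm_smul_le _ _
    have h4 : ‖α₂ • (shift (0, 1) + shift (0, -1))‖ ≤ _ := ContinuousLinearMap.opNorm_smul_le _ _
    refine lt_of_le_of_lt ((norm_add_le _ _).trans (add_le_add h3 h4)) (lt_of_le_of_lt ?_ h)
    have h1 := mul_le_mul_of_nonneg_left (hs (1, 0) (-1, 0)) (norm_nonneg α₁)
    have h2 := mul_le_mul_of_nonneg_left (hs (0, 1) (0, -1)) (norm_nonneg α₂)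
    linarith
  have h1 : ‖-N‖ * ‖(1 : VertexL2 →L[ℂ] VertexL2)‖ < ‖δ‖ := by
    rw [norm_neg]
    refine lt_of_le_of_lt ?_ hn
    exact mul_le_of_le_one_right (norm_nonneg _) ContinuousLinearMap.norm_id_le
  have h2 := spectrum.mem_resolventSet_of_norm_lt_mul h1
  rw [spectrum.mem_resolventSet_iff, sub_neg_eq_add, Algebra.algebraMap_eq_smul_one] at h2
  rwa [laurent, ← hN, add_comm]

/-- Cramer's rule. Since `p`, `r`, `S` are scalars, the inverse of the determinant commutes with
`q`, and the adjugate matrix supplies the solution. -/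
theorem exists_solve_system {H : Type*} [NormedAddCommGroup H] [NormedSpace ℂ H]
    {p r S : ℂ} {q : VertexL2 →L[ℂ] VertexL2} (hΔ : IsUnit ((p * r) • 1 - S • q))
    (G₁ G₂ : H →L[ℂ] VertexL2) :
    ∃ A B : H →L[ℂ] VertexL2, ∀ f, p • A f + S • B f = G₁ f ∧ q (A f) + r • B f = G₂ f := by
  obtain ⟨Δ, hΔ'⟩ := hΔ
  set Q : VertexL2 →L[ℂ] VertexL2 := ((Δ⁻¹ : (VertexL2 →L[ℂ] VertexL2)ˣ) : VertexL2 →L[ℂ] VertexL2)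
  have hQΔ : ∀ x, Q ((p * r) • x - S • q x) = x := fun x => by
    have h1 : Q * (Δ : VertexL2 →L[ℂ] VertexL2) = 1 := Units.inv_mul Δ
    rw [hΔ'] at h1
    have := congrArg (fun T : VertexL2 →L[ℂ] VertexL2 => T x) h1
    simpa using this
  have hcomm : ∀ x, q (Q x) = Q (q x) := fun x => by
    have h1 : Commute q (Δ : VertexL2 →L[ℂ] VertexL2) := by
      rw [hΔ']
      exact (((Commute.one_right q).smul_right _).sub_right ((Commute.refl q).smul_right _))
    have h2 : Commute q Q := h1.units_inv_right
    exact congrArg (fun T : VertexL2 →L[ℂ] VertexL2 => T x) h2.eq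
  refine ⟨Q.comp (r • G₁ - S • G₂), Q.comp (p • G₂ - q.comp G₁), fun f => ⟨?_, ?_⟩⟩
  · rw [← hQΔ (G₁ f)]
    simp only [ContinuousLinearMap.comp_apply, sub_apply, smul_apply, map_sub, map_smul]
    module
  · rw [← hQΔ (G₂ f)]
    simp only [ContinuousLinearMap.comp_apply, sub_apply, smul_apply, map_sub, map_smul, hcomm]
    module

/-- Multiplication of the system by the adjugate matrix shows that the determinant annihilates `A`
and `B`. -/
theorem eq_zero_of_system {p r S : ℂ} {q : VertexL2 →L[ℂ] VertexL2}
    (hΔ : IsUnit ((p * r) • 1 - S • q)) {A B : VertexL2} (h₁ : p • A + S • B = 0)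
    (h₂ : q A + r • B = 0) : A = 0 ∧ B = 0 := by
  have hinj : ∀ x, (p * r) • x - S • q x = 0 → x = 0 := fun x hx => by
    obtain ⟨Δ, hΔ'⟩ := hΔ
    have h1 : ((Δ⁻¹ : (VertexL2 →L[ℂ] VertexL2)ˣ) : VertexL2 →L[ℂ] VertexL2) *
      (Δ : VertexL2 →L[ℂ] VertexL2) = 1 := Units.inv_mul Δ
    rw [hΔ'] at h1
    have := congrArg (fun T : VertexL2 →L[ℂ] VertexL2 => T x) h1
    simp only [mul_apply_eq_comp, sub_apply, smul_apply,
      one_apply_eq_self, hx, map_zero] at this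
    exact this.symm
  constructor
  · refine hinj A ?_
    have : (p * r) • A - S • q A = r • (p • A + S • B) - S • (q A + r • B) := by module
    rw [this, h₁, h₂, smul_zero, smul_zero, sub_zero]
  · refine hinj B ?_
    have : (p * r) • B - S • q B = p • (q A + r • B) - q (p • A + S • B) := by
      simp only [map_add, map_smul]
      module
    rw [this, h₁, h₂, smul_zero, map_zero, sub_zero]

/-! ### Vertex conditions in terms of initial data -/

section Conditions

variable {a₁ a₂ a₃ lam : ℝ} (P : FundPair lam)

theorem len_dir₁ : len a₁ a₂ a₃ .dir₁ = a₁ := sub_zero _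
theorem len_dir₂ : len a₁ a₂ a₃ .dir₂ = a₂ := sub_zero _
theorem len_plus : len a₁ a₂ a₃ .plus = a₃ / 2 := sub_zero _
theorem len_minus : len a₁ a₂ a₃ .minus = a₃ / 2 := by simp [len, left, right]

theorem left_lt_right (ha₁ : 0 < a₁) (ha₂ : 0 < a₂) (ha₃ : 0 < a₃) (κ : EdgeKind) :
    left a₃ κ < right a₁ a₂ a₃ κ := by
  cases κ <;> simp only [left, right] <;> linarith

theorem FundPair.c_double (a : ℝ) :
    (P.c a : ℂ) = P.c (a / 2) ^ 2 - lam * (P.s (a / 2) : ℂ) ^ 2 := by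
  have h := P.c_add (a / 2) (a / 2)
  rw [add_halves] at h
  rw [h]
  push_cast
  ring

theorem FundPair.s_double (a : ℝ) : (P.s a : ℂ) = 2 * P.s (a / 2) * P.c (a / 2) := by
  have h := P.s_add (a / 2) (a / 2)
  rw [add_halves] at h
  rw [h]
  push_cast
  ring

theorem exp_neg_mul_exp (β : ℝ) :
    Complex.exp (-Complex.I * β) * Complex.exp (Complex.I * β) = 1 := by
  rw [← Complex.exp_add]
  simp

theorem exp_add_exp_neg (β : ℝ) :
    Complex.exp (Complex.I * β) + Complex.exp (-Complex.I * β) = 2 * Real.cos β := by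
  rw [Complex.ofReal_cos, Complex.two_cos]
  ring_nf

/-- The operator `q` of the vertex system. -/
def vertexOp (a₁ a₂ a₃ β : ℝ) : VertexL2 →L[ℂ] VertexL2 :=
  laurent (P.s a₁ : ℂ)⁻¹ (P.s a₂ : ℂ)⁻¹
    (-2 * P.c a₁ / P.s a₁ - 2 * P.c a₂ / P.s a₂ + Complex.exp (Complex.I * β) * lam * P.s a₃)

/-- With `E = exp (iβ)` and `c² + lam s² = 1` at `a₃`, the scalar product is `2c - 2 cos β + E lam
s²`. Its last term cancels against the one in `vertexOp`, so the coefficients of the determinant are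
real and `β` enters only through `cos β`. -/
theorem det_vertex_system (a₁ a₂ a₃ β : ℝ) :
    ((P.c a₃ - Complex.exp (-Complex.I * β)) * (1 - Complex.exp (Complex.I * β) * P.c a₃)) • 1 -
      (P.s a₃ : ℂ) • vertexOp P a₁ a₂ a₃ β =
    laurent (-(P.s a₃ / P.s a₁ : ℝ) : ℂ) (-(P.s a₃ / P.s a₂ : ℝ) : ℂ)
      (-2 * (Real.cos β - P.c a₃ - P.s a₃ * (P.c a₁ / P.s a₁ + P.c a₂ / P.s a₂) : ℝ) : ℂ) := by
  have h : (P.c a₃ - Complex.exp (-Complex.I * β)) * (1 - Complex.exp (Complex.I * β) * P.c a₃) =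
      2 * P.c a₃ - 2 * Real.cos β + P.s a₃ * (Complex.exp (Complex.I * β) * lam * P.s a₃) := by
    linear_combination (P.c a₃ : ℂ) * exp_neg_mul_exp β -
      Complex.exp (Complex.I * β) * P.sq_add_complex a₃ - exp_add_exp_neg β
  rw [h, vertexOp, laurent, laurent]
  push_cast
  module

theorem isUnit_det (a₁ a₂ a₃ β : ℝ)
    (h : |P.s a₃ / P.s a₁| + |P.s a₃ / P.s a₂| <
      |Real.cos β - P.c a₃ - P.s a₃ * (P.c a₁ / P.s a₁ + P.c a₂ / P.s a₂)|) :
    IsUnit (((P.c a₃ - Complex.exp (-Complex.I * β)) *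
      (1 - Complex.exp (Complex.I * β) * P.c a₃)) • 1 - (P.s a₃ : ℂ) • vertexOp P a₁ a₂ a₃ β) := by
  rw [det_vertex_system]
  refine isUnit_laurent ?_
  rw [norm_neg, norm_neg, norm_mul, Complex.norm_real, Complex.norm_real, Complex.norm_real,
    Real.norm_eq_abs, Real.norm_eq_abs, Real.norm_eq_abs]
  norm_num
  linarith

/-- Translates membership in the domain into linear equations for the data at the left ends. On
three kinds of edges the left end is the vertex `v k ℓ`; on `minus` it is the free end `-a₃/2`.
Therefore quasi-periodicity prescribes the data there (`hXm`, `hYm`), and continuity at the vertex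
becomes an equation at the right end (`hm`). -/
theorem inDomain_of_initial_data {β : ℝ} (ha₁ : 0 < a₁) (ha₂ : 0 < a₂) (ha₃ : 0 < a₃)
    {g f f₁ : GraphL2 a₁ a₂ a₃} {X Y : ℤ × ℤ → EdgeKind → ℂ}
    (hH2 : IsH2 (edgeSol P g X Y) (edgeSol' P g X Y) f f₁ (-((lam : ℂ) • f + g)))
    (hX₁ : ∀ c, X c .dir₁ = X c .plus) (hX₂ : ∀ c, X c .dir₂ = X c .plus)
    (h₁ : ∀ k l, P.c a₁ * X (k, l) .dir₁ + P.s a₁ * Y (k, l) .dir₁ +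
      endValue P .dir₁ ha₁.le (g ((k, l), .dir₁)) = X (k + 1, l) .plus)
    (h₂ : ∀ k l, P.c a₂ * X (k, l) .dir₂ + P.s a₂ * Y (k, l) .dir₂ +
      endValue P .dir₂ ha₂.le (g ((k, l), .dir₂)) = X (k, l + 1) .plus)
    (hXm : ∀ c, X c .minus = Complex.exp (Complex.I * β) * (P.c (a₃ / 2) * X c .plus +
      P.s (a₃ / 2) * Y c .plus + endValue P .plus (half_pos ha₃).le (g (c, .plus))))
    (hYm : ∀ c, Y c .minus = Complex.exp (Complex.I * β) * (-lam * P.s (a₃ / 2) * X c .plus +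
      P.c (a₃ / 2) * Y c .plus + endDeriv P .plus (half_pos ha₃).le (g (c, .plus))))
    (hm : ∀ c, P.c (a₃ / 2) * X c .minus + P.s (a₃ / 2) * Y c .minus +
      endValue P .minus (neg_neg_of_pos (half_pos ha₃)).le (g (c, .minus)) = X c .plus)
    (hK : ∀ k l, Y (k, l) .dir₁ - (-lam * P.s a₁ * X (k - 1, l) .dir₁ +
        P.c a₁ * Y (k - 1, l) .dir₁ + endDeriv P .dir₁ ha₁.le (g ((k - 1, l), .dir₁))) +
      Y (k, l) .dir₂ - (-lam * P.s a₂ * X (k, l - 1) .dir₂ +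
        P.c a₂ * Y (k, l - 1) .dir₂ + endDeriv P .dir₂ ha₂.le (g ((k, l - 1), .dir₂))) +
      (Y (k, l) .plus - (-lam * P.s (a₃ / 2) * X (k, l) .minus + P.c (a₃ / 2) * Y (k, l) .minus +
        endDeriv P .minus (neg_neg_of_pos (half_pos ha₃)).le (g ((k, l), .minus)))) = 0) :
    InDomain β f (-((lam : ℂ) • f + g)) := by
  have eR := fun c κ => edgeSol_right P g X Y c κ (left_lt_right ha₁ ha₂ ha₃ κ).le
  have eR' := fun c κ => edgeSol'_right P g X Y c κ (left_lt_right ha₁ ha₂ ha₃ κ).le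
  have eL := edgeSol_left P g X Y
  have eL' := edgeSol'_left P g X Y
  have R1 := fun c => eR c .dir₁
  have R2 := fun c => eR c .dir₂
  have Rp := fun c => eR c .plus
  have Rm := fun c => eR c .minus
  have R1' := fun c => eR' c .dir₁
  have R2' := fun c => eR' c .dir₂
  have Rp' := fun c => eR' c .plus
  have Rm' := fun c => eR' c .minus
  have L1 := fun c => eL c .dir₁
  have L2 := fun c => eL c .dir₂
  have Lp := fun c => eL c .plus
  have Lm := fun c => eL c .minus
  have L1' := fun c => eL' c .dir₁
  have L2' := fun c => eL' c .dir₂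
  have Lp' := fun c => eL' c .plus
  have Lm' := fun c => eL' c .minus
  simp only [left, right, len_dir₁, len_dir₂, len_plus, len_minus] at R1 R2 Rp Rm R1' R2' Rp' Rm' L1 L2 Lp Lm L1' L2' Lp' Lm'
  refine ⟨_, _, f₁, hH2, fun k l => ⟨?_, ?_, ?_, ?_, ?_⟩, fun c => ⟨?_, ?_⟩, fun k l => ?_⟩
  · rw [Rm, Lp]; exact hm _
  · rw [L1, Lp]; exact hX₁ _
  · rw [R1, Lp]; exact (h₁ (k - 1) l).trans (by rw [sub_add_cancel])
  · rw [L2, Lp]; exact hX₂ _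
  · rw [R2, Lp]; exact (h₂ k (l - 1)).trans (by rw [sub_add_cancel])
  · rw [Rp, Lm, hXm, ← mul_assoc, exp_neg_mul_exp, one_mul]; rfl
  · rw [Rp', Lm', hYm, ← mul_assoc, exp_neg_mul_exp, one_mul]; rfl
  · rw [L1', R1', L2', R2', Lp', Rm']; exact hK k l

end Conditions

end

section

variable {a₁ a₂ a₃ lam : ℝ} (P : FundPair lam)

/-! ### Points of the resolvent set -/

/-- The Kirchhoff sum when the initial data on the horizontal edges are expressed by the values at
the vertices. -/
theorem kirchhoff_sum_eq {s₁ s₂ c₁ c₂ s c l E a aE aW aN aS b g₁ g₁W g₂ g₂S d₁ d₂ gp dp dm : ℂ}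
    (hs₁ : s₁ ≠ 0) (hs₂ : s₂ ≠ 0) (q₁ : c₁ ^ 2 + l * s₁ ^ 2 = 1) (q₂ : c₂ ^ 2 + l * s₂ ^ 2 = 1) :
    s₁⁻¹ * (aE - c₁ * a - g₁) - (-l * s₁ * aW + c₁ * (s₁⁻¹ * (a - c₁ * aW - g₁W)) + d₁) +
      s₂⁻¹ * (aN - c₂ * a - g₂) - (-l * s₂ * aS + c₂ * (s₂⁻¹ * (a - c₂ * aS - g₂S)) + d₂) +
      (b - (-l * s * (E * (c * a + s * b + gp)) + c * (E * (-l * s * a + c * b + dp)) + dm)) =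
    s₁⁻¹ * (aE + aW) + s₂⁻¹ * (aN + aS) +
      (-2 * c₁ / s₁ - 2 * c₂ / s₂ + E * l * (2 * s * c)) * a +
      (1 - E * (c ^ 2 - l * s ^ 2)) * b -
      (s₁⁻¹ * g₁ + (d₁ - c₁ / s₁ * g₁W) + (s₂⁻¹ * g₂ + (d₂ - c₂ / s₂ * g₂S)) +
      E * (-l * s * gp + c * dp) + dm) := by
  have i₁ : s₁⁻¹ * s₁ = 1 := inv_mul_cancel₀ hs₁
  have i₂ : s₂⁻¹ * s₂ = 1 := inv_mul_cancel₀ hs₂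
  simp only [div_eq_mul_inv]
  linear_combination s₁⁻¹ * aW * q₁ + s₂⁻¹ * aS * q₂ - l * s₁ * aW * i₁ - l * s₂ * aS * i₂

/-- The unknowns are the vertex values `A` and the derivatives `B` at the start of the `plus` edges.
Continuity along horizontal edges determines the derivatives there, after division by `s a₁` or `s
a₂`, and quasi-periodicity determines the data on `minus`. Continuity at the end of `minus` and the
Kirchhoff condition are the two remaining equations. -/
theorem exists_resolvent {β : ℝ} (ha₁ : 0 < a₁) (ha₂ : 0 < a₂) (ha₃ : 0 < a₃)
    (hs₁ : P.s a₁ ≠ 0) (hs₂ : P.s a₂ ≠ 0)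
    (hD : |P.s a₃ / P.s a₁| + |P.s a₃ / P.s a₂| <
      |Real.cos β - P.c a₃ - P.s a₃ * (P.c a₁ / P.s a₁ + P.c a₂ / P.s a₂)|) :
    ∃ R : GraphL2 a₁ a₂ a₃ →L[ℂ] GraphL2 a₁ a₂ a₃,
      ∀ g, InDomain β (R g) (-((lam : ℂ) • R g + g)) := by
  have hs₁' : (P.s a₁ : ℂ) ≠ 0 := Complex.ofReal_ne_zero.mpr hs₁
  have hs₂' : (P.s a₂ : ℂ) ≠ 0 := Complex.ofReal_ne_zero.mpr hs₂
  set E := Complex.exp (Complex.I * β) with hE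
  set e := Complex.exp (-Complex.I * β) with he
  have heE : e * E = 1 := exp_neg_mul_exp β
  set g₁ : GraphL2 a₁ a₂ a₃ →L[ℂ] VertexL2 := edgeFunctional .dir₁ (endValue P .dir₁ ha₁.le) with hg₁
  set g₂ : GraphL2 a₁ a₂ a₃ →L[ℂ] VertexL2 := edgeFunctional .dir₂ (endValue P .dir₂ ha₂.le) with hg₂
  set gp : GraphL2 a₁ a₂ a₃ →L[ℂ] VertexL2 :=
    edgeFunctional .plus (endValue P .plus (half_pos ha₃).le) with hgp
  set gm : GraphL2 a₁ a₂ a₃ →L[ℂ] VertexL2 :=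
    edgeFunctional .minus (endValue P .minus (neg_neg_of_pos (half_pos ha₃)).le) with hgm
  set d₁ : GraphL2 a₁ a₂ a₃ →L[ℂ] VertexL2 := edgeFunctional .dir₁ (endDeriv P .dir₁ ha₁.le) with hd₁
  set d₂ : GraphL2 a₁ a₂ a₃ →L[ℂ] VertexL2 := edgeFunctional .dir₂ (endDeriv P .dir₂ ha₂.le) with hd₂
  set dp : GraphL2 a₁ a₂ a₃ →L[ℂ] VertexL2 :=
    edgeFunctional .plus (endDeriv P .plus (half_pos ha₃).le) with hdp
  set dm : GraphL2 a₁ a₂ a₃ →L[ℂ] VertexL2 :=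
    edgeFunctional .minus (endDeriv P .minus (neg_neg_of_pos (half_pos ha₃)).le) with hdm
  -- The right-hand sides collect the contributions of the source `g`: first those to continuity
  -- around the vertical loop, multiplied by `e`, then those to the Kirchhoff sum. The backward
  -- shifts belong to the edges that arrive at the vertex.
  obtain ⟨A, B, hAB⟩ := exists_solve_system (isUnit_det P a₁ a₂ a₃ β hD)
    (-((P.c (a₃ / 2) : ℂ) • gp + (P.s (a₃ / 2) : ℂ) • dp) - e • gm)
    ((P.s a₁ : ℂ)⁻¹ • g₁ + (shift (-1, 0)).comp (d₁ - (P.c a₁ / P.s a₁ : ℂ) • g₁) +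
      ((P.s a₂ : ℂ)⁻¹ • g₂ + (shift (0, -1)).comp (d₂ - (P.c a₂ / P.s a₂ : ℂ) • g₂)) +
      E • ((-lam * P.s (a₃ / 2) : ℂ) • gp + (P.c (a₃ / 2) : ℂ) • dp) + dm)
  have h1 : ∀ f c, (P.c a₃ - e) * A f c + P.s a₃ * B f c =
      -(P.c (a₃ / 2) * gp f c + P.s (a₃ / 2) * dp f c) - e * gm f c := fun f c =>
    congrArg (fun x : VertexL2 => x c) (hAB f).1
  have h2 : ∀ f k l, (P.s a₁ : ℂ)⁻¹ * (A f (k + 1, l) + A f (k - 1, l)) +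
      (P.s a₂ : ℂ)⁻¹ * (A f (k, l + 1) + A f (k, l - 1)) +
      (-2 * P.c a₁ / P.s a₁ - 2 * P.c a₂ / P.s a₂ + E * lam * P.s a₃) * A f (k, l) +
      (1 - E * P.c a₃) * B f (k, l) =
      (P.s a₁ : ℂ)⁻¹ * g₁ f (k, l) + (d₁ f (k - 1, l) - P.c a₁ / P.s a₁ * g₁ f (k - 1, l)) +
      ((P.s a₂ : ℂ)⁻¹ * g₂ f (k, l) + (d₂ f (k, l - 1) - P.c a₂ / P.s a₂ * g₂ f (k, l - 1))) +
      E * (-lam * P.s (a₃ / 2) * gp f (k, l) + P.c (a₃ / 2) * dp f (k, l)) + dm f (k, l) := by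
    intro f k l
    have h := congrArg (fun x : VertexL2 => x (k, l)) (hAB f).2
    simp only [lp.coeFn_add, Pi.add_apply, vertexOp, laurent_apply, add_apply,
      ContinuousLinearMap.comp_apply, shift_apply, sub_apply, lp.coeFn_sub, Pi.sub_apply,
      smul_apply, lp.coeFn_smul, Pi.smul_apply, smul_eq_mul, Prod.mk_add_mk, add_zero,
      ← sub_eq_add_neg] at h
    exact h
  let X : EdgeKind → GraphL2 a₁ a₂ a₃ →L[ℂ] VertexL2
    | .dir₁ => A
    | .dir₂ => A
    | .plus => A
    | .minus => E • ((P.c (a₃ / 2) : ℂ) • A + (P.s (a₃ / 2) : ℂ) • B + gp)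
  let Y : EdgeKind → GraphL2 a₁ a₂ a₃ →L[ℂ] VertexL2
    | .dir₁ => (P.s a₁ : ℂ)⁻¹ • ((shift (1, 0)).comp A - (P.c a₁ : ℂ) • A - g₁)
    | .dir₂ => (P.s a₂ : ℂ)⁻¹ • ((shift (0, 1)).comp A - (P.c a₂ : ℂ) • A - g₂)
    | .plus => B
    | .minus => E • ((-lam * P.s (a₃ / 2) : ℂ) • A + (P.c (a₃ / 2) : ℂ) • B + dp)
  obtain ⟨R, R₁, hR⟩ := exists_solution_operators P X Y
  have xm : ∀ g c, X .minus g c = E * (P.c (a₃ / 2) * A g c + P.s (a₃ / 2) * B g c + gp g c) :=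
    fun g c => rfl
  have ym : ∀ g c, Y .minus g c =
      E * (-lam * P.s (a₃ / 2) * A g c + P.c (a₃ / 2) * B g c + dp g c) := fun g c => rfl
  have y1 : ∀ g k l k', k + 1 = k' → Y .dir₁ g (k, l) =
      (P.s a₁ : ℂ)⁻¹ * (A g (k', l) - P.c a₁ * A g (k, l) - g₁ g (k, l)) := fun g k l k' hk => by
    subst hk
    have : Y .dir₁ g (k, l) =
      (P.s a₁ : ℂ)⁻¹ * (A g (k + 1, l + 0) - P.c a₁ * A g (k, l) - g₁ g (k, l)) := rfl
    rw [this, add_zero]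
  have y2 : ∀ g k l l', l + 1 = l' → Y .dir₂ g (k, l) =
      (P.s a₂ : ℂ)⁻¹ * (A g (k, l') - P.c a₂ * A g (k, l) - g₂ g (k, l)) := fun g k l l' hl => by
    subst hl
    have : Y .dir₂ g (k, l) =
      (P.s a₂ : ℂ)⁻¹ * (A g (k + 0, l + 1) - P.c a₂ * A g (k, l) - g₂ g (k, l)) := rfl
    rw [this, add_zero]
  refine ⟨R, fun g => inDomain_of_initial_data P ha₁ ha₂ ha₃ (hR g) (fun c => rfl) (fun c => rfl)
    (fun k l => ?_) (fun k l => ?_) (fun c => rfl) (fun c => rfl) (fun c => ?_) (fun k l => ?_)⟩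
  · change P.c a₁ * A g (k, l) + P.s a₁ * Y .dir₁ g (k, l) + g₁ g (k, l) = A g (k + 1, l)
    rw [y1 g k l _ rfl]
    field_simp
    ring
  · change P.c a₂ * A g (k, l) + P.s a₂ * Y .dir₂ g (k, l) + g₂ g (k, l) = A g (k, l + 1)
    rw [y2 g k l _ rfl]
    field_simp
    ring
  · change P.c (a₃ / 2) * X .minus g c + P.s (a₃ / 2) * Y .minus g c + gm g c = A g c
    have h := h1 g c
    rw [xm, ym]
    rw [P.c_double a₃, P.s_double a₃] at h
    linear_combination E * h + (A g c - gm g c) * heE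
  · change Y .dir₁ g (k, l) - (-lam * P.s a₁ * A g (k - 1, l) + P.c a₁ * Y .dir₁ g (k - 1, l) +
        d₁ g (k - 1, l)) +
      Y .dir₂ g (k, l) - (-lam * P.s a₂ * A g (k, l - 1) + P.c a₂ * Y .dir₂ g (k, l - 1) +
        d₂ g (k, l - 1)) +
      (B g (k, l) - (-lam * P.s (a₃ / 2) * X .minus g (k, l) + P.c (a₃ / 2) * Y .minus g (k, l) +
        dm g (k, l))) = 0
    have h := h2 g k l
    rw [P.c_double a₃, P.s_double a₃] at h
    rw [y1 g k l _ rfl, y2 g k l _ rfl, y1 g (k - 1) l k (sub_add_cancel k 1),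
      y2 g k (l - 1) l (sub_add_cancel l 1), xm, ym]
    exact (kirchhoff_sum_eq hs₁' hs₂' (P.sq_add_complex a₁) (P.sq_add_complex a₂)).trans
      (by rw [h]; ring)

theorem IsH2.homogeneous {u u' : ℤ × ℤ → EdgeKind → ℝ → ℂ} {f f₁ : GraphL2 a₁ a₂ a₃}
    (h : IsH2 u u' f f₁ (-((lam : ℂ) • f))) (c : ℤ × ℤ) (κ : EdgeKind) {x : ℝ}
    (hx : x ∈ Icc (left a₃ κ) (right a₁ a₂ a₃ κ)) :
    P.c (x - left a₃ κ) * u c κ x - P.s (x - left a₃ κ) * u' c κ x = u c κ (left a₃ κ) ∧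
      lam * P.s (x - left a₃ κ) * u c κ x + P.c (x - left a₃ κ) * u' c κ x =
        u' c κ (left a₃ κ) := by
  have h₁ : HasDensityOn (left a₃ κ) (right a₁ a₂ a₃ κ) (u c κ) (u' c κ) :=
    ⟨h.integrable_deriv c κ, h.eq_integral c κ⟩
  have h₂ : HasDensityOn (left a₃ κ) (right a₁ a₂ a₃ κ) (u' c κ)
      ((-((lam : ℂ) • f) : GraphL2 a₁ a₂ a₃) (c, κ)) :=
    ⟨integrable_coe _ c κ, h.deriv_eq_integral c κ⟩
  refine P.eq_sol_of_homogeneous h₁ h₂ ?_ hx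
  have e : (-((lam : ℂ) • f) : GraphL2 a₁ a₂ a₃) (c, κ) = -((lam : ℂ) • f (c, κ)) := rfl
  rw [e]
  filter_upwards [Lp.coeFn_neg ((lam : ℂ) • f (c, κ)), Lp.coeFn_smul (lam : ℂ) (f (c, κ)),
    h.ae_eq c κ] with t h3 h4 h5
  rw [h3, Pi.neg_apply, h4, Pi.smul_apply, ← h5, smul_eq_mul, neg_mul]

/-- Square summability of the data is needed before the inverse determinant can be applied to them.
The first integrals are constant along an edge, so each datum equals an average over the edge, and
this is a bounded functional of `f` and `f₁` that is the same on all edges of the kind. -/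
theorem IsH2.initial_data_mem_l2 (P : FundPair lam) {u u' : ℤ × ℤ → EdgeKind → ℝ → ℂ} {f f₁ : GraphL2 a₁ a₂ a₃}
    (h : IsH2 u u' f f₁ (-((lam : ℂ) • f))) (κ : EdgeKind) (hκ : left a₃ κ < right a₁ a₂ a₃ κ) :
    (∃ x : VertexL2, ∀ c, x c = u c κ (left a₃ κ)) ∧
      (∃ y : VertexL2, ∀ c, y c = u' c κ (left a₃ κ)) := by
  have hl : ((right a₁ a₂ a₃ κ - left a₃ κ : ℝ) : ℂ) ≠ 0 :=
    Complex.ofReal_ne_zero.mpr (sub_pos.mpr hκ).ne'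
  have hR : right a₁ a₂ a₃ κ ∈ Icc (left a₃ κ) (right a₁ a₂ a₃ κ) := ⟨hκ.le, le_rfl⟩
  have key : ∀ (φ ψ : ℝ → ℝ) (hφ : Continuous φ) (hψ : Continuous ψ) (z : ℤ × ℤ → ℂ),
      (∀ c, ∀ x ∈ Icc (left a₃ κ) (right a₁ a₂ a₃ κ), φ x * u c κ x + ψ x * u' c κ x = z c) →
      ∃ x : VertexL2, ∀ c, x c = z c := by
    intro φ ψ hφ hψ z hz
    refine ⟨((right a₁ a₂ a₃ κ - left a₃ κ : ℝ) : ℂ)⁻¹ •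
      (edgeFunctional κ (momentCLM hκ.le hφ) f + edgeFunctional κ (momentCLM hκ.le hψ) f₁),
      fun c => ?_⟩
    have e1 : (∫ t in (left a₃ κ)..(right a₁ a₂ a₃ κ), (φ t : ℂ) * f (c, κ) t) +
        (∫ t in (left a₃ κ)..(right a₁ a₂ a₃ κ), (ψ t : ℂ) * f₁ (c, κ) t) =
        ((right a₁ a₂ a₃ κ - left a₃ κ : ℝ) : ℂ) * z c := by
      rw [← intervalIntegral.integral_add
        (intervalIntegrable_of (integrableOn_ofReal_mul hφ (integrable_coe f c κ)) hR)
        (intervalIntegrable_of (integrableOn_ofReal_mul hψ (integrable_coe f₁ c κ)) hR)]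
      have e2 : (fun t => (φ t : ℂ) * f (c, κ) t + (ψ t : ℂ) * f₁ (c, κ) t)
          =ᵐ[volume.restrict (Ioo (left a₃ κ) (right a₁ a₂ a₃ κ))] fun _ => z c := by
        filter_upwards [h.ae_eq c κ, h.ae_eq_deriv c κ, ae_restrict_mem measurableSet_Ioo]
          with t h1 h2 ht
        rw [← h1, ← h2]
        exact hz c t (Ioo_subset_Icc_self ht)
      rw [integral_congr_edge e2 hR, intervalIntegral.integral_const, Complex.real_smul]
    have e3 : (((right a₁ a₂ a₃ κ - left a₃ κ : ℝ) : ℂ)⁻¹ •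
      (edgeFunctional κ (momentCLM hκ.le hφ) f + edgeFunctional κ (momentCLM hκ.le hψ) f₁) :
        VertexL2) c = ((right a₁ a₂ a₃ κ - left a₃ κ : ℝ) : ℂ)⁻¹ *
        ((∫ t in (left a₃ κ)..(right a₁ a₂ a₃ κ), (φ t : ℂ) * f (c, κ) t) +
        (∫ t in (left a₃ κ)..(right a₁ a₂ a₃ κ), (ψ t : ℂ) * f₁ (c, κ) t)) := rfl
    rw [e3, e1, inv_mul_cancel_left₀ hl]
  constructor
  · refine key (fun x => P.c (x - left a₃ κ)) (fun x => -P.s (x - left a₃ κ)) (P.continuous_c_sub _)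
      (P.continuous_s_sub _).neg _ fun c x hx => ?_
    rw [← (h.homogeneous P c κ hx).1]
    push_cast
    ring
  · refine key (fun x => lam * P.s (x - left a₃ κ)) (fun x => P.c (x - left a₃ κ))
      (continuous_const.mul (P.continuous_s_sub _)) (P.continuous_c_sub _) _ fun c x hx => ?_
    rw [← (h.homogeneous P c κ hx).2]
    push_cast
    ring

/-- Inverts the two first integrals; their matrix has determinant `c² + lam s² = 1`. -/
theorem IsH2.homogeneous_right {u u' : ℤ × ℤ → EdgeKind → ℝ → ℂ} {f f₁ : GraphL2 a₁ a₂ a₃}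
    (h : IsH2 u u' f f₁ (-((lam : ℂ) • f))) (c : ℤ × ℤ) (κ : EdgeKind)
    {x : ℝ} (hx : x ∈ Icc (left a₃ κ) (right a₁ a₂ a₃ κ)) :
    u c κ x = P.c (x - left a₃ κ) * u c κ (left a₃ κ) + P.s (x - left a₃ κ) * u' c κ (left a₃ κ) ∧
    u' c κ x = -lam * P.s (x - left a₃ κ) * u c κ (left a₃ κ) +
      P.c (x - left a₃ κ) * u' c κ (left a₃ κ) := by
  obtain ⟨h1, h2⟩ := h.homogeneous P c κ hx
  have h3 := P.sq_add_complex (x - left a₃ κ)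
  rw [← h1, ← h2]
  constructor
  · linear_combination -u c κ x * h3
  · linear_combination -u' c κ x * h3

/-- The elimination of `exists_resolvent` without source: the vertex data solve the homogeneous
system and vanish, then so do the data on all edges, and with them `f`. -/
theorem eq_zero_of_homogeneous {β : ℝ} (ha₁ : 0 < a₁) (ha₂ : 0 < a₂) (ha₃ : 0 < a₃)
    (hs₁ : P.s a₁ ≠ 0) (hs₂ : P.s a₂ ≠ 0)
    (hD : |P.s a₃ / P.s a₁| + |P.s a₃ / P.s a₂| <
      |Real.cos β - P.c a₃ - P.s a₃ * (P.c a₁ / P.s a₁ + P.c a₂ / P.s a₂)|)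
    (f : GraphL2 a₁ a₂ a₃) (hf : InDomain β f (-((lam : ℂ) • f))) : f = 0 := by
  obtain ⟨u, u', f₁, hH2, hcont, hqp, hkir⟩ := hf
  have hs₁' : (P.s a₁ : ℂ) ≠ 0 := Complex.ofReal_ne_zero.mpr hs₁
  have hs₂' : (P.s a₂ : ℂ) ≠ 0 := Complex.ofReal_ne_zero.mpr hs₂
  have heE := exp_neg_mul_exp β
  have hlr := left_lt_right ha₁ ha₂ ha₃
  obtain ⟨A, hA⟩ := (hH2.initial_data_mem_l2 P .plus (hlr .plus)).1
  obtain ⟨B, hB⟩ := (hH2.initial_data_mem_l2 P .plus (hlr .plus)).2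
  have hr := fun c κ => hH2.homogeneous_right P c κ (x := right a₁ a₂ a₃ κ) ⟨(hlr κ).le, le_rfl⟩
  have r1 := fun c => hr c .dir₁
  have r2 := fun c => hr c .dir₂
  have rp := fun c => hr c .plus
  have rm := fun c => hr c .minus
  have hmm : (0 : ℝ) - -(a₃ / 2) = a₃ / 2 := by ring
  simp only [left, right, sub_zero, hmm] at r1 r2 rp rm hA hB
  -- The zeros added or subtracted here and below stand for the absent source terms, so that the
  -- formulas match `kirchhoff_sum_eq`.
  have y1 : ∀ k l, u' (k, l) .dir₁ 0 = (P.s a₁ : ℂ)⁻¹ * (A (k + 1, l) - P.c a₁ * A (k, l) - 0) := by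
    intro k l
    obtain ⟨-, h1, -, -, -⟩ := hcont k l
    obtain ⟨-, -, h2, -, -⟩ := hcont (k + 1) l
    rw [add_sub_cancel_right, (r1 _).1, h1] at h2
    rw [hA, hA, ← h2]
    field_simp
    ring
  have y2 : ∀ k l, u' (k, l) .dir₂ 0 = (P.s a₂ : ℂ)⁻¹ * (A (k, l + 1) - P.c a₂ * A (k, l) - 0) := by
    intro k l
    obtain ⟨-, -, -, h1, -⟩ := hcont k l
    obtain ⟨-, -, -, -, h2⟩ := hcont k (l + 1)
    rw [add_sub_cancel_right, (r2 _).1, h1] at h2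
    rw [hA, hA, ← h2]
    field_simp
    ring
  have xm : ∀ c, u c .minus (-(a₃ / 2)) = Complex.exp (Complex.I * β) *
      (P.c (a₃ / 2) * A c + P.s (a₃ / 2) * B c + 0) := by
    intro c
    have h1 := (hqp c).1
    rw [(rp c).1] at h1
    rw [hA, hB, add_zero, h1, ← mul_assoc, mul_comm (Complex.exp _), heE, one_mul]
  have ym : ∀ c, u' c .minus (-(a₃ / 2)) = Complex.exp (Complex.I * β) *
      (-lam * P.s (a₃ / 2) * A c + P.c (a₃ / 2) * B c + 0) := by
    intro c
    have h1 := (hqp c).2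
    rw [(rp c).2] at h1
    rw [hA, hB, add_zero, h1, ← mul_assoc, mul_comm (Complex.exp _), heE, one_mul]
  have hAB : A = 0 ∧ B = 0 := by
    refine eq_zero_of_system (isUnit_det P a₁ a₂ a₃ β hD) ?_ ?_
    · ext c
      change (P.c a₃ - Complex.exp (-Complex.I * β)) * A c + P.s a₃ * B c = 0
      have h1 := (hcont c.1 c.2).1
      rw [(rm _).1, xm, ym, ← hA] at h1
      rw [P.c_double a₃, P.s_double a₃]
      linear_combination Complex.exp (-Complex.I * β) * h1 -
        ((P.c (a₃ / 2) ^ 2 - lam * P.s (a₃ / 2) ^ 2) * A c +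
          2 * P.s (a₃ / 2) * P.c (a₃ / 2) * B c) * heE
    · ext c
      obtain ⟨k, l⟩ := c
      have h0 : (vertexOp P a₁ a₂ a₃ β A +
          (1 - Complex.exp (Complex.I * β) * P.c a₃) • B : VertexL2) (k, l) =
          (P.s a₁ : ℂ)⁻¹ * (A (k + 1, l) + A (k - 1, l)) +
          (P.s a₂ : ℂ)⁻¹ * (A (k, l + 1) + A (k, l - 1)) +
          (-2 * P.c a₁ / P.s a₁ - 2 * P.c a₂ / P.s a₂ +
            Complex.exp (Complex.I * β) * lam * P.s a₃) * A (k, l) +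
          (1 - Complex.exp (Complex.I * β) * P.c a₃) * B (k, l) := by
        rw [vertexOp, ← laurent_apply]
        rfl
      have h1 := hkir k l
      have hW : u (k - 1, l) .dir₁ 0 = A (k - 1, l) := by
        rw [hA]; exact (hcont (k - 1) l).2.1
      have hS : u (k, l - 1) .dir₂ 0 = A (k, l - 1) := by
        rw [hA]; exact (hcont k (l - 1)).2.2.2.1
      have y1W := y1 (k - 1) l
      have y2S := y2 k (l - 1)
      rw [show k - 1 + 1 = k by ring] at y1W
      rw [show l - 1 + 1 = l by ring] at y2S
      rw [(r1 _).2, (r2 _).2, (rm _).2, y1, y2, y1W, y2S, xm, ym, ← hB, hW, hS] at h1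
      have h2 := kirchhoff_sum_eq (l := (lam : ℂ)) (s := P.s (a₃ / 2)) (c := P.c (a₃ / 2))
        (E := Complex.exp (Complex.I * β)) (a := A (k, l)) (aE := A (k + 1, l))
        (aW := A (k - 1, l)) (aN := A (k, l + 1)) (aS := A (k, l - 1)) (b := B (k, l))
        (g₁ := 0) (g₁W := 0) (g₂ := 0) (g₂S := 0) (d₁ := 0) (d₂ := 0) (gp := 0) (dp := 0) (dm := 0)
        hs₁' hs₂' (P.sq_add_complex a₁) (P.sq_add_complex a₂)
      rw [h0, P.c_double a₃, P.s_double a₃]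
      refine Eq.trans ?_ h1
      linear_combination -h2
  obtain ⟨rfl, rfl⟩ := hAB
  have hu0 : ∀ c κ, u c κ (left a₃ κ) = 0 ∧ u' c κ (left a₃ κ) = 0 := by
    rintro ⟨k, l⟩ κ
    have hz : ∀ c, (0 : VertexL2) c = 0 := fun c => rfl
    have hp : u (k, l) .plus 0 = 0 := (hA (k, l)).symm
    cases κ
    · refine ⟨(hcont k l).2.1.trans hp, (y1 k l).trans ?_⟩
      simp only [hz]
      ring
    · refine ⟨(hcont k l).2.2.2.1.trans hp, (y2 k l).trans ?_⟩
      simp only [hz]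
      ring
    · exact ⟨hp, (hB (k, l)).symm⟩
    · refine ⟨(xm (k, l)).trans ?_, (ym (k, l)).trans ?_⟩
      · simp only [hz]
        ring
      · simp only [hz]
        ring
  ext1
  funext e
  obtain ⟨c, κ⟩ := e
  have hz : f (c, κ) =ᵐ[edgeMeasure a₁ a₂ a₃ κ] 0 := by
    filter_upwards [hH2.ae_eq c κ, ae_restrict_mem measurableSet_Ioo] with x hx hxm
    rw [← hx, (hH2.homogeneous_right P c κ (Ioo_subset_Icc_self hxm)).1, (hu0 c κ).1, (hu0 c κ).2]
    simp
  exact Lp.ext (hz.trans (Lp.coeFn_zero _ _ _).symm)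

theorem notMem_realSpectrum {β : ℝ} (ha₁ : 0 < a₁) (ha₂ : 0 < a₂) (ha₃ : 0 < a₃)
    (hs₁ : P.s a₁ ≠ 0) (hs₂ : P.s a₂ ≠ 0)
    (hD : |P.s a₃ / P.s a₁| + |P.s a₃ / P.s a₂| <
      |Real.cos β - P.c a₃ - P.s a₃ * (P.c a₁ / P.s a₁ + P.c a₂ / P.s a₂)|) :
    lam ∉ realSpectrum (periodicOperator a₁ a₂ a₃ β) := by
  obtain ⟨R, hR⟩ := exists_resolvent P ha₁ ha₂ ha₃ hs₁ hs₂ hD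
  exact notMem_realSpectrum_of R hR (eq_zero_of_homogeneous P ha₁ ha₂ ha₃ hs₁ hs₂ hD)

end

section

/-! ### Approximate joint eigenvectors of the translations -/

theorem norm_sq_eq_sum {x : VertexL2} {S : Finset (ℤ × ℤ)} (h : ∀ c ∉ S, x c = 0) :
    ‖x‖ ^ 2 = ∑ c ∈ S, ‖x c‖ ^ 2 := by
  have h1 := lp.norm_rpow_eq_tsum (p := 2) (by norm_num) x
  simp only [ENNReal.toReal_ofNat, Real.rpow_two] at h1
  rw [h1]
  exact tsum_eq_sum fun c hc => by rw [h c hc]; simp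

/-- The vector `z₁ ^ k z₂ ^ l` truncated to the square `[0, N)²`. -/
def boxVector (z₁ z₂ : ℂ) (N : ℕ) : VertexL2 :=
  ⟨fun c => if c ∈ Finset.Ico (0 : ℤ) N ×ˢ Finset.Ico (0 : ℤ) N then z₁ ^ c.1 * z₂ ^ c.2 else 0,
    memℓp_gen (summable_of_hasFiniteSupport
      ((Finset.Ico (0 : ℤ) N ×ˢ Finset.Ico (0 : ℤ) N).finite_toSet.subset fun c hc => by
        by_contra h
        refine hc ?_
        simp only
        rw [if_neg (fun h' => h (Finset.mem_coe.mpr h'))]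
        simp))⟩

theorem boxVector_apply (z₁ z₂ : ℂ) (N : ℕ) (c : ℤ × ℤ) : boxVector z₁ z₂ N c =
    if c ∈ Finset.Ico (0 : ℤ) N ×ˢ Finset.Ico (0 : ℤ) N then z₁ ^ c.1 * z₂ ^ c.2 else 0 := rfl

theorem norm_zpow_mul {z₁ z₂ : ℂ} (h₁ : ‖z₁‖ = 1) (h₂ : ‖z₂‖ = 1) (k l : ℤ) :
    ‖z₁ ^ k * z₂ ^ l‖ = 1 := by
  rw [norm_mul, norm_zpow, norm_zpow, h₁, h₂, one_zpow, one_zpow, one_mul]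

theorem norm_boxVector {z₁ z₂ : ℂ} (h₁ : ‖z₁‖ = 1) (h₂ : ‖z₂‖ = 1) (N : ℕ) :
    ‖boxVector z₁ z₂ N‖ = N := by
  have h := norm_sq_eq_sum (x := boxVector z₁ z₂ N)
    (S := Finset.Ico (0 : ℤ) N ×ˢ Finset.Ico (0 : ℤ) N) fun c hc => by
      rw [boxVector_apply, if_neg hc]
  have h2 : ∑ c ∈ Finset.Ico (0 : ℤ) N ×ˢ Finset.Ico (0 : ℤ) N, ‖boxVector z₁ z₂ N c‖ ^ 2 =
      (N : ℝ) ^ 2 := by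
    rw [Finset.sum_congr rfl (g := fun _ => (1 : ℝ)) fun c hc => by
      rw [boxVector_apply, if_pos hc, norm_zpow_mul h₁ h₂, one_pow]]
    simp [sq]
  rw [h2] at h
  exact (pow_left_inj₀ (norm_nonneg _) (Nat.cast_nonneg _) two_ne_zero).mp h

theorem norm_sq_le_card {x : VertexL2} {S : Finset (ℤ × ℤ)} (h : ∀ c ∉ S, x c = 0)
    (h' : ∀ c, ‖x c‖ ≤ 1) : ‖x‖ ^ 2 ≤ S.card := by
  rw [norm_sq_eq_sum h]
  calc ∑ c ∈ S, ‖x c‖ ^ 2 ≤ ∑ c ∈ S, (1 : ℝ) :=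
        Finset.sum_le_sum fun c _ => pow_le_one₀ (norm_nonneg _) (h' c)
    _ = S.card := by simp

/-- The eigenvector equation fails only where the shift crosses the boundary of the box, on the
columns `k = -1` and `k = N - 1`. Each has `N` sites, with entries of modulus at most one. -/
theorem norm_shift_sub_boxVector₁ {z₁ z₂ : ℂ} (h₁ : ‖z₁‖ = 1) (h₂ : ‖z₂‖ = 1) (N : ℕ) :
    ‖shift (1, 0) (boxVector z₁ z₂ N) - z₁ • boxVector z₁ z₂ N‖ ^ 2 ≤ 2 * N := by
  have hz : z₁ ≠ 0 := fun h => by simp [h] at h₁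
  have ha : ∀ k l, (shift (1, 0) (boxVector z₁ z₂ N) - z₁ • boxVector z₁ z₂ N : VertexL2) (k, l) =
      boxVector z₁ z₂ N (k + 1, l) - z₁ * boxVector z₁ z₂ N (k, l) := fun k l => by
    rw [← add_zero l]
    change boxVector z₁ z₂ N (k + 1, l + 0 + 0) - z₁ * boxVector z₁ z₂ N (k, l + 0) = _
    simp
  refine (norm_sq_le_card (S := {-1, (N : ℤ) - 1} ×ˢ Finset.Ico (0 : ℤ) N) ?_ ?_).trans ?_
  · rintro ⟨k, l⟩ hc
    rw [ha, boxVector_apply, boxVector_apply]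
    simp only [Finset.mem_product, Finset.mem_insert, Finset.mem_singleton, Finset.mem_Ico] at hc ⊢
    split_ifs with h3 h4 h4
    · rw [zpow_add_one₀ hz]
      ring
    · omega
    · omega
    · simp
  · rintro ⟨k, l⟩
    rw [ha, boxVector_apply, boxVector_apply]
    simp only
    split_ifs with h3 h4 h4
    · rw [zpow_add_one₀ hz]
      ring_nf
      simp
    · rw [mul_zero, sub_zero, norm_zpow_mul h₁ h₂]
    · rw [zero_sub, norm_neg, norm_mul, h₁, norm_zpow_mul h₁ h₂, mul_one]
    · simp
  · rw [Finset.card_product, Int.card_Ico, sub_zero, Int.toNat_natCast]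
    push_cast
    gcongr
    exact_mod_cast Finset.card_le_two

theorem norm_shift_sub_boxVector₂ {z₁ z₂ : ℂ} (h₁ : ‖z₁‖ = 1) (h₂ : ‖z₂‖ = 1) (N : ℕ) :
    ‖shift (0, 1) (boxVector z₁ z₂ N) - z₂ • boxVector z₁ z₂ N‖ ^ 2 ≤ 2 * N := by
  have hz : z₂ ≠ 0 := fun h => by simp [h] at h₂
  have ha : ∀ k l, (shift (0, 1) (boxVector z₁ z₂ N) - z₂ • boxVector z₁ z₂ N : VertexL2) (k, l) =
      boxVector z₁ z₂ N (k, l + 1) - z₂ * boxVector z₁ z₂ N (k, l) := fun k l => by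
    rw [← add_zero k]
    change boxVector z₁ z₂ N (k + 0 + 0, l + 1) - z₂ * boxVector z₁ z₂ N (k + 0, l) = _
    simp
  refine (norm_sq_le_card (S := Finset.Ico (0 : ℤ) N ×ˢ {-1, (N : ℤ) - 1}) ?_ ?_).trans ?_
  · rintro ⟨k, l⟩ hc
    rw [ha, boxVector_apply, boxVector_apply]
    simp only [Finset.mem_product, Finset.mem_insert, Finset.mem_singleton, Finset.mem_Ico] at hc ⊢
    split_ifs with h3 h4 h4
    · rw [zpow_add_one₀ hz]
      ring
    · omega
    · omega
    · simp
  · rintro ⟨k, l⟩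
    rw [ha, boxVector_apply, boxVector_apply]
    simp only
    split_ifs with h3 h4 h4
    · rw [zpow_add_one₀ hz]
      ring_nf
      simp
    · rw [mul_zero, sub_zero, norm_zpow_mul h₁ h₂]
    · rw [zero_sub, norm_neg, norm_mul, h₂, norm_zpow_mul h₁ h₂, mul_one]
    · simp
  · rw [Finset.card_product, Int.card_Ico, sub_zero, Int.toNat_natCast, mul_comm]
    push_cast
    gcongr
    exact_mod_cast Finset.card_le_two

theorem exists_approximate_eigenvector {z₁ z₂ : ℂ} (h₁ : ‖z₁‖ = 1) (h₂ : ‖z₂‖ = 1) {ε : ℝ}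
    (hε : 0 < ε) : ∃ x : VertexL2, x ≠ 0 ∧ ‖shift (1, 0) x - z₁ • x‖ ≤ ε * ‖x‖ ∧
      ‖shift (0, 1) x - z₂ • x‖ ≤ ε * ‖x‖ := by
  -- The squared error is at most `2N` and the squared norm is `N²`, so `2N ≤ ε² N²` is what is
  -- required.
  obtain ⟨N, hN⟩ := exists_nat_gt (2 / ε ^ 2)
  have hN0 : (0 : ℝ) < N := lt_trans (by positivity) hN
  have h3 : (2 * N : ℝ) ≤ (ε * N) ^ 2 := by
    rw [div_lt_iff₀ (by positivity)] at hN
    nlinarith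
  refine ⟨boxVector z₁ z₂ N, ?_, ?_, ?_⟩
  · rw [← norm_pos_iff, norm_boxVector h₁ h₂]
    exact hN0
  · rw [norm_boxVector h₁ h₂]
    exact (pow_le_pow_iff_left₀ (norm_nonneg _) (by positivity) two_ne_zero).mp
      ((norm_shift_sub_boxVector₁ h₁ h₂ N).trans h3)
  · rw [norm_boxVector h₁ h₂]
    exact (pow_le_pow_iff_left₀ (norm_nonneg _) (by positivity) two_ne_zero).mp
      ((norm_shift_sub_boxVector₂ h₁ h₂ N).trans h3)

/-! ### Bloch solutions and the spectrum -/

/-- The smooth step `3t² - 2t³`, rescaled to `[0, a]`, on the horizontal edges. -/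
def step (a₁ a₂ : ℝ) : EdgeKind → ℝ → ℂ
  | .dir₁, x => (x / a₁) ^ 2 * (3 - 2 * (x / a₁))
  | .dir₂, x => (x / a₂) ^ 2 * (3 - 2 * (x / a₂))
  | .plus, _ => 0
  | .minus, _ => 0

/-- The derivative of `step`. -/
def step' (a₁ a₂ : ℝ) : EdgeKind → ℝ → ℂ
  | .dir₁, x => 6 / a₁ * ((x / a₁) * (1 - x / a₁))
  | .dir₂, x => 6 / a₂ * ((x / a₂) * (1 - x / a₂))
  | .plus, _ => 0
  | .minus, _ => 0

/-- The second derivative of `step`. -/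
def step'' (a₁ a₂ : ℝ) : EdgeKind → ℝ → ℂ
  | .dir₁, x => 6 / a₁ ^ 2 * (1 - 2 * (x / a₁))
  | .dir₂, x => 6 / a₂ ^ 2 * (1 - 2 * (x / a₂))
  | .plus, _ => 0
  | .minus, _ => 0

theorem hasDerivAt_step (a₁ a₂ : ℝ) (κ : EdgeKind) (x : ℝ) :
    HasDerivAt (step a₁ a₂ κ) (step' a₁ a₂ κ x) x := by
  have h : ∀ a : ℝ, HasDerivAt (fun x : ℝ => ((x : ℂ) / a) ^ 2 * (3 - 2 * ((x : ℂ) / a)))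
      (6 / a * ((x / a) * (1 - x / a)) : ℂ) x := fun a => by
    have h1 : HasDerivAt (fun x : ℝ => (x : ℂ) / a) (1 / a) x :=
      (Complex.ofRealCLM.hasDerivAt (x := x)).div_const (a : ℂ)
    refine ((h1.fun_pow 2).fun_mul ((h1.const_mul 2).const_sub 3)).congr_deriv ?_
    push_cast
    ring
  cases κ
  · exact h a₁
  · exact h a₂
  · exact hasDerivAt_const x (0 : ℂ)
  · exact hasDerivAt_const x (0 : ℂ)

theorem hasDerivAt_step' (a₁ a₂ : ℝ) (κ : EdgeKind) (x : ℝ) :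
    HasDerivAt (step' a₁ a₂ κ) (step'' a₁ a₂ κ x) x := by
  have h : ∀ a : ℝ, HasDerivAt (fun x : ℝ => (6 / a * (((x : ℂ) / a) * (1 - (x : ℂ) / a)) : ℂ))
      (6 / a ^ 2 * (1 - 2 * (x / a)) : ℂ) x := fun a => by
    have h1 : HasDerivAt (fun x : ℝ => (x : ℂ) / a) (1 / a) x :=
      (Complex.ofRealCLM.hasDerivAt (x := x)).div_const (a : ℂ)
    refine ((h1.fun_mul (h1.const_sub 1)).const_mul (6 / a : ℂ)).congr_deriv ?_
    ring
  cases κ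
  · exact h a₁
  · exact h a₂
  · exact hasDerivAt_const x (0 : ℂ)
  · exact hasDerivAt_const x (0 : ℂ)

theorem continuous_step'' (a₁ a₂ : ℝ) (κ : EdgeKind) : Continuous (step'' a₁ a₂ κ) := by
  cases κ <;> unfold step'' <;> fun_prop

/-- A Bloch solution of `-u'' = lam u`: on the edge `(k, l)` of a given kind the solution is
`z₁ ^ k z₂ ^ l φ`. -/
structure IsBlochSolution (a₁ a₂ a₃ β lam : ℝ) (z₁ z₂ : ℂ) (φ φ' : EdgeKind → ℝ → ℂ) : Prop where
  norm_z₁ : ‖z₁‖ = 1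
  norm_z₂ : ‖z₂‖ = 1
  hasDerivAt : ∀ κ x, HasDerivAt (φ κ) (φ' κ x) x
  hasDerivAt' : ∀ κ x, HasDerivAt (φ' κ) (-lam * φ κ x) x
  minus_zero : φ .minus 0 = φ .plus 0
  dir₁_zero : φ .dir₁ 0 = φ .plus 0
  dir₂_zero : φ .dir₂ 0 = φ .plus 0
  dir₁_right : φ .dir₁ a₁ = z₁ * φ .plus 0
  dir₂_right : φ .dir₂ a₂ = z₂ * φ .plus 0
  quasi : φ .plus (a₃ / 2) = Complex.exp (-Complex.I * β) * φ .minus (-(a₃ / 2))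
  quasi' : φ' .plus (a₃ / 2) = Complex.exp (-Complex.I * β) * φ' .minus (-(a₃ / 2))
  kirchhoff : φ' .dir₁ 0 - z₁⁻¹ * φ' .dir₁ a₁ + φ' .dir₂ 0 - z₂⁻¹ * φ' .dir₂ a₂ +
    (φ' .plus 0 - φ' .minus 0) = 0

variable {a₁ a₂ a₃ β lam : ℝ} {z₁ z₂ : ℂ} {φ φ' : EdgeKind → ℝ → ℂ}

/-- Deviation of a vertex vector from quasi-periodicity in the direction of an edge. -/
def deviation (z₁ z₂ : ℂ) : EdgeKind → VertexL2 →L[ℂ] VertexL2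
  | .dir₁ => z₁⁻¹ • (shift (1, 0) - z₁ • 1)
  | .dir₂ => z₂⁻¹ • (shift (0, 1) - z₂ • 1)
  | .plus => 0
  | .minus => 0

theorem norm_assemble_le {H : Type*} [NormedAddCommGroup H] [NormedSpace ℂ H]
    (v : ∀ κ, IntervalL2 (left a₃ κ) (right a₁ a₂ a₃ κ)) :
    ∃ K : ℝ, 0 ≤ K ∧ ∀ (X : EdgeKind → H →L[ℂ] VertexL2) (f : H) (r : ℝ),
      (∀ κ, ‖X κ f‖ ≤ r) → ‖assemble v X f‖ ≤ K * r := by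
  refine ⟨∑ κ, ‖embed (Pi.single κ (v κ))‖, Finset.sum_nonneg fun _ _ => norm_nonneg _,
    fun X f r hr => ?_⟩
  rw [assemble, sum_apply, Finset.sum_mul]
  refine norm_sum_le_of_le _ fun κ _ => ?_
  exact ((embed (Pi.single κ (v κ))).le_opNorm _).trans
    (mul_le_mul_of_nonneg_left (hr κ) (norm_nonneg _))

/-- A functional dual to one nonzero profile recovers the amplitudes, which gives a bounded left
inverse of `embed v`. -/
theorem norm_le_norm_embed {v : ∀ κ, IntervalL2 (left a₃ κ) (right a₁ a₂ a₃ κ)}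
    (hv : ∃ κ, v κ ≠ 0) : ∃ K : ℝ, 0 ≤ K ∧ ∀ x : VertexL2, ‖x‖ ≤ K * ‖embed v x‖ := by
  obtain ⟨κ, hκ⟩ := hv
  obtain ⟨T, -, hT⟩ := exists_dual_vector ℂ (v κ) (norm_ne_zero_iff.mpr hκ)
  have hn : (‖v κ‖ : ℂ) ≠ 0 := Complex.ofReal_ne_zero.mpr (norm_ne_zero_iff.mpr hκ)
  set J : GraphL2 a₁ a₂ a₃ →L[ℂ] VertexL2 := (‖v κ‖ : ℂ)⁻¹ • edgeFunctional κ T with hJ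
  refine ⟨‖J‖, norm_nonneg _, fun x => ?_⟩
  have h : J (embed v x) = x := by
    ext c
    have h1 : J (embed v x) c = (‖v κ‖ : ℂ)⁻¹ * T (x c • v κ) := rfl
    rw [h1, map_smul, hT, smul_eq_mul]
    field_simp
    exact mul_comm _ _
  calc ‖x‖ = ‖J (embed v x)‖ := by rw [h]
    _ ≤ _ := J.le_opNorm _

/-- Replacing `z₁ ^ k z₂ ^ l` by arbitrary amplitudes `x` breaks continuity at the far ends of the
horizontal edges by the deviation of `x` from quasi-periodicity. The correction `w = step * φ`
repairs the value there, because `step` rises from 0 to 1, and leaves the Kirchhoff sum intact,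
because its slope is zero at both ends. The price is the residual `r = step'' φ + 2 step' φ'`, again
multiplied by the deviation. -/
theorem IsBlochSolution.exists_truncation (ha₁ : 0 < a₁) (ha₂ : 0 < a₂)
    (h : IsBlochSolution a₁ a₂ a₃ β lam z₁ z₂ φ φ') :
    ∃ v w r : ∀ κ, IntervalL2 (left a₃ κ) (right a₁ a₂ a₃ κ),
      (∀ κ, v κ =ᵐ[edgeMeasure a₁ a₂ a₃ κ] φ κ) ∧
      ∀ x : VertexL2,
        InDomain β (embed v x + assemble w (deviation z₁ z₂) x)
          (-((lam : ℂ) • (embed v x + assemble w (deviation z₁ z₂) x) -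
            assemble r (deviation z₁ z₂) x)) := by
  have cφ : ∀ κ, Continuous (φ κ) := fun κ =>
    continuous_iff_continuousAt.mpr fun t => (h.hasDerivAt κ t).continuousAt
  have cφ' : ∀ κ, Continuous (φ' κ) := fun κ =>
    continuous_iff_continuousAt.mpr fun t => (h.hasDerivAt' κ t).continuousAt
  have cη : ∀ κ, Continuous (step a₁ a₂ κ) := fun κ =>
    continuous_iff_continuousAt.mpr fun t => (hasDerivAt_step a₁ a₂ κ t).continuousAt
  have cη' : ∀ κ, Continuous (step' a₁ a₂ κ) := fun κ =>
    continuous_iff_continuousAt.mpr fun t => (hasDerivAt_step' a₁ a₂ κ t).continuousAt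
  have cw : ∀ κ, Continuous fun t => step a₁ a₂ κ t * φ κ t := fun κ => (cη κ).mul (cφ κ)
  have cw' : ∀ κ, Continuous fun t => step' a₁ a₂ κ t * φ κ t + step a₁ a₂ κ t * φ' κ t :=
    fun κ => ((cη' κ).mul (cφ κ)).add ((cη κ).mul (cφ' κ))
  have cr : ∀ κ, Continuous fun t => step'' a₁ a₂ κ t * φ κ t + 2 * (step' a₁ a₂ κ t * φ' κ t) :=
    fun κ => ((continuous_step'' a₁ a₂ κ).mul (cφ κ)).add
      (continuous_const.mul ((cη' κ).mul (cφ' κ)))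
  refine ⟨fun κ => toL2 (cφ κ).continuousOn, fun κ => toL2 (cw κ).continuousOn,
    fun κ => toL2 (cr κ).continuousOn, fun κ => coeFn_toL2 _, fun x => ?_⟩
  set W := deviation z₁ z₂ with hW
  have c1 : (a₁ : ℂ) ≠ 0 := Complex.ofReal_ne_zero.mpr ha₁.ne'
  have c2 : (a₂ : ℂ) ≠ 0 := Complex.ofReal_ne_zero.mpr ha₂.ne'
  have hz1 : z₁ ≠ 0 := fun h0 => by simpa [h0] using h.norm_z₁
  have hz2 : z₂ ≠ 0 := fun h0 => by simpa [h0] using h.norm_z₂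
  have i1 : z₁⁻¹ * z₁ = 1 := inv_mul_cancel₀ hz1
  have i2 : z₂⁻¹ * z₂ = 1 := inv_mul_cancel₀ hz2
  have s10 : step a₁ a₂ .dir₁ 0 = 0 := by simp [step]
  have s20 : step a₁ a₂ .dir₂ 0 = 0 := by simp [step]
  have s10' : step' a₁ a₂ .dir₁ 0 = 0 := by simp [step']
  have s20' : step' a₁ a₂ .dir₂ 0 = 0 := by simp [step']
  have s11 : step a₁ a₂ .dir₁ a₁ = 1 := by
    simp only [step, div_self c1]
    norm_num
  have s21 : step a₁ a₂ .dir₂ a₂ = 1 := by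
    simp only [step, div_self c2]
    norm_num
  have s11' : step' a₁ a₂ .dir₁ a₁ = 0 := by simp [step', div_self c1]
  have s21' : step' a₁ a₂ .dir₂ a₂ = 0 := by simp [step', div_self c2]
  have w1 : ∀ k l k', k + 1 = k' → W .dir₁ x (k, l) = z₁⁻¹ * (x (k', l) - z₁ * x (k, l)) :=
    fun k l k' hk => by
      have : W .dir₁ x (k, l) = z₁⁻¹ * (x (k + 1, l + 0) - z₁ * x (k, l)) := rfl
      rw [this, add_zero, hk]
  have w2 : ∀ k l l', l + 1 = l' → W .dir₂ x (k, l) = z₂⁻¹ * (x (k, l') - z₂ * x (k, l)) :=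
    fun k l l' hl => by
      have : W .dir₂ x (k, l) = z₂⁻¹ * (x (k + 0, l + 1) - z₂ * x (k, l)) := rfl
      rw [this, add_zero, hl]
  have dw : ∀ κ t, HasDerivAt (fun t => step a₁ a₂ κ t * φ κ t)
      (step' a₁ a₂ κ t * φ κ t + step a₁ a₂ κ t * φ' κ t) t := fun κ t =>
    (hasDerivAt_step a₁ a₂ κ t).fun_mul (h.hasDerivAt κ t)
  have dw' : ∀ κ t, HasDerivAt (fun t => step' a₁ a₂ κ t * φ κ t + step a₁ a₂ κ t * φ' κ t)
      (step'' a₁ a₂ κ t * φ κ t + 2 * (step' a₁ a₂ κ t * φ' κ t) -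
        lam * (step a₁ a₂ κ t * φ κ t)) t := fun κ t =>
    (((hasDerivAt_step' a₁ a₂ κ t).fun_mul (h.hasDerivAt κ t)).fun_add
      ((hasDerivAt_step a₁ a₂ κ t).fun_mul (h.hasDerivAt' κ t))).congr_deriv (by ring)
  have comb : ∀ (p q : ∀ κ, IntervalL2 (left a₃ κ) (right a₁ a₂ a₃ κ)) (c : ℤ × ℤ) (κ : EdgeKind),
      (embed p x + assemble q W x : GraphL2 a₁ a₂ a₃) (c, κ) =ᵐ[edgeMeasure a₁ a₂ a₃ κ]
        fun t => x c * p κ t + W κ x c * q κ t := fun p q c κ => by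
    have e : (embed p x + assemble q W x : GraphL2 a₁ a₂ a₃) (c, κ) =
        x c • p κ + W κ x c • q κ := by
      rw [lp.coeFn_add, Pi.add_apply, embed_apply, assemble_apply]
    rw [e]
    filter_upwards [Lp.coeFn_add (x c • p κ) (W κ x c • q κ), Lp.coeFn_smul (x c) (p κ),
      Lp.coeFn_smul (W κ x c) (q κ)] with t h1 h2 h3
    rw [h1, Pi.add_apply, h2, h3]
    rfl
  refine ⟨fun c κ t => x c * φ κ t + W κ x c * (step a₁ a₂ κ t * φ κ t),
    fun c κ t => x c * φ' κ t +
      W κ x c * (step' a₁ a₂ κ t * φ κ t + step a₁ a₂ κ t * φ' κ t),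
    embed (fun κ => toL2 (cφ' κ).continuousOn) x +
      assemble (fun κ => toL2 (cw' κ).continuousOn) W x, ⟨?_, ?_, ?_, ?_⟩, ?_, ?_, ?_⟩
  · intro c κ
    refine EventuallyEq.symm ((comb _ _ c κ).trans ?_)
    filter_upwards [coeFn_toL2 (a := left a₃ κ) (b := right a₁ a₂ a₃ κ) (cφ κ).continuousOn,
      coeFn_toL2 (a := left a₃ κ) (b := right a₁ a₂ a₃ κ) (cw κ).continuousOn] with t h1 h2
    rw [h1, h2]
  · intro c κ
    refine EventuallyEq.symm ((comb _ _ c κ).trans ?_)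
    filter_upwards [coeFn_toL2 (a := left a₃ κ) (b := right a₁ a₂ a₃ κ) (cφ' κ).continuousOn,
      coeFn_toL2 (a := left a₃ κ) (b := right a₁ a₂ a₃ κ) (cw' κ).continuousOn] with t h1 h2
    rw [h1, h2]
  · intro c κ
    exact (HasDensityOn.of_hasDerivAt (fun t => ((h.hasDerivAt κ t).const_mul (x c)).fun_add
      ((dw κ t).const_mul (W κ x c)))
      ((continuous_const.mul (cφ' κ)).add (continuous_const.mul (cw' κ)))).eq_integral
  · intro c κ
    refine (HasDensityOn.congr_density (HasDensityOn.of_hasDerivAt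
      (fun t => ((h.hasDerivAt' κ t).const_mul (x c)).fun_add ((dw' κ t).const_mul (W κ x c)))
      ((continuous_const.mul (continuous_const.mul (cφ κ))).add (continuous_const.mul
        ((cr κ).sub (continuous_const.mul (cw κ)))))) ?_).eq_integral
    set F : GraphL2 a₁ a₂ a₃ := embed (fun κ => toL2 (cφ κ).continuousOn) x +
      assemble (fun κ => toL2 (cw κ).continuousOn) W x
    have e : (-((lam : ℂ) • F - assemble (fun κ => toL2 (cr κ).continuousOn) W x) :
        GraphL2 a₁ a₂ a₃) (c, κ) =
        -((lam : ℂ) • F (c, κ) - W κ x c • toL2 (cr κ).continuousOn) := by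
      rw [← assemble_apply (fun κ => toL2 (cr κ).continuousOn) W x c κ]
      rfl
    rw [e]
    filter_upwards [Lp.coeFn_neg ((lam : ℂ) • F (c, κ) - W κ x c • toL2 (cr κ).continuousOn),
      Lp.coeFn_sub ((lam : ℂ) • F (c, κ)) (W κ x c • toL2 (cr κ).continuousOn),
      Lp.coeFn_smul (lam : ℂ) (F (c, κ)),
      Lp.coeFn_smul (W κ x c) (toL2 (a := left a₃ κ) (b := right a₁ a₂ a₃ κ) (cr κ).continuousOn),
      comb (fun κ => toL2 (cφ κ).continuousOn) (fun κ => toL2 (cw κ).continuousOn) c κ,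
      coeFn_toL2 (a := left a₃ κ) (b := right a₁ a₂ a₃ κ) (cφ κ).continuousOn,
      coeFn_toL2 (a := left a₃ κ) (b := right a₁ a₂ a₃ κ) (cw κ).continuousOn,
      coeFn_toL2 (a := left a₃ κ) (b := right a₁ a₂ a₃ κ) (cr κ).continuousOn]
      with t h1 h2 h3 h4 h5 h6 h7 h8
    rw [h1, Pi.neg_apply, h2, Pi.sub_apply, h3, h4, Pi.smul_apply, Pi.smul_apply, h5, h6, h7, h8]
    simp only [smul_eq_mul]
    ring
  · intro k l
    have hp : step a₁ a₂ .plus 0 = 0 := rfl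
    have hm : step a₁ a₂ .minus 0 = 0 := rfl
    refine ⟨?_, ?_, ?_, ?_, ?_⟩
    · beta_reduce
      rw [hp, hm, h.minus_zero]
      ring
    · beta_reduce
      rw [hp, s10, h.dir₁_zero]
      ring
    · beta_reduce
      rw [hp, s11, w1 _ _ k (sub_add_cancel k 1), h.dir₁_right]
      linear_combination x (k, l) * φ .plus 0 * i1 - x (k - 1, l) * z₁ * φ .plus 0 * i1
    · beta_reduce
      rw [hp, s20, h.dir₂_zero]
      ring
    · beta_reduce
      rw [hp, s21, w2 _ _ l (sub_add_cancel l 1), h.dir₂_right]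
      linear_combination x (k, l) * φ .plus 0 * i2 - x (k, l - 1) * z₂ * φ .plus 0 * i2
  · intro c
    have hp : ∀ t, step a₁ a₂ .plus t = 0 := fun _ => rfl
    have hm : ∀ t, step a₁ a₂ .minus t = 0 := fun _ => rfl
    have hp' : ∀ t, step' a₁ a₂ .plus t = 0 := fun _ => rfl
    have hm' : ∀ t, step' a₁ a₂ .minus t = 0 := fun _ => rfl
    constructor
    · beta_reduce
      rw [hp, hm, h.quasi]
      ring
    · beta_reduce
      rw [hp, hm, hp', hm', h.quasi']
      ring
  · intro k l
    have hp : ∀ t, step a₁ a₂ .plus t = 0 := fun _ => rfl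
    have hm : ∀ t, step a₁ a₂ .minus t = 0 := fun _ => rfl
    have hp' : ∀ t, step' a₁ a₂ .plus t = 0 := fun _ => rfl
    have hm' : ∀ t, step' a₁ a₂ .minus t = 0 := fun _ => rfl
    beta_reduce
    rw [hp, hm, hp', hm', s10, s10', s11, s11', s20, s20', s21, s21',
      w1 _ _ k (sub_add_cancel k 1), w2 _ _ l (sub_add_cancel l 1)]
    linear_combination x (k, l) * h.kirchhoff + x (k - 1, l) * φ' .dir₁ a₁ * i1 +
      x (k, l - 1) * φ' .dir₂ a₂ * i2

/-- Weyl's criterion: the functions built from approximate eigenvectors of the translations have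
norm comparable to `‖x‖`, while the operator minus `lam` makes them arbitrarily small relative to
`‖x‖`. No bounded inverse can exist. -/
theorem IsBlochSolution.mem_realSpectrum (ha₁ : 0 < a₁) (ha₂ : 0 < a₂) (ha₃ : 0 < a₃)
    (h : IsBlochSolution a₁ a₂ a₃ β lam z₁ z₂ φ φ')
    (hne : ∃ κ, ∃ x ∈ Icc (left a₃ κ) (right a₁ a₂ a₃ κ), φ κ x ≠ 0) :
    lam ∈ realSpectrum (periodicOperator a₁ a₂ a₃ β) := by
  obtain ⟨v, w, r, hv, hdom⟩ := h.exists_truncation ha₁ ha₂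
  intro hres
  obtain ⟨R, -, hR⟩ := hres
  have hv0 : ∃ κ, v κ ≠ 0 := by
    obtain ⟨κ, hκ⟩ := hne
    refine ⟨κ, fun h0 => ?_⟩
    have hc : ContinuousOn (φ κ) (Icc (left a₃ κ) (right a₁ a₂ a₃ κ)) := fun t _ =>
      (h.hasDerivAt κ t).continuousAt.continuousWithinAt
    refine toL2_ne_zero (left_lt_right ha₁ ha₂ ha₃ κ) hc hκ ?_
    rw [← h0]
    exact Lp.ext ((coeFn_toL2 hc).trans (hv κ).symm)
  obtain ⟨K₀, hK₀, h₀⟩ := norm_le_norm_embed hv0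
  obtain ⟨K₁, hK₁, h₁⟩ := norm_assemble_le (H := VertexL2) w
  obtain ⟨K₂, hK₂, h₂⟩ := norm_assemble_le (H := VertexL2) r
  set M := K₀ * (K₁ + ‖R‖ * K₂) with hM
  have hM0 : 0 ≤ M := by positivity
  -- A bounded inverse would give `‖x‖ ≤ M ε ‖x‖`; this choice of `ε` makes `M ε < 1`.
  obtain ⟨x, hx0, hx1, hx2⟩ := exists_approximate_eigenvector h.norm_z₁ h.norm_z₂
    (ε := 1 / (2 * (M + 1))) (by positivity)
  set ε := 1 / (2 * (M + 1)) with hε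
  have hε0 : 0 < ε := by positivity
  have hdev : ∀ κ, ‖deviation z₁ z₂ κ x‖ ≤ ε * ‖x‖ := by
    intro κ
    cases κ
    · have : deviation z₁ z₂ .dir₁ x = z₁⁻¹ • (shift (1, 0) x - z₁ • x) := rfl
      rw [this, norm_smul, norm_inv, h.norm_z₁, inv_one, one_mul]
      exact hx1
    · have : deviation z₁ z₂ .dir₂ x = z₂⁻¹ • (shift (0, 1) x - z₂ • x) := rfl
      rw [this, norm_smul, norm_inv, h.norm_z₂, inv_one, one_mul]
      exact hx2
    · simp only [deviation, zero_apply, norm_zero]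
      positivity
    · simp only [deviation, zero_apply, norm_zero]
      positivity
  have e1 := h₁ _ x _ hdev
  have e2 := h₂ _ x _ hdev
  set f := embed v x + assemble w (deviation z₁ z₂) x with hf
  set g := assemble r (deviation z₁ z₂) x with hg
  obtain ⟨hfd, hfe⟩ := mem_domain_iff.mpr (hdom x)
  have e3 := hR ⟨f, hfd⟩
  rw [hfe] at e3
  have e4 : R (-g) = f := by
    have e : (lam : ℂ) • f - g - (lam : ℂ) • f = -g := by abel
    rw [← e]
    exact e3
  have e5 : ‖f‖ ≤ ‖R‖ * ‖g‖ := by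
    rw [← e4, ← norm_neg g]
    exact R.le_opNorm _
  have e6 : ‖embed v x‖ ≤ ‖f‖ + ‖assemble w (deviation z₁ z₂) x‖ := by
    have : embed v x = f - assemble w (deviation z₁ z₂) x := by rw [hf, add_sub_cancel_right]
    rw [this]
    exact norm_sub_le _ _
  have hxpos : 0 < ‖x‖ := norm_pos_iff.mpr hx0
  have e7 : ‖x‖ ≤ M * (ε * ‖x‖) := by
    calc ‖x‖ ≤ K₀ * ‖embed v x‖ := h₀ x
      _ ≤ K₀ * (‖R‖ * (K₂ * (ε * ‖x‖)) + K₁ * (ε * ‖x‖)) := by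
          refine mul_le_mul_of_nonneg_left (e6.trans (add_le_add (e5.trans ?_) e1)) hK₀
          exact mul_le_mul_of_nonneg_left e2 (norm_nonneg _)
      _ = M * (ε * ‖x‖) := by rw [hM]; ring
  have e8 : M * ε < 1 := by
    rw [hε, mul_one_div, div_lt_one (by positivity)]
    linarith
  nlinarith

end

section

variable {a₁ a₂ a₃ β lam : ℝ}

/-! ### Construction of Bloch solutions -/

theorem exists_ne_zero_of_deriv {L R : ℝ} (hLR : L < R) {φ : ℝ → ℂ} {d : ℂ}
    (hd : HasDerivAt φ d L) (h : φ L ≠ 0 ∨ d ≠ 0) : ∃ x ∈ Icc L R, φ x ≠ 0 := by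
  by_contra! h0
  rcases h with h | h
  · exact h (h0 L ⟨le_rfl, hLR.le⟩)
  · have h1 : HasDerivWithinAt φ d (Icc L R) L := hd.hasDerivWithinAt
    have h2 : HasDerivWithinAt φ 0 (Icc L R) L :=
      (hasDerivWithinAt_const L (Icc L R) (0 : ℂ)).congr h0 (h0 L ⟨le_rfl, hLR.le⟩)
    exact h ((uniqueDiffOn_Icc hLR L ⟨le_rfl, hLR.le⟩).eq_deriv _ h1 h2)

namespace FundPair

variable (P : FundPair lam)

/-- The solution of `-u'' = lam u` with data `A`, `B` at `L`. -/
def hom (L : ℝ) (A B : ℂ) (x : ℝ) : ℂ := A * P.c (x - L) + B * P.s (x - L)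

/-- The derivative of `hom`. -/
def hom' (L : ℝ) (A B : ℂ) (x : ℝ) : ℂ := -lam * A * P.s (x - L) + B * P.c (x - L)

theorem hasDerivAt_hom (L : ℝ) (A B : ℂ) (x : ℝ) :
    HasDerivAt (P.hom L A B) (P.hom' L A B x) x := by
  refine (((P.deriv_c_sub L x).ofReal_comp.const_mul A).fun_add
    ((P.deriv_s_sub L x).ofReal_comp.const_mul B)).congr_deriv ?_
  rw [hom']
  push_cast
  ring

theorem hasDerivAt_hom' (L : ℝ) (A B : ℂ) (x : ℝ) :
    HasDerivAt (P.hom' L A B) (-lam * P.hom L A B x) x := by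
  refine (((P.deriv_s_sub L x).ofReal_comp.const_mul (-lam * A : ℂ)).fun_add
    ((P.deriv_c_sub L x).ofReal_comp.const_mul B)).congr_deriv ?_
  rw [hom]
  push_cast
  ring

theorem hom_left (L : ℝ) (A B : ℂ) : P.hom L A B L = A := by
  simp [hom, P.c_zero, P.s_zero]

theorem hom'_left (L : ℝ) (A B : ℂ) : P.hom' L A B L = B := by
  simp [hom', P.c_zero, P.s_zero]

end FundPair

variable (P : FundPair lam)

/-- The counterpart of `inDomain_of_initial_data` for Bloch solutions: there is no source, and the
translations are replaced by the phases `z₁`, `z₂`. -/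
theorem mem_realSpectrum_of_data (ha₁ : 0 < a₁) (ha₂ : 0 < a₂) (ha₃ : 0 < a₃) {z₁ z₂ : ℂ}
    (hz₁ : ‖z₁‖ = 1) (hz₂ : ‖z₂‖ = 1) (A B : EdgeKind → ℂ)
    (hA₁ : A .dir₁ = A .plus) (hA₂ : A .dir₂ = A .plus)
    (hm : P.c (a₃ / 2) * A .minus + P.s (a₃ / 2) * B .minus = A .plus)
    (h₁ : P.c a₁ * A .plus + P.s a₁ * B .dir₁ = z₁ * A .plus)
    (h₂ : P.c a₂ * A .plus + P.s a₂ * B .dir₂ = z₂ * A .plus)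
    (hAm : A .minus = Complex.exp (Complex.I * β) *
      (P.c (a₃ / 2) * A .plus + P.s (a₃ / 2) * B .plus))
    (hBm : B .minus = Complex.exp (Complex.I * β) *
      (-lam * P.s (a₃ / 2) * A .plus + P.c (a₃ / 2) * B .plus))
    (hK : B .dir₁ - z₁⁻¹ * (-lam * P.s a₁ * A .plus + P.c a₁ * B .dir₁) +
      B .dir₂ - z₂⁻¹ * (-lam * P.s a₂ * A .plus + P.c a₂ * B .dir₂) +
      (B .plus - (-lam * P.s (a₃ / 2) * A .minus + P.c (a₃ / 2) * B .minus)) = 0)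
    (hne : ∃ κ, A κ ≠ 0 ∨ B κ ≠ 0) :
    lam ∈ realSpectrum (periodicOperator a₁ a₂ a₃ β) := by
  have hb : IsBlochSolution a₁ a₂ a₃ β lam z₁ z₂ (fun κ => P.hom (left a₃ κ) (A κ) (B κ))
      (fun κ => P.hom' (left a₃ κ) (A κ) (B κ)) := by
    have heE := exp_neg_mul_exp β
    have hmm : (0 : ℝ) - -(a₃ / 2) = a₃ / 2 := by ring
    refine ⟨hz₁, hz₂, fun κ x => P.hasDerivAt_hom _ _ _ x, fun κ x => P.hasDerivAt_hom' _ _ _ x,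
      ?_, ?_, ?_, ?_, ?_, ?_, ?_, ?_⟩ <;>
      simp only [left, FundPair.hom_left, FundPair.hom'_left]
    · simp only [FundPair.hom, hmm]
      rw [← hm]
      ring
    · exact hA₁
    · exact hA₂
    · simp only [FundPair.hom, sub_zero]
      rw [← h₁, hA₁]
      ring
    · simp only [FundPair.hom, sub_zero]
      rw [← h₂, hA₂]
      ring
    · simp only [FundPair.hom, sub_zero]
      rw [hAm, ← mul_assoc, heE]
      ring
    · simp only [FundPair.hom', sub_zero]
      rw [hBm, ← mul_assoc, heE]
      ring
    · simp only [FundPair.hom', sub_zero, hmm]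
      rw [← hK, hA₁, hA₂]
      ring
  refine hb.mem_realSpectrum ha₁ ha₂ ha₃ ?_
  obtain ⟨κ, hκ⟩ := hne
  refine ⟨κ, exists_ne_zero_of_deriv (left_lt_right ha₁ ha₂ ha₃ κ) (P.hasDerivAt_hom _ _ _ _) ?_⟩
  rwa [P.hom_left, P.hom'_left]

theorem FundPair.norm_c_of_s_eq_zero {a : ℝ} (h : P.s a = 0) :
    ‖(P.c a : ℂ)‖ = 1 ∧ (P.c a : ℂ)⁻¹ * P.c a = 1 := by
  have h1 := P.sq_add a
  rw [h] at h1
  have h2 : P.c a ≠ 0 := fun h0 => by simp [h0] at h1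
  refine ⟨?_, inv_mul_cancel₀ (Complex.ofReal_ne_zero.mpr h2)⟩
  rw [Complex.norm_real, Real.norm_eq_abs]
  have h3 : P.c a ^ 2 = 1 := by linarith
  exact (pow_eq_one_iff_of_nonneg (abs_nonneg _) two_ne_zero).mp (by rw [sq_abs, h3])

/-- The function `s` on the edges of direction 1 vanishes at all vertices and may be extended by
zero to the other edges. Its slope is multiplied by `c a₁ = ±1` along an edge; with this number as
the phase `z₁` the Kirchhoff sum is zero. -/
theorem mem_realSpectrum_of_s₁_eq_zero (ha₁ : 0 < a₁) (ha₂ : 0 < a₂) (ha₃ : 0 < a₃)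
    (h : P.s a₁ = 0) : lam ∈ realSpectrum (periodicOperator a₁ a₂ a₃ β) := by
  obtain ⟨h1, h2⟩ := P.norm_c_of_s_eq_zero h
  refine mem_realSpectrum_of_data P ha₁ ha₂ ha₃ (z₁ := P.c a₁) (z₂ := 1) h1 norm_one
    (fun _ => 0) (Pi.single .dir₁ 1) rfl rfl ?_ ?_ ?_ ?_ ?_ ?_ ⟨.dir₁, ?_⟩
  · simp
  · simp [h]
  · simp
  · simp
  · simp
  · simp [h2]
  · simp

theorem mem_realSpectrum_of_s₂_eq_zero (ha₁ : 0 < a₁) (ha₂ : 0 < a₂) (ha₃ : 0 < a₃)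
    (h : P.s a₂ = 0) : lam ∈ realSpectrum (periodicOperator a₁ a₂ a₃ β) := by
  obtain ⟨h1, h2⟩ := P.norm_c_of_s_eq_zero h
  refine mem_realSpectrum_of_data P ha₁ ha₂ ha₃ (z₁ := 1) (z₂ := P.c a₂) norm_one h1
    (fun _ => 0) (Pi.single .dir₂ 1) rfl rfl ?_ ?_ ?_ ?_ ?_ ?_ ⟨.dir₂, ?_⟩
  · simp
  · simp
  · simp [h]
  · simp
  · simp
  · simp [h2]
  · simp

/-- Each of `(S, -p)` and `(r, -q)` lies in the kernel of the singular matrix; if both vanish, the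
matrix is zero. -/
theorem exists_kernel {p q r S : ℂ} (h : p * r - S * q = 0) :
    ∃ A B : ℂ, (A ≠ 0 ∨ B ≠ 0) ∧ p * A + S * B = 0 ∧ q * A + r * B = 0 := by
  by_cases h1 : S ≠ 0 ∨ -p ≠ 0
  · exact ⟨S, -p, h1, by ring, by linear_combination -h⟩
  · push Not at h1
    obtain ⟨rfl, hp⟩ := h1
    rw [neg_eq_zero] at hp
    subst hp
    by_cases h2 : r ≠ 0 ∨ -q ≠ 0
    · exact ⟨r, -q, h2, by ring, by ring⟩
    · push Not at h2
      obtain ⟨rfl, hq⟩ := h2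
      rw [neg_eq_zero] at hq
      subst hq
      exact ⟨1, 0, Or.inl one_ne_zero, by ring, by ring⟩

theorem exists_unit_add_inv {t : ℝ} (ht : |t| ≤ 1) :
    ∃ z : ℂ, ‖z‖ = 1 ∧ z + z⁻¹ = 2 * t := by
  refine ⟨Complex.exp (Complex.I * Real.arccos t), ?_, ?_⟩
  · rw [mul_comm]
    exact Complex.norm_exp_ofReal_mul_I _
  · rw [← Complex.exp_neg, ← neg_mul, exp_add_exp_neg,
      Real.cos_arccos (abs_le.mp ht).1 (abs_le.mp ht).2]

theorem exists_cosines {D α₁ α₂ : ℝ} (h : |D| ≤ |α₁| + |α₂|) :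
    ∃ t₁ t₂ : ℝ, |t₁| ≤ 1 ∧ |t₂| ≤ 1 ∧ D + α₁ * t₁ + α₂ * t₂ = 0 := by
  rcases (add_nonneg (abs_nonneg α₁) (abs_nonneg α₂)).eq_or_lt with h0 | h0
  · rw [← h0] at h
    have h1 : α₁ = 0 := abs_eq_zero.mp (by linarith [abs_nonneg α₁, abs_nonneg α₂])
    have h2 : α₂ = 0 := abs_eq_zero.mp (by linarith [abs_nonneg α₁, abs_nonneg α₂])
    have h3 : D = 0 := abs_eq_zero.mp (le_antisymm h (abs_nonneg D))
    exact ⟨0, 0, by simp, by simp, by rw [h1, h2, h3]; ring⟩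
  · set M := |α₁| + |α₂|
    -- The quotient `|α| / α` is the sign of `α`, and is 0 for `α = 0`. The solution sought is `tᵢ =
    -- -(D / M) sign αᵢ`.
    have hb : ∀ α : ℝ, |-(D / M) * (|α| / α)| ≤ 1 := fun α => by
      rw [abs_mul, abs_neg, abs_div, abs_of_pos h0, abs_div, abs_abs]
      exact mul_le_one₀ ((div_le_one h0).mpr h) (by positivity) (div_self_le_one _)
    have he : ∀ α : ℝ, α * (|α| / α) = |α| := fun α => by
      rcases eq_or_ne α 0 with rfl | hα
      · simp
      · field_simp
    refine ⟨_, _, hb α₁, hb α₂, ?_⟩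
    have : D / M * M = D := div_mul_cancel₀ _ h0.ne'
    linear_combination -(D / M) * he α₁ - (D / M) * he α₂ - this

/-- The inequality allows a choice of phases at which the symbol of the determinant vanishes. The
vertex system with these phases is then a singular numerical matrix, and a kernel vector supplies
the data of a Bloch solution. -/
theorem mem_realSpectrum_of_le (ha₁ : 0 < a₁) (ha₂ : 0 < a₂) (ha₃ : 0 < a₃)
    (hs₁ : P.s a₁ ≠ 0) (hs₂ : P.s a₂ ≠ 0)
    (hD : |Real.cos β - P.c a₃ - P.s a₃ * (P.c a₁ / P.s a₁ + P.c a₂ / P.s a₂)| ≤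
      |P.s a₃ / P.s a₁| + |P.s a₃ / P.s a₂|) :
    lam ∈ realSpectrum (periodicOperator a₁ a₂ a₃ β) := by
  have hs₁' : (P.s a₁ : ℂ) ≠ 0 := Complex.ofReal_ne_zero.mpr hs₁
  have hs₂' : (P.s a₂ : ℂ) ≠ 0 := Complex.ofReal_ne_zero.mpr hs₂
  obtain ⟨t₁, t₂, ht₁, ht₂, ht⟩ := exists_cosines hD
  obtain ⟨z₁, hz₁, hzt₁⟩ := exists_unit_add_inv ht₁
  obtain ⟨z₂, hz₂, hzt₂⟩ := exists_unit_add_inv ht₂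
  have hz1 : z₁ ≠ 0 := fun h0 => by simp [h0] at hz₁
  have hz2 : z₂ ≠ 0 := fun h0 => by simp [h0] at hz₂
  have j1 : z₁⁻¹ * z₁ = 1 := inv_mul_cancel₀ hz1
  have j2 : z₂⁻¹ * z₂ = 1 := inv_mul_cancel₀ hz2
  have heE := exp_neg_mul_exp β
  have hEe := exp_add_exp_neg β
  have hq3 := P.sq_add_complex a₃
  have htc := congrArg (fun r : ℝ => (r : ℂ)) ht
  push_cast at htc
  set E := Complex.exp (Complex.I * β)
  set e := Complex.exp (-Complex.I * β)
  rw [← Complex.ofReal_cos] at htc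
  obtain ⟨A, B, hAB, k1, k2⟩ := exists_kernel (p := P.c a₃ - e) (r := 1 - E * P.c a₃)
    (S := P.s a₃) (q := (P.s a₁ : ℂ)⁻¹ * (z₁ + z₁⁻¹) + (P.s a₂ : ℂ)⁻¹ * (z₂ + z₂⁻¹) +
      (-2 * P.c a₁ / P.s a₁ - 2 * P.c a₂ / P.s a₂ + E * lam * P.s a₃)) (by
      rw [hzt₁, hzt₂]
      simp only [div_eq_mul_inv] at htc ⊢
      linear_combination (P.c a₃ : ℂ) * heE - E * hq3 - hEe - 2 * htc)
  let AA : EdgeKind → ℂ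
    | .dir₁ => A
    | .dir₂ => A
    | .plus => A
    | .minus => E * (P.c (a₃ / 2) * A + P.s (a₃ / 2) * B)
  let BB : EdgeKind → ℂ
    | .dir₁ => (P.s a₁ : ℂ)⁻¹ * (z₁ * A - P.c a₁ * A - 0)
    | .dir₂ => (P.s a₂ : ℂ)⁻¹ * (z₂ * A - P.c a₂ * A - 0)
    | .plus => B
    | .minus => E * (-lam * P.s (a₃ / 2) * A + P.c (a₃ / 2) * B)
  refine mem_realSpectrum_of_data P ha₁ ha₂ ha₃ hz₁ hz₂ AA BB rfl rfl ?_ ?_ ?_ rfl rfl ?_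
    ⟨.plus, hAB⟩
  · change P.c (a₃ / 2) * (E * (P.c (a₃ / 2) * A + P.s (a₃ / 2) * B)) +
      P.s (a₃ / 2) * (E * (-lam * P.s (a₃ / 2) * A + P.c (a₃ / 2) * B)) = A
    rw [P.c_double a₃, P.s_double a₃] at k1
    linear_combination E * k1 + A * heE
  · change P.c a₁ * A + P.s a₁ * ((P.s a₁ : ℂ)⁻¹ * (z₁ * A - P.c a₁ * A - 0)) = z₁ * A
    rw [mul_inv_cancel_left₀ hs₁']
    ring
  · change P.c a₂ * A + P.s a₂ * ((P.s a₂ : ℂ)⁻¹ * (z₂ * A - P.c a₂ * A - 0)) = z₂ * A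
    rw [mul_inv_cancel_left₀ hs₂']
    ring
  -- The values at the four neighbouring vertices are `A` times `z₁`, `z₁⁻¹`, `z₂`, `z₂⁻¹`.
  · have h2 := kirchhoff_sum_eq (l := (lam : ℂ)) (s := P.s (a₃ / 2)) (c := P.c (a₃ / 2))
        (E := E) (a := A) (aE := z₁ * A) (aW := z₁⁻¹ * A) (aN := z₂ * A) (aS := z₂⁻¹ * A) (b := B)
        (g₁ := 0) (g₁W := 0) (g₂ := 0) (g₂S := 0) (d₁ := 0) (d₂ := 0) (gp := 0) (dp := 0) (dm := 0)
        hs₁' hs₂' (P.sq_add_complex a₁) (P.sq_add_complex a₂)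
    change (P.s a₁ : ℂ)⁻¹ * (z₁ * A - P.c a₁ * A - 0) - z₁⁻¹ * (-lam * P.s a₁ * A + P.c a₁ *
      ((P.s a₁ : ℂ)⁻¹ * (z₁ * A - P.c a₁ * A - 0))) +
      (P.s a₂ : ℂ)⁻¹ * (z₂ * A - P.c a₂ * A - 0) - z₂⁻¹ * (-lam * P.s a₂ * A + P.c a₂ *
      ((P.s a₂ : ℂ)⁻¹ * (z₂ * A - P.c a₂ * A - 0))) +
      (B - (-lam * P.s (a₃ / 2) * (E * (P.c (a₃ / 2) * A + P.s (a₃ / 2) * B)) + P.c (a₃ / 2) *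
        (E * (-lam * P.s (a₃ / 2) * A + P.c (a₃ / 2) * B)))) = 0
    rw [P.c_double a₃, P.s_double a₃] at k2
    linear_combination h2 + k2 - P.c a₁ * (P.s a₁ : ℂ)⁻¹ * A * j1 -
      P.c a₂ * (P.s a₂ : ℂ)⁻¹ * A * j2

/-! ### The spectrum -/

/-- The fundamental solutions for a positive spectral parameter. -/
def posPair {w : ℝ} (hw : w ≠ 0) : FundPair (w ^ 2) where
  c x := Real.cos (w * x)
  s x := Real.sin (w * x) / w
  deriv_c x := (((hasDerivAt_id x).const_mul w).cos).congr_deriv (by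
    simp only [id_eq]
    field_simp)
  deriv_s x := ((((hasDerivAt_id x).const_mul w).sin).div_const w).congr_deriv (by
    simp only [id_eq]
    field_simp)
  c_zero := by simp
  s_zero := by simp
  c_add x y := by
    rw [mul_add, Real.cos_add]
    field_simp
  s_add x y := by
    rw [mul_add, Real.sin_add]
    field_simp
  sq_add x := by
    have := Real.sin_sq_add_cos_sq (w * x)
    field_simp
    linarith

/-- The fundamental solutions for the spectral parameter zero. -/
def zeroPair : FundPair 0 where
  c _ := 1
  s x := x
  deriv_c x := (hasDerivAt_const x 1).congr_deriv (by simp)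
  deriv_s x := hasDerivAt_id x
  c_zero := rfl
  s_zero := rfl
  c_add x y := by ring
  s_add x y := by ring
  sq_add x := by ring

/-- The fundamental solutions for a negative spectral parameter. -/
def negPair {w : ℝ} (hw : w ≠ 0) : FundPair (-w ^ 2) where
  c x := Real.cosh (w * x)
  s x := Real.sinh (w * x) / w
  deriv_c x := (((hasDerivAt_id x).const_mul w).cosh).congr_deriv (by
    simp only [id_eq]
    field_simp)
  deriv_s x := ((((hasDerivAt_id x).const_mul w).sinh).div_const w).congr_deriv (by
    simp only [id_eq]
    field_simp)
  c_zero := by simp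
  s_zero := by simp
  c_add x y := by
    rw [mul_add, Real.cosh_add]
    field_simp
    ring
  s_add x y := by
    rw [mul_add, Real.sinh_add]
    field_simp
  sq_add x := by
    have := Real.cosh_sq (w * x)
    field_simp
    linarith

/-- The dispersion relation in terms of the frequency `w > 0`. -/
def IsBandFrequency (a₁ a₂ a₃ β w : ℝ) : Prop :=
  Real.sin (w * a₁) = 0 ∨ Real.sin (w * a₂) = 0 ∨
    |Real.cos β - Real.cos (w * a₃) - Real.sin (w * a₃) *
      (Real.cos (w * a₁) / Real.sin (w * a₁) + Real.cos (w * a₂) / Real.sin (w * a₂))| ≤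
    |Real.sin (w * a₃) / Real.sin (w * a₁)| + |Real.sin (w * a₃) / Real.sin (w * a₂)|

theorem sq_mem_realSpectrum_iff (ha₁ : 0 < a₁) (ha₂ : 0 < a₂) (ha₃ : 0 < a₃) {w : ℝ} (hw : 0 < w) :
    w ^ 2 ∈ realSpectrum (periodicOperator a₁ a₂ a₃ β) ↔ IsBandFrequency a₁ a₂ a₃ β w := by
  have hw' := hw.ne'
  -- The normalising factor `1 / w` in `s` cancels from every term of the dispersion relation.
  have e1 : ∀ a b, (posPair hw').s a / (posPair hw').s b = Real.sin (w * a) / Real.sin (w * b) :=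
    fun a b => div_div_div_cancel_right₀ hw' _ _
  have e2 : (posPair hw').s a₃ * ((posPair hw').c a₁ / (posPair hw').s a₁ +
      (posPair hw').c a₂ / (posPair hw').s a₂) = Real.sin (w * a₃) *
      (Real.cos (w * a₁) / Real.sin (w * a₁) + Real.cos (w * a₂) / Real.sin (w * a₂)) := by
    simp only [posPair]
    field_simp
  have e3 : ∀ a, (posPair hw').s a = 0 ↔ Real.sin (w * a) = 0 := fun a => by
    simp [posPair, hw']
  have e4 : (posPair hw').c a₃ = Real.cos (w * a₃) := rfl
  by_cases h1 : Real.sin (w * a₁) = 0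
  · exact ⟨fun _ => Or.inl h1, fun _ =>
      mem_realSpectrum_of_s₁_eq_zero (posPair hw') ha₁ ha₂ ha₃ ((e3 _).mpr h1)⟩
  by_cases h2 : Real.sin (w * a₂) = 0
  · exact ⟨fun _ => Or.inr (Or.inl h2), fun _ =>
      mem_realSpectrum_of_s₂_eq_zero (posPair hw') ha₁ ha₂ ha₃ ((e3 _).mpr h2)⟩
  rw [IsBandFrequency, or_iff_right h1, or_iff_right h2]
  constructor
  · intro h
    by_contra! hlt
    refine notMem_realSpectrum (posPair hw') (β := β) ha₁ ha₂ ha₃ (fun h0 => h1 ((e3 _).mp h0))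
      (fun h0 => h2 ((e3 _).mp h0)) ?_ h
    rwa [e1, e1, e2, e4]
  · intro h
    refine mem_realSpectrum_of_le (posPair hw') ha₁ ha₂ ha₃ (fun h0 => h1 ((e3 _).mp h0))
      (fun h0 => h2 ((e3 _).mp h0)) ?_
    rwa [e1, e1, e2, e4]

/-- With `c = 1` and `s x = x`, the left side of the dispersion inequality exceeds the right side by
exactly `1 - cos β`. -/
theorem zero_mem_realSpectrum_iff (ha₁ : 0 < a₁) (ha₂ : 0 < a₂) (ha₃ : 0 < a₃) :
    (0 : ℝ) ∈ realSpectrum (periodicOperator a₁ a₂ a₃ β) ↔ Real.cos β = 1 := by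
  have h1 : 0 < a₃ / a₁ := by positivity
  have h2 : 0 < a₃ / a₂ := by positivity
  have h3 := Real.cos_le_one β
  have e : |Real.cos β - zeroPair.c a₃ - zeroPair.s a₃ *
      (zeroPair.c a₁ / zeroPair.s a₁ + zeroPair.c a₂ / zeroPair.s a₂)| =
      1 - Real.cos β + (a₃ / a₁ + a₃ / a₂) := by
    simp only [zeroPair]
    have : Real.cos β - 1 - a₃ * (1 / a₁ + 1 / a₂) = -(1 - Real.cos β + (a₃ / a₁ + a₃ / a₂)) := by
      ring
    rw [this, abs_neg, abs_of_nonneg (by linarith)]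
  have e' : |zeroPair.s a₃ / zeroPair.s a₁| + |zeroPair.s a₃ / zeroPair.s a₂| =
      a₃ / a₁ + a₃ / a₂ := by
    simp only [zeroPair]
    rw [abs_of_pos h1, abs_of_pos h2]
  constructor
  · intro h
    by_contra hne
    refine notMem_realSpectrum zeroPair (β := β) ha₁ ha₂ ha₃ ha₁.ne' ha₂.ne' ?_ h
    rw [e, e']
    linarith [lt_of_le_of_ne h3 hne]
  · intro h
    refine mem_realSpectrum_of_le zeroPair ha₁ ha₂ ha₃ ha₁.ne' ha₂.ne' ?_
    rw [e, e', h]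
    linarith

/-- For a negative parameter `c` is a hyperbolic cosine and exceeds 1 at each of the three lengths.
Hence the terms `s a₃ c aᵢ / s aᵢ` alone reach the threshold, and `c a₃ - cos β > 0` makes the
inequality strict. -/
theorem nonneg_of_mem_realSpectrum (ha₁ : 0 < a₁) (ha₂ : 0 < a₂) (ha₃ : 0 < a₃) {t : ℝ}
    (ht : t ∈ realSpectrum (periodicOperator a₁ a₂ a₃ β)) : 0 ≤ t := by
  by_contra! hneg
  obtain ⟨w, hw, rfl⟩ : ∃ w : ℝ, 0 < w ∧ t = -w ^ 2 :=
    ⟨√(-t), Real.sqrt_pos.mpr (by linarith), by rw [Real.sq_sqrt (by linarith)]; ring⟩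
  have hs : ∀ a, 0 < a → 0 < (negPair hw.ne').s a := fun a ha =>
    div_pos (Real.sinh_pos_iff.mpr (mul_pos hw ha)) hw
  have hc : ∀ a, 0 < a → 1 < (negPair hw.ne').c a := fun a ha =>
    Real.one_lt_cosh.mpr (mul_pos hw ha).ne'
  refine notMem_realSpectrum (negPair hw.ne') (β := β) ha₁ ha₂ ha₃ (hs a₁ ha₁).ne' (hs a₂ ha₂).ne'
    ?_ ht
  have h1 := hs a₁ ha₁
  have h2 := hs a₂ ha₂
  have h3 := hs a₃ ha₃
  have k1 := hc a₁ ha₁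
  have k2 := hc a₂ ha₂
  have k3 := hc a₃ ha₃
  set Q := negPair hw.ne'
  have l1 : Q.s a₃ / Q.s a₁ ≤ Q.s a₃ * (Q.c a₁ / Q.s a₁) := by
    rw [mul_div_assoc', mul_comm]
    gcongr
    nlinarith
  have l2 : Q.s a₃ / Q.s a₂ ≤ Q.s a₃ * (Q.c a₂ / Q.s a₂) := by
    rw [mul_div_assoc', mul_comm]
    gcongr
    nlinarith
  rw [abs_of_pos (div_pos h3 h1), abs_of_pos (div_pos h3 h2)]
  refine lt_of_lt_of_le ?_ (neg_le_abs _)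
  rw [mul_add]
  linarith [Real.cos_le_one β]

end

section

variable {a a₁ a₂ a₃ β w q b t : ℝ}

/-! ### The band condition as a comparison of cotangent functions -/

/-- The quotient `(cos β - cos (w a₃)) / sin (w a₃)`, continued analytically. -/
def verticalSlope (a₃ β w : ℝ) : ℝ :=
  Real.cos (β / 2) ^ 2 * (Real.sin (w * (a₃ / 2)) / Real.cos (w * (a₃ / 2))) -
    Real.sin (β / 2) ^ 2 * (Real.cos (w * (a₃ / 2)) / Real.sin (w * (a₃ / 2)))

/-- The poles of `verticalSlope a₃ β`. -/
def IsPole (a₃ β w : ℝ) : Prop :=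
  Real.sin (w * a₃) = 0 ∧ Real.cos β ≠ Real.cos (w * a₃)

/-- The upper edge of the range of `cot (w a) + cos θ / sin (w a)`. -/
def upperSlope (a w : ℝ) : ℝ := Real.cos (w * a) / Real.sin (w * a) + 1 / |Real.sin (w * a)|

/-- The lower edge of the range of `cot (w a) + cos θ / sin (w a)`. -/
def lowerSlope (a w : ℝ) : ℝ := Real.cos (w * a) / Real.sin (w * a) - 1 / |Real.sin (w * a)|

theorem abs_cos_div_sin_le (x : ℝ) : |Real.cos x / Real.sin x| ≤ 1 / |Real.sin x| := by
  rw [abs_div]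
  exact div_le_div_of_nonneg_right (Real.abs_cos_le_one x) (abs_nonneg _)

/-- With `lowerSlope_nonpos`, this places 0 in the band at every frequency, so `verticalSlope`
cannot change sides within a gap without passing through a pole. -/
theorem upperSlope_nonneg (a w : ℝ) : 0 ≤ upperSlope a w := by
  have := (abs_le.mp (abs_cos_div_sin_le (w * a))).1
  unfold upperSlope
  linarith

theorem lowerSlope_nonpos (a w : ℝ) : lowerSlope a w ≤ 0 := by
  have := (abs_le.mp (abs_cos_div_sin_le (w * a))).2
  unfold lowerSlope
  linarith

/-- The reflection `w ↦ -w` turns the band upside down; statements about right ends of gaps follow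
from those about left ends. -/
theorem verticalSlope_neg (a₃ β w : ℝ) : verticalSlope a₃ β (-w) = -verticalSlope a₃ β w := by
  simp only [verticalSlope, neg_mul, Real.sin_neg, Real.cos_neg, neg_div, div_neg]
  ring

theorem upperSlope_neg (a w : ℝ) : upperSlope a (-w) = -lowerSlope a w := by
  simp only [upperSlope, lowerSlope, neg_mul, Real.sin_neg, Real.cos_neg, div_neg, abs_neg]
  ring

theorem lowerSlope_neg (a w : ℝ) : lowerSlope a (-w) = -upperSlope a w := by
  simp only [upperSlope, lowerSlope, neg_mul, Real.sin_neg, Real.cos_neg, div_neg, abs_neg]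
  ring

theorem IsPole.neg (h : IsPole a₃ β w) : IsPole a₃ β (-w) := by
  simpa [IsPole, neg_mul] using h

theorem isBandFrequency_neg :
    IsBandFrequency a₁ a₂ a₃ β (-w) ↔ IsBandFrequency a₁ a₂ a₃ β w := by
  simp only [IsBandFrequency, neg_mul, Real.sin_neg, Real.cos_neg, neg_eq_zero, div_neg, neg_div,
    neg_neg]
  rw [← neg_add, mul_neg, neg_neg]

theorem half_facts (a₃ w : ℝ) :
    Real.sin (w * a₃) = 2 * Real.sin (w * (a₃ / 2)) * Real.cos (w * (a₃ / 2)) ∧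
      Real.cos (w * a₃) = 2 * Real.cos (w * (a₃ / 2)) ^ 2 - 1 := by
  rw [← Real.sin_two_mul, ← Real.cos_two_mul]
  constructor <;> congr 1 <;> ring

theorem cos_eq_half (β : ℝ) : Real.cos β = 2 * Real.cos (β / 2) ^ 2 - 1 := by
  rw [← Real.cos_two_mul]
  congr 1
  ring

/-- Away from the poles, a term of `verticalSlope` whose denominator vanishes has coefficient zero.
Such a term is identically zero, and this is why the formula is the analytic continuation of the
quotient. -/
theorem coeff_of_not_isPole (h : ¬IsPole a₃ β w) :
    (Real.cos (β / 2) = 0 ∨ Real.cos (w * (a₃ / 2)) ≠ 0) ∧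
      (Real.sin (β / 2) = 0 ∨ Real.sin (w * (a₃ / 2)) ≠ 0) := by
  obtain ⟨h1, h2⟩ := half_facts a₃ w
  have h3 := cos_eq_half β
  have h4 := Real.sin_sq_add_cos_sq (w * (a₃ / 2))
  have h5 := Real.sin_sq_add_cos_sq (β / 2)
  constructor
  · by_contra! hc
    refine h ⟨by rw [h1, hc.2]; ring, fun he => hc.1 ?_⟩
    rw [h2, h3, hc.2] at he
    exact pow_eq_zero_iff (two_ne_zero) |>.mp (by linarith)
  · by_contra! hc
    refine h ⟨by rw [h1, hc.2]; ring, fun he => hc.1 ?_⟩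
    rw [h2, h3] at he
    rw [hc.2] at h4
    exact pow_eq_zero_iff (two_ne_zero) |>.mp (by linarith)

theorem sin_mul_verticalSlope (h : ¬IsPole a₃ β w) :
    Real.sin (w * a₃) * verticalSlope a₃ β w = Real.cos β - Real.cos (w * a₃) := by
  obtain ⟨h1, h2⟩ := half_facts a₃ w
  have h3 := cos_eq_half β
  have h4 := Real.sin_sq_add_cos_sq (w * (a₃ / 2))
  have h5 := Real.sin_sq_add_cos_sq (β / 2)
  obtain ⟨hp, hq⟩ := coeff_of_not_isPole h
  rw [h1, h2, h3, verticalSlope]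
  set s := Real.sin (w * (a₃ / 2))
  set c := Real.cos (w * (a₃ / 2))
  have e1 : Real.cos (β / 2) ^ 2 * (s / c) * c = Real.cos (β / 2) ^ 2 * s := by
    rcases hp with hp | hp
    · rw [hp]; ring
    · field_simp
  have e2 : Real.sin (β / 2) ^ 2 * (c / s) * s = Real.sin (β / 2) ^ 2 * c := by
    rcases hq with hq | hq
    · rw [hq]; ring
    · field_simp
  linear_combination 2 * s * e1 - 2 * c * e2 + 2 * Real.cos (β / 2) ^ 2 * h4 - 2 * c ^ 2 * h5

theorem verticalSlope_eq_zero (h : ¬IsPole a₃ β w) (hs : Real.sin (w * a₃) = 0) :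
    verticalSlope a₃ β w = 0 := by
  obtain ⟨h1, -⟩ := half_facts a₃ w
  obtain ⟨hp, hq⟩ := coeff_of_not_isPole h
  rw [h1] at hs
  have : Real.sin (w * (a₃ / 2)) = 0 ∨ Real.cos (w * (a₃ / 2)) = 0 := by
    rcases mul_eq_zero.mp hs with h | h
    · exact Or.inl (by linarith)
    · exact Or.inr h
  unfold verticalSlope
  rcases this with h | h <;> simp [h]

/-- Division of the dispersion inequality by `|sin (w a₃)|`. If this is zero without a pole, the
inequality reads `0 ≤ 0`, and `verticalSlope` is 0, which always lies in the band. -/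
theorem isBandFrequency_iff (h1 : Real.sin (w * a₁) ≠ 0) (h2 : Real.sin (w * a₂) ≠ 0)
    (hp : ¬IsPole a₃ β w) :
    IsBandFrequency a₁ a₂ a₃ β w ↔
      lowerSlope a₁ w + lowerSlope a₂ w ≤ verticalSlope a₃ β w ∧
        verticalSlope a₃ β w ≤ upperSlope a₁ w + upperSlope a₂ w := by
  have e := sin_mul_verticalSlope hp
  simp only [IsBandFrequency, h1, h2, false_or]
  rw [← e, ← mul_sub, abs_mul, abs_div, abs_div, ← mul_one_div |Real.sin (w * a₃)|,
    ← mul_one_div |Real.sin (w * a₃)| |Real.sin (w * a₂)|, ← mul_add]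
  by_cases hs : Real.sin (w * a₃) = 0
  · rw [verticalSlope_eq_zero hp hs, hs]
    have := lowerSlope_nonpos a₁ w
    have := lowerSlope_nonpos a₂ w
    have := upperSlope_nonneg a₁ w
    have := upperSlope_nonneg a₂ w
    refine ⟨fun _ => ⟨by linarith, by linarith⟩, fun _ => by simp⟩
  · rw [mul_le_mul_iff_right₀ (abs_pos.mpr hs), abs_le, lowerSlope, lowerSlope, upperSlope,
      upperSlope]
    constructor <;> rintro ⟨u, v⟩ <;> constructor <;> linarith

theorem IsPole.not_isBandFrequency (hp : IsPole a₃ β w) (h1 : Real.sin (w * a₁) ≠ 0)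
    (h2 : Real.sin (w * a₂) ≠ 0) : ¬IsBandFrequency a₁ a₂ a₃ β w := by
  simp only [IsBandFrequency, h1, h2, false_or, hp.1, zero_mul, zero_div, abs_zero, add_zero,
    sub_zero, not_le, abs_pos]
  exact sub_ne_zero.mpr hp.2

/-- Here the first difference in the dispersion relation vanishes and `|cos x / sin x| ≤ 1 / |sin
x|` suffices. This yields `σ₃` as well as a band frequency between any two poles. -/
theorem isBandFrequency_of_cos_eq (h : Real.cos (w * a₃) = Real.cos β) :
    IsBandFrequency a₁ a₂ a₃ β w := by
  by_cases h1 : Real.sin (w * a₁) = 0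
  · exact Or.inl h1
  by_cases h2 : Real.sin (w * a₂) = 0
  · exact Or.inr (Or.inl h2)
  refine Or.inr (Or.inr ?_)
  have key : ∀ x, |Real.sin (w * a₃) * (Real.cos x / Real.sin x)| ≤
      |Real.sin (w * a₃) / Real.sin x| := by
    intro x
    rw [abs_mul, abs_div (Real.sin (w * a₃)), ← mul_one_div |Real.sin (w * a₃)|]
    exact mul_le_mul_of_nonneg_left (abs_cos_div_sin_le _) (abs_nonneg _)
  rw [h, sub_self, zero_sub, abs_neg, mul_add]
  exact (abs_add_le _ _).trans (add_le_add (key _) (key _))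

/-- A frequency that is no band frequency lies strictly above or below the band. -/
theorem lt_or_lt_of_not_isBandFrequency (hw : ¬IsBandFrequency a₁ a₂ a₃ β w)
    (hp : ¬IsPole a₃ β w) :
    verticalSlope a₃ β w < lowerSlope a₁ w + lowerSlope a₂ w ∨
      upperSlope a₁ w + upperSlope a₂ w < verticalSlope a₃ β w := by
  have h1 : Real.sin (w * a₁) ≠ 0 := fun h => hw (Or.inl h)
  have h2 : Real.sin (w * a₂) ≠ 0 := fun h => hw (Or.inr (Or.inl h))
  rw [isBandFrequency_iff h1 h2 hp, not_and_or, not_le, not_le] at hw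
  exact hw

/-! ### Regularity -/

/-- The tangent increases, the cotangent decreases, and both coefficients are squares; a term with
vanishing denominator is identically zero. -/
theorem hasDerivAt_verticalSlope (hp : ¬IsPole a₃ β w) (ha₃ : 0 < a₃) :
    ∃ d, 0 ≤ d ∧ HasDerivAt (verticalSlope a₃ β) d w := by
  obtain ⟨hp, hq⟩ := coeff_of_not_isPole hp
  have hs : HasDerivAt (fun w => Real.sin (w * (a₃ / 2)))
      (Real.cos (w * (a₃ / 2)) * (a₃ / 2)) w := by
    simpa using ((hasDerivAt_id w).mul_const (a₃ / 2)).sin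
  have hc : HasDerivAt (fun w => Real.cos (w * (a₃ / 2)))
      (-Real.sin (w * (a₃ / 2)) * (a₃ / 2)) w := by
    simpa using ((hasDerivAt_id w).mul_const (a₃ / 2)).cos
  have h4 := Real.sin_sq_add_cos_sq (w * (a₃ / 2))
  have e1 : ∃ d, 0 ≤ d ∧ HasDerivAt (fun w => Real.cos (β / 2) ^ 2 *
      (Real.sin (w * (a₃ / 2)) / Real.cos (w * (a₃ / 2)))) d w := by
    rcases hp with hp | hp
    · exact ⟨0, le_rfl, by simpa [hp] using hasDerivAt_const w (0 : ℝ)⟩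
    · refine ⟨_, ?_, (hs.div hc hp).const_mul _⟩
      refine mul_nonneg (sq_nonneg _) (div_nonneg ?_ (sq_nonneg _))
      nlinarith
  have e2 : ∃ d, d ≤ 0 ∧ HasDerivAt (fun w => Real.sin (β / 2) ^ 2 *
      (Real.cos (w * (a₃ / 2)) / Real.sin (w * (a₃ / 2)))) d w := by
    rcases hq with hq | hq
    · exact ⟨0, le_rfl, by simpa [hq] using hasDerivAt_const w (0 : ℝ)⟩
    · refine ⟨_, ?_, (hc.div hs hq).const_mul _⟩
      refine mul_nonpos_of_nonneg_of_nonpos (sq_nonneg _)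
        (div_nonpos_of_nonpos_of_nonneg ?_ (sq_nonneg _))
      nlinarith
  obtain ⟨d1, hd1, e1⟩ := e1
  obtain ⟨d2, hd2, e2⟩ := e2
  exact ⟨d1 - d2, by linarith, e1.sub e2⟩

/-- The derivative is `-a (1 ± cos (w a)) / sin (w a) ^ 2`, with the sign of `sin (w a)`. -/
theorem hasDerivAt_upperSlope (ha : 0 < a) (h : Real.sin (w * a) ≠ 0) :
    ∃ d, d ≤ 0 ∧ HasDerivAt (upperSlope a) d w := by
  have hs : HasDerivAt (fun w => Real.sin (w * a)) (Real.cos (w * a) * a) w := by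
    simpa using ((hasDerivAt_id w).mul_const a).sin
  have hc : HasDerivAt (fun w => Real.cos (w * a)) (-Real.sin (w * a) * a) w := by
    simpa using ((hasDerivAt_id w).mul_const a).cos
  have h4 := Real.sin_sq_add_cos_sq (w * a)
  have h6 := Real.neg_one_le_cos (w * a)
  have h7 := Real.cos_le_one (w * a)
  have habs : HasDerivAt (fun w => |Real.sin (w * a)|)
      (SignType.sign (Real.sin (w * a)) * (Real.cos (w * a) * a)) w :=
    HasDerivAt.comp w (h₂ := fun x : ℝ => |x|) (hasDerivAt_abs h) hs
  refine ⟨_, ?_, (hc.div hs h).add ((hasDerivAt_const w 1).div habs (abs_ne_zero.mpr h))⟩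
  rw [sq_abs, ← add_div]
  refine div_nonpos_of_nonpos_of_nonneg ?_ (sq_nonneg _)
  rcases lt_or_gt_of_ne h with hn | hn
  · simp only [sign_neg hn, SignType.coe_neg_one]
    nlinarith
  · simp only [sign_pos hn, SignType.coe_one]
    nlinarith

theorem hasDerivAt_lowerSlope (ha : 0 < a) (h : Real.sin (w * a) ≠ 0) :
    ∃ d, d ≤ 0 ∧ HasDerivAt (lowerSlope a) d w := by
  have h' : Real.sin (-w * a) ≠ 0 := by simpa [neg_mul] using h
  obtain ⟨d, hd, hu⟩ := hasDerivAt_upperSlope ha h'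
  refine ⟨d, hd, ?_⟩
  have h1 := HasDerivAt.neg (HasDerivAt.comp w hu (hasDerivAt_neg w))
  rw [mul_neg_one, neg_neg] at h1
  refine h1.congr_of_eventuallyEq (Eventually.of_forall fun x => ?_)
  simp [upperSlope_neg]

theorem continuousAt_verticalSlope (hp : ¬IsPole a₃ β w) (ha₃ : 0 < a₃) :
    ContinuousAt (verticalSlope a₃ β) w :=
  (hasDerivAt_verticalSlope hp ha₃).choose_spec.2.continuousAt

theorem eventually_sin_ne_zero (ha : a ≠ 0) (q : ℝ) : ∀ᶠ w in 𝓝[≠] q, Real.sin (w * a) ≠ 0 := by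
  have hs : HasDerivAt (fun w => Real.sin (w * a)) (Real.cos (q * a) * a) q := by
    simpa using ((hasDerivAt_id q).mul_const a).sin
  by_cases h : Real.sin (q * a) = 0
  · refine hs.eventually_ne (mul_ne_zero (fun hc => ?_) ha)
    have := Real.sin_sq_add_cos_sq (q * a)
    rw [h, hc] at this
    norm_num at this
  · exact (hs.continuousAt.eventually_ne h).filter_mono nhdsWithin_le_nhds

theorem eventually_not_isPole (ha₃ : a₃ ≠ 0) (q : ℝ) : ∀ᶠ w in 𝓝[≠] q, ¬IsPole a₃ β w := by
  filter_upwards [eventually_sin_ne_zero ha₃ q] with w hw hp using hw hp.1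

end

section

variable {a a₁ a₂ a₃ β w q b t : ℝ}

/-! ### Behaviour near poles -/

theorem cos_sq_of_sin_eq_zero {x : ℝ} (h : Real.sin x = 0) : Real.cos x * Real.cos x = 1 := by
  have := Real.sin_sq_add_cos_sq x
  rw [h] at this
  linarith

theorem tendsto_neg_left (q : ℝ) : Tendsto (fun w : ℝ => -w) (𝓝[<] q) (𝓝[>] (-q)) :=
  tendsto_nhdsWithin_iff.mpr ⟨(continuous_neg.tendsto q).mono_left nhdsWithin_le_nhds,
    eventually_mem_nhdsWithin.mono fun _ hw => neg_lt_neg (mem_Iio.mp hw)⟩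

/-- At a zero `q` of the sine, `cos (q a) = ±1`, and this factor turns `sin (w a)`, `cos (w a)` into
the sine and cosine of `(w - q) a`. On a window of length `1 / a` this angle lies in `(0, 1)`, where
both are positive. -/
theorem eventually_shift (ha : 0 < a) (hq : Real.sin (q * a) = 0) :
    ∀ᶠ w in 𝓝[>] q, 0 < Real.cos (q * a) * Real.sin (w * a) ∧
      0 < Real.cos (q * a) * Real.cos (w * a) := by
  have hc := cos_sq_of_sin_eq_zero hq
  have hlt : q < q + 1 / a := by have := one_div_pos.mpr ha; linarith
  filter_upwards [Ioo_mem_nhdsGT hlt] with w hw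
  have hpos : 0 < (w - q) * a := mul_pos (by linarith [hw.1]) ha
  have hone : (w - q) * a < 1 := by
    have : w - q < 1 / a := by linarith [hw.2]
    rwa [lt_div_iff₀ ha] at this
  have hpi := Real.pi_gt_three
  have e : w * a = q * a + (w - q) * a := by ring
  rw [e, Real.sin_add, Real.cos_add, hq]
  have h1 : Real.cos (q * a) * (0 * Real.cos ((w - q) * a) +
      Real.cos (q * a) * Real.sin ((w - q) * a)) = Real.sin ((w - q) * a) := by
    linear_combination Real.sin ((w - q) * a) * hc
  have h2 : Real.cos (q * a) * (Real.cos (q * a) * Real.cos ((w - q) * a) -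
      0 * Real.sin ((w - q) * a)) = Real.cos ((w - q) * a) := by
    linear_combination Real.cos ((w - q) * a) * hc
  rw [h1, h2]
  exact ⟨Real.sin_pos_of_pos_of_lt_pi hpos (by linarith),
    Real.cos_pos_of_mem_Ioo ⟨by linarith, by linarith⟩⟩

theorem tendsto_inv_sin (ha : 0 < a) (hq : Real.sin (q * a) = 0) :
    Tendsto (fun w => (Real.cos (q * a) * Real.sin (w * a))⁻¹) (𝓝[>] q) atTop := by
  have hcont : Continuous fun w => Real.cos (q * a) * Real.sin (w * a) := by fun_prop
  have h1 := (hcont.tendsto q).mono_left (nhdsWithin_le_nhds (s := Ioi q))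
  simp only [hq, mul_zero] at h1
  exact Tendsto.inv_tendsto_nhdsGT_zero (tendsto_nhdsWithin_iff.mpr
    ⟨h1, (eventually_shift ha hq).mono fun w hw => hw.1⟩)

theorem abs_eq_mul_of_sq {κ x : ℝ} (h : κ * κ = 1) (hx : 0 < κ * x) : |x| = κ * x := by
  rw [← abs_of_pos hx, abs_mul]
  have : |κ| = 1 := by
    have h1 := abs_mul_abs_self κ
    rw [h] at h1
    have h2 := abs_nonneg κ
    nlinarith
  rw [this, one_mul]

/-- With `κ = cos (q a)`, the function equals `(κ cos (w a) + 1) / (κ sin (w a))` to the right of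
`q`; the numerator tends to 2 and the denominator to 0 from above. -/
theorem tendsto_upperSlope (ha : 0 < a) (hq : Real.sin (q * a) = 0) :
    Tendsto (upperSlope a) (𝓝[>] q) atTop := by
  have hc := cos_sq_of_sin_eq_zero hq
  have hcont : Continuous fun w => Real.cos (q * a) * Real.cos (w * a) + 1 := by fun_prop
  have h1 := (hcont.tendsto q).mono_left (nhdsWithin_le_nhds (s := Ioi q))
  refine (Tendsto.pos_mul_atTop (by rw [hc]; norm_num) h1 (tendsto_inv_sin ha hq)).congr' ?_
  filter_upwards [eventually_shift ha hq] with w hw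
  have hs : Real.sin (w * a) ≠ 0 := fun h => by simp [h] at hw
  have hk : Real.cos (q * a) ≠ 0 := fun h => by simp [h] at hw
  rw [upperSlope, abs_eq_mul_of_sq hc hw.1]
  field_simp

/-- To the right of a zero of the sine the singularities of `cot` and `1/|sin|` cancel: with `x = (w
- q) a` the value is `(cos x - 1) / sin x ≥ -1`, because `sin x + cos x ≥ 1` for small `x > 0`. At
other points continuity suffices. -/
theorem eventually_lowerSlope_ge (ha : 0 < a) (q : ℝ) :
    ∀ᶠ w in 𝓝[>] q, lowerSlope a q - 1 ≤ lowerSlope a w := by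
  by_cases hq : Real.sin (q * a) = 0
  · have hc := cos_sq_of_sin_eq_zero hq
    filter_upwards [eventually_shift ha hq] with w hw
    have hs : Real.sin (w * a) ≠ 0 := fun h => by simp [h] at hw
    have hk : Real.cos (q * a) ≠ 0 := fun h => by simp [h] at hw
    refine le_trans (by linarith [lowerSlope_nonpos a q] : _ ≤ (-1 : ℝ)) ?_
    have e : lowerSlope a w = (Real.cos (q * a) * Real.cos (w * a) - 1) /
        (Real.cos (q * a) * Real.sin (w * a)) := by
      rw [lowerSlope, abs_eq_mul_of_sq hc hw.1]
      generalize Real.cos (q * a) = κ at hk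
      generalize Real.sin (w * a) = s at hs
      field_simp
    rw [e, le_div_iff₀ hw.1]
    have h4 := Real.sin_sq_add_cos_sq (w * a)
    have h5 : (Real.cos (q * a) * Real.sin (w * a)) ^ 2 +
        (Real.cos (q * a) * Real.cos (w * a)) ^ 2 = 1 := by
      linear_combination Real.cos (q * a) * Real.cos (q * a) * h4 + hc
    nlinarith [mul_pos hw.1 hw.2]
  · obtain ⟨d, -, hd⟩ := hasDerivAt_lowerSlope ha hq
    refine ((hd.continuousAt.eventually_const_lt (sub_one_lt _)).filter_mono
      nhdsWithin_le_nhds).mono fun w hw => hw.le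

/-- With `κ = cos (q a₃) = ±1` and `cos β ≠ κ`, the numerator multiplied by `κ` tends to `κ cos β -
1 < 0`, while `κ sin (w a₃)` tends to 0 from above. -/
theorem IsPole.tendsto_verticalSlope_right (ha₃ : 0 < a₃) (hp : IsPole a₃ β q) :
    Tendsto (verticalSlope a₃ β) (𝓝[>] q) atBot := by
  have hc := cos_sq_of_sin_eq_zero hp.1
  have hcont : Continuous fun w => Real.cos (q * a₃) * (Real.cos β - Real.cos (w * a₃)) := by
    fun_prop
  have h1 := (hcont.tendsto q).mono_left (nhdsWithin_le_nhds (s := Ioi q))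
  have hneg : Real.cos (q * a₃) * (Real.cos β - Real.cos (q * a₃)) < 0 := by
    have h2 := Real.neg_one_le_cos β
    have h3 := Real.cos_le_one β
    have h4 := hp.2
    have h5 : (Real.cos (q * a₃) - 1) * (Real.cos (q * a₃) + 1) = 0 := by linarith
    rcases mul_eq_zero.mp h5 with h | h
    · have h6 : Real.cos (q * a₃) = 1 := by linarith
      rw [h6] at h4 ⊢
      have := lt_of_le_of_ne h3 h4
      linarith
    · have h6 : Real.cos (q * a₃) = -1 := by linarith
      rw [h6] at h4 ⊢
      have := lt_of_le_of_ne h2 h4.symm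
      linarith
  refine (Tendsto.neg_mul_atTop hneg h1 (tendsto_inv_sin ha₃ hp.1)).congr' ?_
  filter_upwards [eventually_shift ha₃ hp.1] with w hw
  have hs : Real.sin (w * a₃) ≠ 0 := fun h => by simp [h] at hw
  have hk : Real.cos (q * a₃) ≠ 0 := fun h => by simp [h] at hw
  rw [← sin_mul_verticalSlope (fun h => hs h.1)]
  generalize Real.cos (q * a₃) = κ at hk
  generalize Real.sin (w * a₃) = s at hs
  field_simp

theorem IsPole.tendsto_verticalSlope_left (ha₃ : 0 < a₃) (hp : IsPole a₃ β q) :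
    Tendsto (verticalSlope a₃ β) (𝓝[<] q) atTop := by
  have := (hp.neg.tendsto_verticalSlope_right ha₃).comp (tendsto_neg_left q)
  refine (tendsto_neg_atBot_atTop.comp this).congr fun w => ?_
  simp [verticalSlope_neg]

theorem nhdsGT_le_nhdsNE' (q : ℝ) : 𝓝[>] q ≤ 𝓝[≠] q :=
  nhdsWithin_mono _ fun _ hw => ne_of_gt hw

/-- There is a gap to the right of each pole. -/
theorem IsPole.eventually_right (ha₁ : 0 < a₁) (ha₂ : 0 < a₂) (ha₃ : 0 < a₃)
    (hp : IsPole a₃ β q) : ∀ᶠ w in 𝓝[>] q, ¬IsBandFrequency a₁ a₂ a₃ β w := by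
  filter_upwards [nhdsGT_le_nhdsNE' q (eventually_sin_ne_zero ha₁.ne' q),
    nhdsGT_le_nhdsNE' q (eventually_sin_ne_zero ha₂.ne' q),
    nhdsGT_le_nhdsNE' q (eventually_not_isPole (β := β) ha₃.ne' q),
    eventually_lowerSlope_ge ha₁ q, eventually_lowerSlope_ge ha₂ q,
    (hp.tendsto_verticalSlope_right ha₃).eventually_lt_atBot
      (lowerSlope a₁ q - 1 + (lowerSlope a₂ q - 1))] with w h1 h2 h3 h4 h5 h6
  rw [isBandFrequency_iff h1 h2 h3]
  exact fun h => by linarith [h.1]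

/-- There is a gap to the left of each pole. -/
theorem IsPole.eventually_left (ha₁ : 0 < a₁) (ha₂ : 0 < a₂) (ha₃ : 0 < a₃)
    (hp : IsPole a₃ β q) : ∀ᶠ w in 𝓝[<] q, ¬IsBandFrequency a₁ a₂ a₃ β w :=
  ((tendsto_neg_left q).eventually (hp.neg.eventually_right ha₁ ha₂ ha₃)).mono
    fun _ hw => fun h => hw (isBandFrequency_neg.mpr h)

/-- The set of band frequencies is closed. -/
theorem eventually_not_isBandFrequency (ha₁ : 0 < a₁) (ha₂ : 0 < a₂) (ha₃ : 0 < a₃)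
    (hq : ¬IsBandFrequency a₁ a₂ a₃ β q) : ∀ᶠ w in 𝓝 q, ¬IsBandFrequency a₁ a₂ a₃ β w := by
  by_cases hp : IsPole a₃ β q
  · rw [← nhdsNE_sup_pure q, eventually_sup, ← Iio_union_Ioi, nhdsWithin_union, eventually_sup]
    exact ⟨⟨hp.eventually_left ha₁ ha₂ ha₃, hp.eventually_right ha₁ ha₂ ha₃⟩, hq⟩
  have h1 : Real.sin (q * a₁) ≠ 0 := fun h => hq (Or.inl h)
  have h2 : Real.sin (q * a₂) ≠ 0 := fun h => hq (Or.inr (Or.inl h))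
  have hv := continuousAt_verticalSlope hp ha₃
  have hpe : ∀ᶠ w in 𝓝 q, ¬IsPole a₃ β w := by
    rw [← nhdsNE_sup_pure q, eventually_sup]
    exact ⟨eventually_not_isPole ha₃.ne' q, hp⟩
  have e1 : ∀ᶠ w in 𝓝 q, Real.sin (w * a₁) ≠ 0 :=
    (by fun_prop : Continuous fun w => Real.sin (w * a₁)).continuousAt.eventually_ne h1
  have e2 : ∀ᶠ w in 𝓝 q, Real.sin (w * a₂) ≠ 0 :=
    (by fun_prop : Continuous fun w => Real.sin (w * a₂)).continuousAt.eventually_ne h2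
  rcases lt_or_lt_of_not_isBandFrequency hq hp with h | h
  · obtain ⟨_, -, d1⟩ := hasDerivAt_lowerSlope ha₁ h1
    obtain ⟨_, -, d2⟩ := hasDerivAt_lowerSlope ha₂ h2
    filter_upwards [hpe, e1, e2, hv.eventually_lt (d1.continuousAt.add d2.continuousAt) h]
      with w h3 h4 h5 h6
    rw [isBandFrequency_iff h4 h5 h3]
    exact fun h => h6.not_ge h.1
  · obtain ⟨_, -, d1⟩ := hasDerivAt_upperSlope ha₁ h1
    obtain ⟨_, -, d2⟩ := hasDerivAt_upperSlope ha₂ h2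
    filter_upwards [hpe, e1, e2,
      ContinuousAt.eventually_lt (d1.continuousAt.add d2.continuousAt) hv h] with w h3 h4 h5 h6
    rw [isBandFrequency_iff h4 h5 h3]
    exact fun h => h6.not_ge h.2

/-! ### Gaps in terms of frequencies -/

/-- Between two poles there is a band frequency. -/
theorem IsPole.exists_isBandFrequency (ha₃ : 0 < a₃) {p : ℝ} (hp : IsPole a₃ β p)
    (hq : IsPole a₃ β q) (hpq : p < q) : ∃ w ∈ Icc p q, IsBandFrequency a₁ a₂ a₃ β w := by
  obtain ⟨m, hm⟩ := Real.sin_eq_zero_iff.mp hp.1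
  obtain ⟨n, hn⟩ := Real.sin_eq_zero_iff.mp hq.1
  have hmn : (m : ℝ) + 1 ≤ n := by
    have h1 : (m : ℝ) * Real.pi < n * Real.pi := by
      rw [hm, hn]
      exact mul_lt_mul_of_pos_right hpq ha₃
    have h2 : (m : ℝ) < n := lt_of_mul_lt_mul_right h1 Real.pi_pos.le
    exact_mod_cast Int.add_one_le_iff.mpr (by exact_mod_cast h2)
  -- Zeros of `sin (w a₃)` are at least `π / a₃` apart, and over one such step `cos (w a₃)` passes
  -- from one of the values `±1` to the other, taking the value `cos β`.
  have hle : p + Real.pi / a₃ ≤ q := by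
    have h3 : (p + Real.pi / a₃) * a₃ ≤ q * a₃ := by
      rw [add_mul, div_mul_cancel₀ _ ha₃.ne', ← hm, ← hn]
      nlinarith [Real.pi_pos]
    exact le_of_mul_le_mul_right h3 ha₃
  have hpi : 0 < Real.pi / a₃ := div_pos Real.pi_pos ha₃
  have hcont : ContinuousOn (fun w => Real.cos (w * a₃)) (uIcc p (p + Real.pi / a₃)) := by fun_prop
  have hmem : Real.cos β ∈ uIcc (Real.cos (p * a₃)) (Real.cos ((p + Real.pi / a₃) * a₃)) := by
    have h2 := Real.neg_one_le_cos β
    have h3 := Real.cos_le_one β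
    rw [add_mul, div_mul_cancel₀ _ ha₃.ne', Real.cos_add_pi]
    have h5 : (Real.cos (p * a₃) - 1) * (Real.cos (p * a₃) + 1) = 0 := by
      linarith [cos_sq_of_sin_eq_zero hp.1]
    rw [mem_uIcc]
    rcases mul_eq_zero.mp h5 with h | h
    · right; constructor <;> linarith
    · left; constructor <;> linarith
  obtain ⟨w, hw, hwe⟩ := intermediate_value_uIcc hcont hmem
  rw [uIcc_of_le (by linarith)] at hw
  exact ⟨w, ⟨hw.1, hw.2.trans hle⟩, isBandFrequency_of_cos_eq hwe⟩

/-- Without poles, `verticalSlope` stays on one side of the band throughout a gap. -/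
theorem side_of_gap (ha₃ : 0 < a₃) {p q : ℝ}
    (hgap : ∀ w ∈ Ioo p q, ¬IsBandFrequency a₁ a₂ a₃ β w) (hpole : ∀ w ∈ Ioo p q, ¬IsPole a₃ β w) :
    (∀ w ∈ Ioo p q, verticalSlope a₃ β w < lowerSlope a₁ w + lowerSlope a₂ w) ∨
      ∀ w ∈ Ioo p q, upperSlope a₁ w + upperSlope a₂ w < verticalSlope a₃ β w := by
  by_contra! hc
  obtain ⟨⟨x, hx, hx'⟩, ⟨y, hy, hy'⟩⟩ := hc
  have h1 := (lt_or_lt_of_not_isBandFrequency (hgap x hx) (hpole x hx)).resolve_left hx'.not_gt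
  have h2 := (lt_or_lt_of_not_isBandFrequency (hgap y hy) (hpole y hy)).resolve_right hy'.not_gt
  -- Above the band at `x` and below it at `y`, the function would vanish somewhere in the gap; but
  -- 0 lies in the band.
  have h0 : (0 : ℝ) ∈ Icc (verticalSlope a₃ β y) (verticalSlope a₃ β x) :=
    ⟨by linarith [lowerSlope_nonpos a₁ y, lowerSlope_nonpos a₂ y],
      by linarith [upperSlope_nonneg a₁ x, upperSlope_nonneg a₂ x]⟩
  obtain ⟨z, hz, hz'⟩ := isPreconnected_Ioo.intermediate_value hy hx
    (fun w hw => (continuousAt_verticalSlope (hpole w hw) ha₃).continuousWithinAt) h0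
  rcases lt_or_lt_of_not_isBandFrequency (hgap z hz) (hpole z hz) with h | h
  · linarith [lowerSlope_nonpos a₁ z, lowerSlope_nonpos a₂ z]
  · linarith [upperSlope_nonneg a₁ z, upperSlope_nonneg a₂ z]

/-- To the right of `b` the upper edge tends to infinity, whereas `verticalSlope` stays bounded, or
tends to minus infinity if `b` is a pole. -/
theorem eventually_verticalSlope_le (ha₁ : 0 < a₁) (ha₂ : 0 < a₂) (ha₃ : 0 < a₃)
    (hb : Real.sin (b * a₁) = 0 ∨ Real.sin (b * a₂) = 0) :
    ∀ᶠ w in 𝓝[>] b, verticalSlope a₃ β w ≤ upperSlope a₁ w + upperSlope a₂ w := by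
  have h1 : ∀ᶠ w in 𝓝[>] b, verticalSlope a₃ β b + 1 ≤ upperSlope a₁ w + upperSlope a₂ w := by
    rcases hb with h | h
    · filter_upwards [(tendsto_upperSlope ha₁ h).eventually_ge_atTop (verticalSlope a₃ β b + 1)]
        with w hw
      linarith [upperSlope_nonneg a₂ w]
    · filter_upwards [(tendsto_upperSlope ha₂ h).eventually_ge_atTop (verticalSlope a₃ β b + 1)]
        with w hw
      linarith [upperSlope_nonneg a₁ w]
  by_cases hp : IsPole a₃ β b
  · filter_upwards [(hp.tendsto_verticalSlope_right ha₃).eventually_le_atBot 0] with w hw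
    linarith [upperSlope_nonneg a₁ w, upperSlope_nonneg a₂ w]
  · filter_upwards [h1, ((continuousAt_verticalSlope hp ha₃).eventually_lt_const
      (lt_add_one _)).filter_mono nhdsWithin_le_nhds] with w hw hw'
    linarith

/-- A gap that begins at a zero of `sin (w a₁)` or `sin (w a₂)` lies below the band. -/
theorem gap_of_left (ha₁ : 0 < a₁) (ha₂ : 0 < a₂) (ha₃ : 0 < a₃)
    (hgap : ∀ w ∈ Ioo b t, ¬IsBandFrequency a₁ a₂ a₃ β w)
    (hb : Real.sin (b * a₁) = 0 ∨ Real.sin (b * a₂) = 0) :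
    ∀ w ∈ Ioo b t, ¬IsPole a₃ β w ∧ verticalSlope a₃ β w < lowerSlope a₁ w + lowerSlope a₂ w := by
  -- Formulated for initial segments of the gap, so that it applies up to a supposed pole before
  -- poles have been excluded.
  have key : ∀ q, b < q → q ≤ t → (∀ w ∈ Ioo b q, ¬IsPole a₃ β w) →
      ∀ w ∈ Ioo b q, verticalSlope a₃ β w < lowerSlope a₁ w + lowerSlope a₂ w := by
    intro q hbq hqt hpole
    refine (side_of_gap ha₃ (fun w hw => hgap w ⟨hw.1, hw.2.trans_le hqt⟩) hpole).resolve_right ?_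
    intro h
    obtain ⟨w, hw, hw'⟩ := ((eventually_verticalSlope_le (β := β) ha₁ ha₂ ha₃ hb).and
      (Ioo_mem_nhdsGT hbq)).exists
    exact absurd (h w hw') (not_lt.mpr hw)
  have hno : ∀ q ∈ Ioo b t, ¬IsPole a₃ β q := by
    intro q hq hp
    -- No other pole precedes `q` in the gap, as two poles enclose a band frequency. Hence
    -- `verticalSlope` is negative up to `q`, although it tends to infinity there.
    have h1 := key q hq.1 hq.2.le fun w hw hpw => by
      obtain ⟨z, hz, hz'⟩ := hpw.exists_isBandFrequency (a₁ := a₁) (a₂ := a₂) ha₃ hp hw.2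
      exact hgap z ⟨hw.1.trans_le hz.1, hz.2.trans_lt hq.2⟩ hz'
    obtain ⟨w, hw, hw'⟩ := (((hp.tendsto_verticalSlope_left ha₃).eventually_ge_atTop 0).and
      (Ioo_mem_nhdsLT hq.1)).exists
    linarith [h1 w hw', lowerSlope_nonpos a₁ w, lowerSlope_nonpos a₂ w]
  intro w hw
  exact ⟨hno w hw, key t (hw.1.trans hw.2) le_rfl hno w hw⟩

/-- A gap that ends at a zero of `sin (w a₁)` or `sin (w a₂)` lies above the band. -/
theorem gap_of_right (ha₁ : 0 < a₁) (ha₂ : 0 < a₂) (ha₃ : 0 < a₃)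
    (hgap : ∀ w ∈ Ioo b t, ¬IsBandFrequency a₁ a₂ a₃ β w)
    (ht : Real.sin (t * a₁) = 0 ∨ Real.sin (t * a₂) = 0) :
    ∀ w ∈ Ioo b t, ¬IsPole a₃ β w ∧ upperSlope a₁ w + upperSlope a₂ w < verticalSlope a₃ β w := by
  intro w hw
  -- The reflected gap begins at `-t`.
  obtain ⟨h1, h2⟩ := gap_of_left (β := β) (b := -t) (t := -b) ha₁ ha₂ ha₃
    (fun z hz h => hgap (-z) ⟨by linarith [hz.2], by linarith [hz.1]⟩ (isBandFrequency_neg.mpr h))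
    (by simpa [neg_mul] using ht) (-w) ⟨neg_lt_neg hw.2, neg_lt_neg hw.1⟩
  refine ⟨fun h => h1 h.neg, ?_⟩
  rw [verticalSlope_neg, lowerSlope_neg, lowerSlope_neg] at h2
  linarith

/-- A gap whose ends are no zeros of `sin (w a₁) sin (w a₂)` contains a pole. -/
theorem exists_isPole_of_gap (ha₁ : 0 < a₁) (ha₂ : 0 < a₂) (ha₃ : 0 < a₃) (hbt : b < t)
    (hgap : ∀ w ∈ Ioo b t, ¬IsBandFrequency a₁ a₂ a₃ β w)
    (hb : IsBandFrequency a₁ a₂ a₃ β b) (ht : IsBandFrequency a₁ a₂ a₃ β t)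
    (hb₁ : Real.sin (b * a₁) ≠ 0) (hb₂ : Real.sin (b * a₂) ≠ 0)
    (ht₁ : Real.sin (t * a₁) ≠ 0) (ht₂ : Real.sin (t * a₂) ≠ 0) :
    ∃ q ∈ Ioo b t, IsPole a₃ β q := by
  by_contra! hno
  have hbp : ¬IsPole a₃ β b := fun h => h.not_isBandFrequency hb₁ hb₂ hb
  have htp : ¬IsPole a₃ β t := fun h => h.not_isBandFrequency ht₁ ht₂ ht
  have hext : ∀ {p : ℝ → Prop}, p b → p t → (∀ w ∈ Ioo b t, p w) → ∀ w ∈ Icc b t, p w := by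
    intro p h1 h2 h3 w hw
    rcases hw.1.eq_or_lt with h | h
    · rwa [← h]
    rcases hw.2.eq_or_lt with h' | h'
    · rwa [h']
    exact h3 w ⟨h, h'⟩
  have hpole := hext (p := fun w => ¬IsPole a₃ β w) hbp htp hno
  have hs₁ := hext (p := fun w => Real.sin (w * a₁) ≠ 0) hb₁ ht₁ fun w hw h => hgap w hw (Or.inl h)
  have hs₂ := hext (p := fun w => Real.sin (w * a₂) ≠ 0) hb₂ ht₂
    fun w hw h => hgap w hw (Or.inr (Or.inl h))
  have anti : ∀ {f : ℝ → ℝ}, (∀ w ∈ Icc b t, ∃ d, d ≤ 0 ∧ HasDerivAt f d w) →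
      AntitoneOn f (Icc b t) := by
    intro f hf
    refine antitoneOn_of_deriv_nonpos (convex_Icc b t) (fun w hw => ?_) (fun w hw => ?_)
      fun w hw => ?_
    · obtain ⟨d, -, hd⟩ := hf w hw
      exact hd.continuousAt.continuousWithinAt
    · obtain ⟨d, -, hd⟩ := hf w (interior_subset hw)
      exact hd.differentiableAt.differentiableWithinAt
    · obtain ⟨d, hd', hd⟩ := hf w (interior_subset hw)
      rwa [hd.deriv]
  have hv : AntitoneOn (fun w => -verticalSlope a₃ β w) (Icc b t) := anti fun w hw => by
    obtain ⟨d, hd, h⟩ := hasDerivAt_verticalSlope (hpole w hw) ha₃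
    exact ⟨-d, by linarith, h.neg⟩
  have hl : ∀ m ∈ Icc b t, lowerSlope a₁ m + lowerSlope a₂ m ≤
      lowerSlope a₁ b + lowerSlope a₂ b := fun m hm =>
    add_le_add
      (anti (fun w hw => hasDerivAt_lowerSlope ha₁ (hs₁ w hw)) ⟨le_rfl, hbt.le⟩ hm hm.1)
      (anti (fun w hw => hasDerivAt_lowerSlope ha₂ (hs₂ w hw)) ⟨le_rfl, hbt.le⟩ hm hm.1)
  have hu : ∀ m ∈ Icc b t, upperSlope a₁ t + upperSlope a₂ t ≤
      upperSlope a₁ m + upperSlope a₂ m := fun m hm =>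
    add_le_add
      (anti (fun w hw => hasDerivAt_upperSlope ha₁ (hs₁ w hw)) hm ⟨hbt.le, le_rfl⟩ hm.2)
      (anti (fun w hw => hasDerivAt_upperSlope ha₂ (hs₂ w hw)) hm ⟨hbt.le, le_rfl⟩ hm.2)
  obtain ⟨m, hm⟩ := exists_between hbt
  have hm' : m ∈ Icc b t := ⟨hm.1.le, hm.2.le⟩
  rw [isBandFrequency_iff hb₁ hb₂ hbp] at hb
  rw [isBandFrequency_iff ht₁ ht₂ htp] at ht
  have v1 := hv ⟨le_rfl, hbt.le⟩ hm' hm.1.le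
  have v2 := hv hm' ⟨hbt.le, le_rfl⟩ hm.2.le
  simp only at v1 v2
  -- Below the band is impossible by the left end: `L m ≤ L b ≤ v b ≤ v m` for the lower edge `L`
  -- and the vertical slope `v`. Above is impossible by the right end: `v m ≤ v t ≤ U t ≤ U m`.
  rcases side_of_gap ha₃ hgap hno with h | h
  · linarith [h m hm, hl m hm', hb.1]
  · linarith [h m hm, hu m hm', ht.2]

/-- No gap begins at frequency zero. -/
theorem not_gap_zero (ha₁ : 0 < a₁) (ha₂ : 0 < a₂) (ha₃ : 0 < a₃) (ht : 0 < t)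
    (hβ : Real.cos β = 1) : ∃ w ∈ Ioo 0 t, IsBandFrequency a₁ a₂ a₃ β w := by
  by_contra! hgap
  -- Frequency 0 is a zero of the sines, so the gap would lie below the band and `verticalSlope`
  -- would be negative. But for `cos β = 1` only the tangent term remains, and it is nonnegative on
  -- `(0, π / a₃)`.
  have h := gap_of_left (β := β) ha₁ ha₂ ha₃ hgap (Or.inl (by simp))
  have hs : Real.sin (β / 2) ^ 2 = 0 := by
    have := cos_eq_half β
    have := Real.sin_sq_add_cos_sq (β / 2)
    linarith
  have hlt : 0 < min t (Real.pi / a₃) := lt_min ht (div_pos Real.pi_pos ha₃)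
  obtain ⟨w, hw0, hw⟩ := exists_between hlt
  have hw1 : w * (a₃ / 2) < Real.pi / 2 := by
    have := hw.trans_le (min_le_right _ _)
    rw [lt_div_iff₀ ha₃] at this
    linarith
  have hw2 : 0 < w * (a₃ / 2) := by positivity
  have h1 := (h w ⟨hw0, hw.trans_le (min_le_left _ _)⟩).2
  rw [verticalSlope, hs, zero_mul, sub_zero] at h1
  have h2 : 0 < Real.sin (w * (a₃ / 2)) :=
    Real.sin_pos_of_pos_of_lt_pi hw2 (by linarith [Real.pi_pos])
  have h3 : 0 < Real.cos (w * (a₃ / 2)) := Real.cos_pos_of_mem_Ioo ⟨by linarith, hw1⟩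
  have h4 : 0 ≤ Real.cos (β / 2) ^ 2 * (Real.sin (w * (a₃ / 2)) / Real.cos (w * (a₃ / 2))) := by
    positivity
  linarith [lowerSlope_nonpos a₁ w, lowerSlope_nonpos a₂ w]

end

section

variable {a a₁ a₂ a₃ β w x y : ℝ}

/-! ### The explicit part of the spectrum and the special frequencies -/

theorem sq_mem_realSpectrum (ha₁ : 0 < a₁) (ha₂ : 0 < a₂) (ha₃ : 0 < a₃) (hx : x ≠ 0)
    (h : IsBandFrequency a₁ a₂ a₃ β x) :
    x ^ 2 ∈ realSpectrum (periodicOperator a₁ a₂ a₃ β) := by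
  rcases lt_or_gt_of_ne hx with hn | hp
  · rw [← neg_sq]
    exact (sq_mem_realSpectrum_iff ha₁ ha₂ ha₃ (neg_pos.mpr hn)).mpr (isBandFrequency_neg.mpr h)
  · exact (sq_mem_realSpectrum_iff ha₁ ha₂ ha₃ hp).mpr h

theorem sq_mem_sigmaDir_iff (ha : 0 < a) (hw : 0 < w) :
    w ^ 2 ∈ sigmaDir a ↔ Real.sin (w * a) = 0 := by
  rw [Real.sin_eq_zero_iff]
  constructor
  · rintro ⟨n, -, hn⟩
    rcases sq_eq_sq_iff_eq_or_eq_neg.mp hn with h | h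
    · exact ⟨n, by rw [h]; field_simp⟩
    · exact ⟨-n, by rw [h]; push_cast; field_simp⟩
  · rintro ⟨n, hn⟩
    refine ⟨n, ?_, ?_⟩
    · rintro rfl
      have := mul_pos hw ha
      simp only [Int.cast_zero, zero_mul] at hn
      linarith
    · rw [mul_comm Real.pi, hn, mul_div_cancel_right₀ _ ha.ne']

theorem sq_mem_sigmaDir_union_iff (ha₁ : 0 < a₁) (ha₂ : 0 < a₂) (hw : 0 < w) :
    w ^ 2 ∈ sigmaDir a₁ ∪ sigmaDir a₂ ↔ Real.sin (w * a₁) = 0 ∨ Real.sin (w * a₂) = 0 := by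
  rw [mem_union, sq_mem_sigmaDir_iff ha₁ hw, sq_mem_sigmaDir_iff ha₂ hw]

theorem sigma_subset_realSpectrum (ha₁ : 0 < a₁) (ha₂ : 0 < a₂) (ha₃ : 0 < a₃) (β : ℝ) :
    sigmaDir a₁ ∪ sigmaDir a₂ ∪ sigmaThree a₃ β ⊆
      realSpectrum (periodicOperator a₁ a₂ a₃ β) := by
  have hdir : ∀ {a : ℝ}, 0 < a → ∀ n : ℤ, n ≠ 0 →
      Real.pi * n / a ≠ 0 ∧ Real.sin (Real.pi * n / a * a) = 0 := by
    intro a ha n hn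
    refine ⟨div_ne_zero (mul_ne_zero Real.pi_ne_zero (by exact_mod_cast hn)) ha.ne', ?_⟩
    rw [div_mul_cancel₀ _ ha.ne', mul_comm, Real.sin_int_mul_pi]
  have hthree : ∀ x : ℝ, Real.cos (x * a₃) = Real.cos β →
      x ^ 2 ∈ realSpectrum (periodicOperator a₁ a₂ a₃ β) := by
    intro x hx
    -- `σ₃` contains 0 when `cos β = 1`, a point that the frequency form of the dispersion relation
    -- leaves out.
    by_cases h0 : x = 0
    · rw [h0, zero_mul, Real.cos_zero] at hx
      rw [h0, zero_pow two_ne_zero]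
      exact (zero_mem_realSpectrum_iff ha₁ ha₂ ha₃).mpr hx.symm
    · exact sq_mem_realSpectrum ha₁ ha₂ ha₃ h0 (isBandFrequency_of_cos_eq hx)
  rintro t ((⟨n, hn, rfl⟩ | ⟨n, hn, rfl⟩) | ⟨n, rfl | rfl⟩)
  · exact sq_mem_realSpectrum ha₁ ha₂ ha₃ (hdir ha₁ n hn).1 (Or.inl (hdir ha₁ n hn).2)
  · exact sq_mem_realSpectrum ha₁ ha₂ ha₃ (hdir ha₂ n hn).1 (Or.inr (Or.inl (hdir ha₂ n hn).2))
  · refine hthree _ ?_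
    rw [div_mul_cancel₀ _ ha₃.ne', mul_comm (2 * Real.pi), Real.cos_add_int_mul_two_pi]
  · refine hthree _ ?_
    rw [div_mul_cancel₀ _ ha₃.ne', mul_comm (2 * Real.pi), Real.cos_add_int_mul_two_pi,
      Real.cos_neg]

theorem cos_eq_neg_one_iff_of_sin_eq_zero {z : ℝ} (hz : Real.sin z = 0) :
    Real.cos z ≠ 1 ↔ Real.cos z = -1 := by
  constructor
  · intro h
    exact (Real.sin_eq_zero_iff_cos_eq.mp hz).resolve_left h
  · intro h h'
    rw [h] at h'
    norm_num at h'

/-- For `0 < β < π` every zero of `sin (w a₃)` is a pole, since `cos β ≠ ±1`. For `β = 0` or `β = π`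
only the zeros with `cos (w a₃) = -cos β` are poles, which amounts to `cos (w a₃ - β) = -1`. -/
theorem mem_specialFrequencies_iff (ha₃ : 0 < a₃) (hβ : β ∈ Icc 0 Real.pi) :
    w ∈ specialFrequencies a₃ β ↔ 0 < w ∧ IsPole a₃ β w := by
  have hpi := Real.pi_pos
  have hcos : ∀ z : ℝ, Real.cos z = -1 → Real.sin z = 0 := fun z hz =>
    Real.sin_eq_zero_iff_cos_eq.mpr (Or.inr hz)
  rw [specialFrequencies]
  split_ifs with h
  · have key : IsPole a₃ β w ↔ Real.cos (w * a₃ - β) = -1 := by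
      rw [IsPole, Real.cos_sub]
      rcases h with rfl | rfl
      · rw [Real.cos_zero, Real.sin_zero, mul_one, mul_zero, add_zero]
        constructor
        · rintro ⟨h1, h2⟩
          exact (cos_eq_neg_one_iff_of_sin_eq_zero h1).mp h2.symm
        · intro h1
          exact ⟨hcos _ h1, by rw [h1]; norm_num⟩
      · rw [Real.cos_pi, Real.sin_pi, mul_zero, add_zero, mul_neg_one, neg_inj]
        constructor
        · rintro ⟨h1, h2⟩
          exact (Real.sin_eq_zero_iff_cos_eq.mp h1).resolve_right h2.symm
        · intro h1
          exact ⟨Real.sin_eq_zero_iff_cos_eq.mpr (Or.inl h1), by rw [h1]; norm_num⟩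
    rw [key, Real.cos_eq_neg_one_iff]
    constructor
    · rintro ⟨n, rfl⟩
      have h0 := hβ.1
      refine ⟨by positivity, n, ?_⟩
      push_cast
      field_simp
      ring
    · rintro ⟨hw, n, hn⟩
      -- For `n ≤ -1` the frequency would satisfy `w a₃ ≤ β - π ≤ 0`.
      have hn0 : 0 ≤ n := by
        by_contra! hneg
        have h1 : (n : ℝ) ≤ -1 := by exact_mod_cast Int.le_sub_one_iff.mpr hneg
        have h2 := mul_pos hw ha₃
        have h3 := hβ.2
        have : w * a₃ ≤ 0 := by nlinarith
        linarith
      lift n to ℕ using hn0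
      refine ⟨n, ?_⟩
      field_simp
      push_cast at hn
      linarith
  · push Not at h
    have hlt : 0 < β ∧ β < Real.pi := ⟨hβ.1.lt_of_ne h.1.symm, hβ.2.lt_of_ne h.2⟩
    have hsin : Real.sin β ≠ 0 := (Real.sin_pos_of_pos_of_lt_pi hlt.1 hlt.2).ne'
    have key : IsPole a₃ β w ↔ Real.sin (w * a₃) = 0 := by
      refine ⟨fun h => h.1, fun h1 => ⟨h1, fun h2 => hsin ?_⟩⟩
      rw [Real.sin_eq_zero_iff_cos_eq, h2]
      exact Real.sin_eq_zero_iff_cos_eq.mp h1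
    rw [key, Real.sin_eq_zero_iff]
    constructor
    · rintro ⟨n, hn, rfl⟩
      have h1 : (0 : ℝ) < n := by exact_mod_cast hn
      refine ⟨by positivity, n, ?_⟩
      push_cast
      field_simp
    · rintro ⟨hw, n, hn⟩
      have hn0 : 0 < n := by
        have h1 : 0 < (n : ℝ) * Real.pi := by rw [hn]; exact mul_pos hw ha₃
        exact_mod_cast pos_of_mul_pos_left h1 hpi.le
      lift n to ℕ using hn0.le
      refine ⟨n, by exact_mod_cast hn0, ?_⟩
      field_simp
      push_cast at hn
      linarith

/-! ### Gaps of the operator -/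

/-- Overlapping gaps coincide, because the ends of a gap belong to `S` and cannot lie inside the
other gap. -/
theorem IsGap.eq_of_lt {S : Set ℝ} {s t s' t' : ℝ} (h : IsGap S s t) (h' : IsGap S s' t')
    (h1 : s < t') (h2 : s' < t) : s = s' ∧ t = t' := by
  have mem : ∀ {s t}, IsGap S s t → s ∈ S ∧ t ∈ S := fun {s t} h => by
    have e1 : s ∈ Icc s t ∩ S := by rw [h.2]; exact Or.inl rfl
    have e2 : t ∈ Icc s t ∩ S := by rw [h.2]; exact Or.inr rfl
    exact ⟨e1.2, e2.2⟩
  have out : ∀ {s t}, IsGap S s t → ∀ r ∈ S, s < r → r < t → False :=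
    fun {s t} h r hr hs ht => by
      have : r ∈ Icc s t ∩ S := ⟨⟨hs.le, ht.le⟩, hr⟩
      rw [h.2] at this
      rcases this with rfl | rfl
      · exact lt_irrefl _ hs
      · exact lt_irrefl _ ht
  have hs : s = s' := by
    rcases lt_trichotomy s s' with hl | hl | hl
    · exact (out h s' (mem h').1 hl h2).elim
    · exact hl
    · exact (out h' s (mem h).1 hl h1).elim
  refine ⟨hs, ?_⟩
  rcases lt_trichotomy t t' with hl | hl | hl
  · exact (out h' t (mem h).2 (hs ▸ h.1) hl).elim
  · exact hl
  · exact (out h t' (mem h').2 (hs ▸ h'.1) hl).elim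

/-- Only finitely many gaps touch a given point. -/
theorem finite_gaps_at (S : Set ℝ) (r : ℝ) :
    {g : ℝ × ℝ | IsGap S g.1 g.2 ∧ g.1 ≤ r ∧ r ≤ g.2}.Finite := by
  -- At most one gap has `r` in its interior, at most one begins at `r` and at most one ends there.
  have h1 : {g : ℝ × ℝ | IsGap S g.1 g.2 ∧ g.1 < r ∧ r < g.2}.Subsingleton :=
    fun g hg g' hg' => Prod.ext_iff.mpr
      (hg.1.eq_of_lt hg'.1 (hg.2.1.trans hg'.2.2) (hg'.2.1.trans hg.2.2))
  have h2 : {g : ℝ × ℝ | IsGap S g.1 g.2 ∧ g.1 = r}.Subsingleton :=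
    fun g hg g' hg' => Prod.ext_iff.mpr
      (hg.1.eq_of_lt hg'.1 (by rw [hg.2, ← hg'.2]; exact hg'.1.1)
        (by rw [hg'.2, ← hg.2]; exact hg.1.1))
  have h3 : {g : ℝ × ℝ | IsGap S g.1 g.2 ∧ g.2 = r}.Subsingleton :=
    fun g hg g' hg' => Prod.ext_iff.mpr
      (hg.1.eq_of_lt hg'.1 (by rw [hg'.2, ← hg.2]; exact hg.1.1)
        (by rw [hg.2, ← hg'.2]; exact hg'.1.1))
  refine ((h1.finite.union h2.finite).union h3.finite).subset ?_
  rintro g ⟨hg, hl, hr⟩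
  rcases hl.eq_or_lt with e | hl
  · exact Or.inl (Or.inr ⟨hg, e⟩)
  rcases hr.eq_or_lt with e | hr
  · exact Or.inr ⟨hg, e.symm⟩
  · exact Or.inl (Or.inl ⟨hg, hl, hr⟩)

/-- Gaps of the operator correspond to gaps of the set of band frequencies. -/
theorem exists_frequencies_of_gap (ha₁ : 0 < a₁) (ha₂ : 0 < a₂) (ha₃ : 0 < a₃) {s t : ℝ}
    (h : IsGap (realSpectrum (periodicOperator a₁ a₂ a₃ β)) s t) :
    ∃ x y, 0 < x ∧ x < y ∧ s = x ^ 2 ∧ t = y ^ 2 ∧ IsBandFrequency a₁ a₂ a₃ β x ∧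
      IsBandFrequency a₁ a₂ a₃ β y ∧ ∀ w ∈ Ioo x y, ¬IsBandFrequency a₁ a₂ a₃ β w := by
  have hs : s ∈ Icc s t ∩ realSpectrum (periodicOperator a₁ a₂ a₃ β) := by
    rw [h.2]; exact Or.inl rfl
  have ht : t ∈ Icc s t ∩ realSpectrum (periodicOperator a₁ a₂ a₃ β) := by
    rw [h.2]; exact Or.inr rfl
  have hs0 := nonneg_of_mem_realSpectrum ha₁ ha₂ ha₃ hs.2
  have ht0 : 0 < t := hs0.trans_lt h.1
  have no : ∀ w, 0 < w → s < w ^ 2 → w ^ 2 < t → ¬IsBandFrequency a₁ a₂ a₃ β w := by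
    intro w hw h1 h2 hb
    have : w ^ 2 ∈ Icc s t ∩ realSpectrum (periodicOperator a₁ a₂ a₃ β) :=
      ⟨⟨h1.le, h2.le⟩, (sq_mem_realSpectrum_iff ha₁ ha₂ ha₃ hw).mpr hb⟩
    rw [h.2] at this
    rcases this with e | e
    · linarith [e]
    · linarith [mem_singleton_iff.mp e]
  have hy : 0 < √t := Real.sqrt_pos.mpr ht0
  have et : t = √t ^ 2 := (Real.sq_sqrt ht0.le).symm
  have hgap : ∀ w ∈ Ioo √s √t, ¬IsBandFrequency a₁ a₂ a₃ β w := by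
    intro w hw
    have hw0 : 0 < w := (Real.sqrt_nonneg s).trans_lt hw.1
    exact no w hw0 ((Real.sqrt_lt' hw0).mp hw.1) ((Real.lt_sqrt hw0.le).mp hw.2)
  -- A gap beginning at 0 is excluded by `not_gap_zero`; afterwards both ends have positive
  -- frequencies and the dispersion relation applies.
  have hspos : 0 < s := by
    refine hs0.lt_of_ne fun e => ?_
    subst e
    rw [Real.sqrt_zero] at hgap
    obtain ⟨w, hw, hb⟩ := not_gap_zero (β := β) ha₁ ha₂ ha₃ hy
      ((zero_mem_realSpectrum_iff ha₁ ha₂ ha₃).mp hs.2)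
    exact hgap w hw hb
  have hx : 0 < √s := Real.sqrt_pos.mpr hspos
  have es : s = √s ^ 2 := (Real.sq_sqrt hs0).symm
  refine ⟨√s, √t, hx, Real.sqrt_lt_sqrt hs0 h.1, es, et, ?_, ?_, hgap⟩
  · rw [← sq_mem_realSpectrum_iff ha₁ ha₂ ha₃ hx, ← es]
    exact hs.2
  · rw [← sq_mem_realSpectrum_iff ha₁ ha₂ ha₃ hy, ← et]
    exact ht.2

theorem isGap_of_frequencies (ha₁ : 0 < a₁) (ha₂ : 0 < a₂) (ha₃ : 0 < a₃) (hx : 0 < x)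
    (hxy : x < y) (hbx : IsBandFrequency a₁ a₂ a₃ β x) (hby : IsBandFrequency a₁ a₂ a₃ β y)
    (hgap : ∀ w ∈ Ioo x y, ¬IsBandFrequency a₁ a₂ a₃ β w) :
    IsGap (realSpectrum (periodicOperator a₁ a₂ a₃ β)) (x ^ 2) (y ^ 2) := by
  have hlt : x ^ 2 < y ^ 2 := pow_lt_pow_left₀ hxy hx.le two_ne_zero
  have hy := hx.trans hxy
  refine ⟨hlt, Subset.antisymm ?_ ?_⟩
  · rintro r ⟨hr, hrS⟩
    have hr0 : 0 < r := (pow_pos hx 2).trans_le hr.1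
    have hsq : r = √r ^ 2 := (Real.sq_sqrt hr0.le).symm
    have hpos : 0 < √r := Real.sqrt_pos.mpr hr0
    rw [hsq, sq_mem_realSpectrum_iff ha₁ ha₂ ha₃ hpos] at hrS
    have h1 : x ≤ √r := Real.le_sqrt_of_sq_le hr.1
    have h2 : √r ≤ y := (Real.sqrt_le_left hy.le).mpr hr.2
    rcases h1.eq_or_lt with e | h1
    · left; rw [hsq, e]
    rcases h2.eq_or_lt with e | h2
    · right; rw [mem_singleton_iff, hsq, e]
    · exact (hgap _ ⟨h1, h2⟩ hrS).elim
  · rintro r (rfl | rfl)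
    · exact ⟨⟨le_rfl, hlt.le⟩, (sq_mem_realSpectrum_iff ha₁ ha₂ ha₃ hx).mpr hbx⟩
    · exact ⟨⟨hlt.le, le_rfl⟩, (sq_mem_realSpectrum_iff ha₁ ha₂ ha₃ hy).mpr hby⟩

theorem finite_sin_zeros (ha : 0 < a) (M : ℝ) :
    {w : ℝ | w ∈ Icc 0 M ∧ Real.sin (w * a) = 0}.Finite := by
  refine ((Set.finite_Icc (0 : ℤ) ⌈M * a / Real.pi⌉).image
    fun n : ℤ => (n : ℝ) * Real.pi / a).subset ?_
  rintro w ⟨hw, hs⟩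
  obtain ⟨n, hn⟩ := Real.sin_eq_zero_iff.mp hs
  have hpi := Real.pi_pos
  refine ⟨n, ⟨?_, ?_⟩, ?_⟩
  · have h1 : 0 ≤ (n : ℝ) * Real.pi := by rw [hn]; exact mul_nonneg hw.1 ha.le
    exact_mod_cast nonneg_of_mul_nonneg_left h1 hpi
  · have h1 : (n : ℝ) ≤ M * a / Real.pi := by
      rw [le_div_iff₀ hpi, hn]
      exact mul_le_mul_of_nonneg_right hw.2 ha.le
    exact_mod_cast h1.trans (Int.le_ceil _)
  · simp only [hn]
    field_simp

/-- A closed gap of frequencies contains a zero of one of the three sines. -/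
theorem exists_sin_zero_of_gap (ha₁ : 0 < a₁) (ha₂ : 0 < a₂) (ha₃ : 0 < a₃) (hxy : x < y)
    (hbx : IsBandFrequency a₁ a₂ a₃ β x) (hby : IsBandFrequency a₁ a₂ a₃ β y)
    (hgap : ∀ w ∈ Ioo x y, ¬IsBandFrequency a₁ a₂ a₃ β w) :
    ∃ w ∈ Icc x y, Real.sin (w * a₁) = 0 ∨ Real.sin (w * a₂) = 0 ∨ Real.sin (w * a₃) = 0 := by
  by_contra! h
  have hl := h x ⟨le_rfl, hxy.le⟩
  have hr := h y ⟨hxy.le, le_rfl⟩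
  obtain ⟨q, hq, hp⟩ := exists_isPole_of_gap ha₁ ha₂ ha₃ hxy hgap hbx hby hl.1 hl.2.1 hr.1 hr.2.1
  exact (h q ⟨hq.1.le, hq.2.le⟩).2.2 hp.1

/-- Such a gap either touches `R` or ends before it. In the second case its closure contains the
square of one of the finitely many zeros in `[0, √R]` of the three sines, and each point touches
only finitely many gaps. -/
theorem finite_gaps_lt (ha₁ : 0 < a₁) (ha₂ : 0 < a₂) (ha₃ : 0 < a₃) (β R : ℝ) :
    {g : ℝ × ℝ | IsGap (realSpectrum (periodicOperator a₁ a₂ a₃ β)) g.1 g.2 ∧ g.1 < R}.Finite := by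
  set S := realSpectrum (periodicOperator a₁ a₂ a₃ β)
  have hZ := ((finite_sin_zeros ha₁ √R).union (finite_sin_zeros ha₂ √R)).union
    (finite_sin_zeros ha₃ √R)
  refine ((finite_gaps_at S R).union
    (hZ.biUnion fun w _ => finite_gaps_at S (w ^ 2))).subset ?_
  rintro g ⟨hg, hlt⟩
  rcases le_total R g.2 with hR | hR
  · exact Or.inl ⟨hg, hlt.le, hR⟩
  right
  obtain ⟨x, y, hx, hxy, hs, ht, hbx, hby, hgap⟩ := exists_frequencies_of_gap ha₁ ha₂ ha₃ hg
  obtain ⟨w, hw, hz⟩ := exists_sin_zero_of_gap ha₁ ha₂ ha₃ hxy hbx hby hgap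
  have hw0 : 0 ≤ w := hx.le.trans hw.1
  have hwR : w ∈ Icc 0 √R := by
    refine ⟨hw0, Real.le_sqrt_of_sq_le ?_⟩
    rw [ht] at hR
    exact (pow_le_pow_left₀ hw0 hw.2 2).trans hR
  refine mem_biUnion (x := w) ?_ ⟨hg, ?_, ?_⟩
  · rcases hz with h | h | h
    · exact Or.inl (Or.inl ⟨hwR, h⟩)
    · exact Or.inl (Or.inr ⟨hwR, h⟩)
    · exact Or.inr ⟨hwR, h⟩
  · rw [hs]; exact pow_le_pow_left₀ hx.le hw.1 2
  · rw [ht]; exact pow_le_pow_left₀ hw0 hw.2 2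

theorem exists_isPole_gt (ha₃ : 0 < a₃) (β M : ℝ) : ∃ q, M < q ∧ IsPole a₃ β q := by
  obtain ⟨n, hn⟩ := exists_nat_gt (M * a₃ / Real.pi)
  have hpi := Real.pi_pos
  rw [div_lt_iff₀ hpi] at hn
  have hn0 : (0 : ℝ) ≤ n * Real.pi := by positivity
  -- A zero of `sin (w a₃)` is chosen at which `cos (w a₃)` differs from `cos β`: the value there is
  -- -1 if `cos β = 1`, and 1 otherwise.
  by_cases hβ : Real.cos β = 1
  · refine ⟨(n * (2 * Real.pi) + Real.pi) / a₃, ?_, ?_, ?_⟩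
    · rw [lt_div_iff₀ ha₃]
      linarith
    · rw [div_mul_cancel₀ _ ha₃.ne', Real.sin_add_pi, ← zero_add (n * (2 * Real.pi)),
        Real.sin_add_nat_mul_two_pi, Real.sin_zero, neg_zero]
    · rw [div_mul_cancel₀ _ ha₃.ne', Real.cos_add_pi, Real.cos_nat_mul_two_pi, hβ]
      norm_num
  · refine ⟨(n * (2 * Real.pi)) / a₃, ?_, ?_, ?_⟩
    · rw [lt_div_iff₀ ha₃]
      linarith
    · rw [div_mul_cancel₀ _ ha₃.ne', ← zero_add (n * (2 * Real.pi)),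
        Real.sin_add_nat_mul_two_pi, Real.sin_zero]
    · rwa [div_mul_cancel₀ _ ha₃.ne', Real.cos_nat_mul_two_pi]

/-- There are gaps beyond every point. -/
theorem exists_gap_gt (ha₁ : 0 < a₁) (ha₂ : 0 < a₂) (ha₃ : 0 < a₃) (β : ℝ) {M : ℝ} (hM : 0 ≤ M) :
    ∃ s t, IsGap (realSpectrum (periodicOperator a₁ a₂ a₃ β)) s t ∧ M ^ 2 < t := by
  have hpi := Real.pi_pos
  -- The bound `π / a₁` leaves a positive band frequency below the gap. A point `p` slightly to the
  -- left of the pole is used because the pole itself may be a band frequency, as a zero of another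
  -- sine.
  obtain ⟨q, hq, hpole⟩ := exists_isPole_gt ha₃ β (max M (Real.pi / a₁))
  obtain ⟨p, hp, hpq⟩ := ((hpole.eventually_left ha₁ ha₂ ha₃).and (Ioo_mem_nhdsLT hq)).exists
  have hpM : M < p := (le_max_left _ _).trans_lt hpq.1
  have hp1 : Real.pi / a₁ < p := (le_max_right _ _).trans_lt hpq.1
  have hm0 : 0 < Real.pi / a₁ := div_pos hpi ha₁
  set B : Set ℝ := {w | IsBandFrequency a₁ a₂ a₃ β w}
  have hB : IsClosed B := isOpen_compl_iff.mp (isOpen_iff_mem_nhds.mpr fun w hw =>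
    eventually_not_isBandFrequency ha₁ ha₂ ha₃ hw)
  have hmB : Real.pi / a₁ ∈ B ∩ Iic p :=
    ⟨Or.inl (by rw [div_mul_cancel₀ _ ha₁.ne', Real.sin_pi]), hp1.le⟩
  obtain ⟨n, hn⟩ := exists_nat_gt (p * a₁ / Real.pi)
  have hnB : (n : ℝ) * Real.pi / a₁ ∈ B ∩ Ici p := by
    refine ⟨Or.inl (by rw [div_mul_cancel₀ _ ha₁.ne', Real.sin_nat_mul_pi]), ?_⟩
    rw [div_lt_iff₀ hpi] at hn
    rw [mem_Ici, le_div_iff₀ ha₁]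
    exact hn.le
  have hbA : BddAbove (B ∩ Iic p) := ⟨p, fun w hw => hw.2⟩
  have hbB : BddBelow (B ∩ Ici p) := ⟨p, fun w hw => hw.2⟩
  -- The nearest band frequencies on either side of `p` exist because the set of band frequencies is
  -- closed; they are the ends of the gap.
  have hx := (hB.inter isClosed_Iic).csSup_mem ⟨_, hmB⟩ hbA
  have hy := (hB.inter isClosed_Ici).csInf_mem ⟨_, hnB⟩ hbB
  have hxp : sSup (B ∩ Iic p) < p := lt_of_le_of_ne hx.2 fun e => hp (e ▸ hx.1)
  have hyp : p < sInf (B ∩ Ici p) := lt_of_le_of_ne hy.2 fun e => hp (e ▸ hy.1)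
  refine ⟨_, _, isGap_of_frequencies ha₁ ha₂ ha₃ (hm0.trans_le (le_csSup hbA hmB))
    (hxp.trans hyp) hx.1 hy.1 ?_, pow_lt_pow_left₀ (hpM.trans hyp) hM two_ne_zero⟩
  intro w hw hb
  rcases le_total w p with h | h
  · exact absurd (le_csSup hbA ⟨hb, h⟩) (not_le.mpr hw.1)
  · exact absurd (csInf_le hbB ⟨hb, h⟩) (not_le.mpr hw.2)

theorem infinite_gaps (ha₁ : 0 < a₁) (ha₂ : 0 < a₂) (ha₃ : 0 < a₃) (β : ℝ) :
    {g : ℝ × ℝ | IsGap (realSpectrum (periodicOperator a₁ a₂ a₃ β)) g.1 g.2}.Infinite := by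
  intro hfin
  obtain ⟨M, hM⟩ := (hfin.image Prod.snd).bddAbove
  obtain ⟨s, t, hg, ht⟩ := exists_gap_gt ha₁ ha₂ ha₃ β (Real.sqrt_nonneg M)
  have h1 : t ≤ M := hM ⟨(s, t), hg, rfl⟩
  have h2 : M ≤ √M ^ 2 := by
    rcases le_total 0 M with h | h
    · rw [Real.sq_sqrt h]
    · exact h.trans (sq_nonneg _)
  linarith

theorem tendsto_gap_left (ha₁ : 0 < a₁) (ha₂ : 0 < a₂) (ha₃ : 0 < a₃) (β : ℝ) :
    Tendsto (fun g : {g : ℝ × ℝ //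
      IsGap (realSpectrum (periodicOperator a₁ a₂ a₃ β)) g.1 g.2} => g.1.1) cofinite atTop := by
  refine tendsto_atTop.mpr fun R => eventually_cofinite.mpr ?_
  refine ((finite_gaps_lt ha₁ ha₂ ha₃ β R).preimage Subtype.val_injective.injOn).subset ?_
  intro g hg
  exact ⟨g.2, not_le.mp hg⟩

/-- The three kinds of gaps. -/
theorem gap_classification (ha₁ : 0 < a₁) (ha₂ : 0 < a₂) (ha₃ : 0 < a₃)
    (hβ : β ∈ Icc 0 Real.pi) (hx : 0 < x) (hxy : x < y)
    (hbx : IsBandFrequency a₁ a₂ a₃ β x) (hby : IsBandFrequency a₁ a₂ a₃ β y)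
    (hgap : ∀ w ∈ Ioo x y, ¬IsBandFrequency a₁ a₂ a₃ β w) :
    (x ^ 2 ∉ sigmaDir a₁ ∪ sigmaDir a₂ ∧ y ^ 2 ∉ sigmaDir a₁ ∪ sigmaDir a₂ ∧
        ∃! ω₀ : ℝ, ω₀ ∈ Ioo x y ∩ specialFrequencies a₃ β) ∨
      (x ^ 2 ∈ sigmaDir a₁ ∪ sigmaDir a₂ ∧ y ^ 2 ∉ sigmaDir a₁ ∪ sigmaDir a₂ ∧
        specialFrequencies a₃ β ∩ Ioo x y = ∅) ∨
      (x ^ 2 ∉ sigmaDir a₁ ∪ sigmaDir a₂ ∧ y ^ 2 ∈ sigmaDir a₁ ∪ sigmaDir a₂ ∧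
        specialFrequencies a₃ β ∩ Ioo x y = ∅) := by
  rw [sq_mem_sigmaDir_union_iff ha₁ ha₂ hx, sq_mem_sigmaDir_union_iff ha₁ ha₂ (hx.trans hxy)]
  have hempty : (∀ w ∈ Ioo x y, ¬IsPole a₃ β w) → specialFrequencies a₃ β ∩ Ioo x y = ∅ :=
    fun h => eq_empty_of_forall_notMem fun w hw =>
      h w hw.2 ((mem_specialFrequencies_iff ha₃ hβ).mp hw.1).2
  by_cases hdx : Real.sin (x * a₁) = 0 ∨ Real.sin (x * a₂) = 0 <;>
    by_cases hdy : Real.sin (y * a₁) = 0 ∨ Real.sin (y * a₂) = 0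
  -- With both ends in `σ₁ ∪ σ₂` the gap would lie below and above the band.
  · obtain ⟨m, hm⟩ := exists_between hxy
    have h1 := (gap_of_left ha₁ ha₂ ha₃ hgap hdx m hm).2
    have h2 := (gap_of_right ha₁ ha₂ ha₃ hgap hdy m hm).2
    linarith [lowerSlope_nonpos a₁ m, lowerSlope_nonpos a₂ m, upperSlope_nonneg a₁ m,
      upperSlope_nonneg a₂ m]
  · exact Or.inr (Or.inl ⟨hdx, hdy,
      hempty fun w hw => (gap_of_left ha₁ ha₂ ha₃ hgap hdx w hw).1⟩)
  · exact Or.inr (Or.inr ⟨hdx, hdy,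
      hempty fun w hw => (gap_of_right ha₁ ha₂ ha₃ hgap hdy w hw).1⟩)
  · refine Or.inl ⟨hdx, hdy, ?_⟩
    rw [not_or] at hdx hdy
    obtain ⟨q, hq, hp⟩ := exists_isPole_of_gap ha₁ ha₂ ha₃ hxy hgap hbx hby hdx.1 hdx.2
      hdy.1 hdy.2
    refine ⟨q, ⟨hq, (mem_specialFrequencies_iff ha₃ hβ).mpr ⟨hx.trans hq.1, hp⟩⟩, ?_⟩
    rintro r ⟨hr, hrW⟩
    have hrp := ((mem_specialFrequencies_iff ha₃ hβ).mp hrW).2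
    rcases lt_trichotomy r q with h | h | h
    -- A second pole in the gap would enclose a band frequency together with `q`.
    · obtain ⟨z, hz, hzb⟩ := hrp.exists_isBandFrequency (a₁ := a₁) (a₂ := a₂) ha₃ hp h
      exact (hgap z ⟨hr.1.trans_le hz.1, hz.2.trans_lt hq.2⟩ hzb).elim
    · exact h
    · obtain ⟨z, hz, hzb⟩ := hp.exists_isBandFrequency (a₁ := a₁) (a₂ := a₂) ha₃ hrp h
      exact (hgap z ⟨hq.1.trans_le hz.1, hz.2.trans_lt hr.2⟩ hzb).elim

end

end PeriodicGraph

end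

/-! ### The main theorem -/

open PeriodicGraph in
theorem lemma1 (a₁ a₂ a₃ : ℝ) (ha₁ : 0 < a₁) (ha₂ : 0 < a₂) (ha₃ : 0 < a₃) :
    -- the explicit part of the spectrum
    (∀ β : ℝ, sigmaDir a₁ ∪ sigmaDir a₂ ∪ sigmaThree a₃ β ⊆
      realSpectrum (periodicOperator a₁ a₂ a₃ β)) ∧
    -- infinitely many gaps, whose ends tend to infinity
    (∀ β ∈ Set.Icc 0 Real.pi,
      {g : ℝ × ℝ | IsGap (realSpectrum (periodicOperator a₁ a₂ a₃ β)) g.1 g.2}.Infinite ∧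
      Filter.Tendsto (fun g : {g : ℝ × ℝ //
          IsGap (realSpectrum (periodicOperator a₁ a₂ a₃ β)) g.1 g.2} => g.1.1)
        Filter.cofinite Filter.atTop ∧
      Filter.Tendsto (fun g : {g : ℝ × ℝ //
          IsGap (realSpectrum (periodicOperator a₁ a₂ a₃ β)) g.1 g.2} => g.1.2)
        Filter.cofinite Filter.atTop) ∧
    -- classification of the gaps
    (∀ β ∈ Set.Icc 0 Real.pi, ∀ s t : ℝ,
      IsGap (realSpectrum (periodicOperator a₁ a₂ a₃ β)) s t →
      ∃ ωb ωt : ℝ, 0 ≤ ωb ∧ 0 ≤ ωt ∧ s = ωb ^ 2 ∧ t = ωt ^ 2 ∧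
        ((ωb ^ 2 ∉ sigmaDir a₁ ∪ sigmaDir a₂ ∧ ωt ^ 2 ∉ sigmaDir a₁ ∪ sigmaDir a₂ ∧
            ∃! ω₀ : ℝ, ω₀ ∈ Set.Ioo ωb ωt ∩ specialFrequencies a₃ β) ∨
          (ωb ^ 2 ∈ sigmaDir a₁ ∪ sigmaDir a₂ ∧ ωt ^ 2 ∉ sigmaDir a₁ ∪ sigmaDir a₂ ∧
            specialFrequencies a₃ β ∩ Set.Ioo ωb ωt = ∅) ∨
          (ωb ^ 2 ∉ sigmaDir a₁ ∪ sigmaDir a₂ ∧ ωt ^ 2 ∈ sigmaDir a₁ ∪ sigmaDir a₂ ∧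
            specialFrequencies a₃ β ∩ Set.Ioo ωb ωt = ∅))) := by
  refine ⟨sigma_subset_realSpectrum ha₁ ha₂ ha₃, fun β _ => ⟨infinite_gaps ha₁ ha₂ ha₃ β,
    tendsto_gap_left ha₁ ha₂ ha₃ β, ?_⟩, fun β hβ s t hg => ?_⟩
  · exact Filter.tendsto_atTop_mono (fun g => g.2.1.le) (tendsto_gap_left ha₁ ha₂ ha₃ β)
  · obtain ⟨x, y, hx, hxy, hs, ht, hbx, hby, hgap⟩ := exists_frequencies_of_gap ha₁ ha₂ ha₃ hg
    exact ⟨x, y, hx.le, (hx.trans hxy).le, hs, ht,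
      gap_classification ha₁ ha₂ ha₃ hβ hx hxy hbx hby hgap⟩
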